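/- **Notation.** For $h>0$ let $\mathcal S_h$ be the ideal sampler, $(\mathcal S_hu)[n]=u(nh)$, and $\mathcal H_h$ the zero-order hold with period $h$. Let $K_{\rm c}(s)$ be a stable, proper, real-rational transfer function and $F(s)$ a stable, strictly proper, real-rational transfer function, both acting on signals on $[0,\infty)$ by convolution with their impulse responses. For $M\ge 1$ and $a=(a_0,\dots,a_{M-1})\in\mathbb R^M$ let $K(z)=\sum_{k=0}^{M-1}a_kz^{-k}$. Let ${\rm lift}(G,N)$ denote the discrete-time lifting $(\downarrow N)[1,z,\dots,z^{N-1}]^\top\, G\,[1,z^{-1},\dots,z^{-N+1}](\uparrow N)$. For $N\ge1$ put $K_N={\rm lift}(\mathcal S_{h/N}K_{\rm c}\mathcal H_{h/N},N)$, $F_N={\rm lift}(\mathcal S_{h/N}F\mathcal H_{h/N},N)$, $H_N=[1,\dots,1]^\top\in\mathbb R^{N}$, $S_N=[1,0,\dots,0]\in\mathbb R^{1\times N}$. Fix an integer $d\ge0$ (for an analog delay $e^{-mhs}$: $d=mN$, or $d=m$ if the delay is counted in the period $h$ of the lifted systems). The fast sample/hold approximation of the error system is $$E_N(z)=\bigl(z^{-d}K_N(z)-H_NK(z)S_N\bigr)F_N(z),$$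 and in the multi-rate case, with $L\ge2$, $p\ge1$, $N=Lp$, $\widetilde H_N={\rm blkdiag}(\mathbf 1_p,\dots,\mathbf 1_p)\in\mathbb R^{N\times L}$ and $\widetilde K(z)={\rm lift}(K(z),L)[1,0,\dots,0]^\top$, it is $$E_{{\rm mr},N}(z)=\bigl(z^{-d}K_N(z)-\widetilde H_N\widetilde K(z)S_N\bigr)F_N(z).$$ Let $A_K\in\mathbb R^{(M-1)\times(M-1)}$ have ones on the superdiagonal and zeros elsewhere, $B_K=[0,\dots,0,1]^\top$, $C_K=[a_{M-1},\dots,a_1]$, $D_K=a_0$. Let $\widetilde A_K=A_K^L$, $\widetilde B_K=A_K^{L-1}B_K$, let $\widetilde C_K$ have the rows $C_KA_K^{i}$ ($0\le i<L$), and let $\widetilde D_K$ have the rows $D_K,C_KB_K,\dots,C_KA_K^{L-2}B_K$. A square matrix is called Schur stable if all its eigenvalues have modulus $<1$; $\|G\|_\infty=\max_{\theta\in[0,\pi]}\sigma_{\max}(G(e^{{\rm j}\theta}))$. **Statement.** (0) $T_1(z)=z^{-d}K_N(z)F_N(z)$ and $T_2(z)=S_NF_N(z)$ have finite-dimensional realizations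 $(A_1,B_1,C_1,D_1)$ and $(A_2,B_2,C_2,0)$ with $A_1,A_2$ Schur stable, and with $D_1=0$ if $d\ge1$. (1) For all such realizations, $E_N$ has the state-space realization $$A=\begin{bmatrix}A_1&0&0\\0&A_2&0\\0&B_KC_2&A_K\end{bmatrix},\quad B=\begin{bmatrix}B_1\\B_2\\0\end{bmatrix},\quad C(a)=\begin{bmatrix}C_1&-H_ND_KC_2&-H_NC_K\end{bmatrix},\quad D(a)=D_1,$$ in which $A$ (Schur stable) and $B$ do not depend on $a$, while $C$ and $D$ are affine in $a$; as input-output maps the two systems agree, and $E_N(z)=C(a)(zI-A)^{-1}B+D(a)$ for $|z|\ge1$, where the series defining the transfer function converges. (2) For every $a\in\mathbb R^M$ the maximum in $\|E_N\|_\infty$ is attained, and for every $\gamma\in\mathbb R$ one has $\|E_N\|_\infty<\gamma$ if and only if there is a symmetric matrix $X$ with $$\begin{bmatrix}A^\top XA-X&A^\top XB&C(a)^\top\\B^\top XA&B^\top XB-\gamma I&D(a)^\top\\C(a)&D(a)&-\gamma I\end{bmatrix}<0,\qquad X>0 .$$ The block matrix is affine in $(a,X,\gamma)$, and the set of feasible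 triples $(a,X,\gamma)$ is convex. (3) Consequently, minimizing $\|E_N\|_\infty$ over $a$ is equivalent to the convex problem of minimizing $\gamma$ over the feasible triples: for each $a$, $\|E_N\|_\infty$ is the infimum of $\gamma$ over the feasible triples with first entry $a$; the infimum of $\gamma$ over all feasible triples is $\inf_a\|E_N\|_\infty$; and $a$ minimizes $\|E_N\|_\infty$ if and only if the infimum of $\gamma$ over the feasible triples with first entry $a$ equals the infimum over all feasible triples. (4) The statements (1)–(3) hold in the same way for $E_{{\rm mr},N}$, $N=Lp$, with $A_K,B_K,H_NC_K,H_ND_K$ replaced by $\widetilde A_K,\widetilde B_K,\widetilde H_N\widetilde C_K,\widetilde H_N\widetilde D_K$. -/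

import Mathlib

open scoped Matrix

noncomputable section

namespace SampledData

/-! ### Discrete-time signals and systems -/

/-- Discrete-time signals `w[0], w[1], …` with values in `ℝ^ι`. Scalar signals have `ι = Unit`. -/
abbrev Sig (ι : Type) := ℕ → ι → ℝ

/-- The delay `z⁻ʲ`, with zero initial values. -/
def delay {ι : Type} (j : ℕ) (v : Sig ι) : Sig ι :=
  fun n => if j ≤ n then v (n - j) else 0

/-- The static system `w ↦ P w`. -/
def gain {ι κ : Type} [Fintype ι] (P : Matrix κ ι ℝ) (w : Sig ι) : Sig κ :=
  fun n => P *ᵥ w n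

/-- The upsampler `↑N`: `x[0], 0, …, 0, x[1], 0, …`. -/
def upsample {ι : Type} (N : ℕ) (x : Sig ι) : Sig ι :=
  fun n => if N ∣ n then x (n / N) else 0

/-- The downsampler `↓N`: `x[0], x[N], x[2N], …`. -/
def downsample {ι : Type} (N : ℕ) (x : Sig ι) : Sig ι :=
  fun k => x (k * N)

/-- The lifting `(↓N) [1, z, …, z^(N-1)]ᵀ` (here `z` is the advance). -/
def dlift (N : ℕ) (y : Sig Unit) : Sig (Fin N) :=
  fun k i => downsample N (fun n => y (n + i)) k ()

/-- The inverse lifting `[1, z⁻¹, …, z^(-N+1)] (↑N)`. -/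
def idlift (N : ℕ) (w : Sig (Fin N)) : Sig Unit :=
  ∑ j : Fin N, delay (j : ℕ) (upsample N (fun k _ => w k j))

/-- The lifted system `lift(G, N)`. -/
def lift (N : ℕ) (G : Sig Unit → Sig Unit) : Sig (Fin N) → Sig (Fin N) :=
  fun w => dlift N (G (idlift N w))

/-- The FIR filter `K(z) = ∑_{k < M} a_k z⁻ᵏ`. -/
def fir {M : ℕ} (a : Fin M → ℝ) (v : Sig Unit) : Sig Unit :=
  ∑ k : Fin M, a k • delay (k : ℕ) v

/-- State trajectory of `x[k+1] = A x[k] + B w[k]`, `x[0] = 0`. -/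
def ssState {σ ι : Type} [Fintype σ] [Fintype ι]
    (A : Matrix σ σ ℝ) (B : Matrix σ ι ℝ) (w : Sig ι) : ℕ → σ → ℝ
  | 0 => 0
  | k + 1 => A *ᵥ ssState A B w k + B *ᵥ w k

/-- The discrete-time system with state-space matrices `A, B, C, D`. -/
def ss {σ ι κ : Type} [Fintype σ] [Fintype ι]
    (A : Matrix σ σ ℝ) (B : Matrix σ ι ℝ) (C : Matrix κ σ ℝ) (D : Matrix κ ι ℝ) :
    Sig ι → Sig κ :=
  fun w k => C *ᵥ ssState A B w k + D *ᵥ w k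

/-- Discrete-time stability: all eigenvalues lie in the open unit disc. -/
def IsSchur {σ : Type} [Fintype σ] [DecidableEq σ] (A : Matrix σ σ ℝ) : Prop :=
  ∀ μ ∈ spectrum ℂ (A.map Complex.ofReal), ‖μ‖ < 1

/-- Matrix impulse response: column `j` is the response to the unit impulse in channel `j`. -/
def impulse {ι κ : Type} [DecidableEq ι] (G : Sig ι → Sig κ) (k : ℕ) : Matrix κ ι ℝ :=
  Matrix.of fun i j => G (fun n => if n = 0 then Pi.single j 1 else 0) k i

/-- The `k`-th term `g_k z⁻ᵏ` of the transfer function of `G`. -/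
def tfTerm {ι κ : Type} [DecidableEq ι] (G : Sig ι → Sig κ) (z : ℂ) (k : ℕ) : Matrix κ ι ℂ :=
  (z ^ k)⁻¹ • (impulse G k).map Complex.ofReal

/-- The transfer function `G(z) = ∑_k g_k z⁻ᵏ`. -/
def tf {ι κ : Type} [DecidableEq ι] (G : Sig ι → Sig κ) (z : ℂ) : Matrix κ ι ℂ :=
  ∑' k, tfTerm G z k

/-- The value `C (zI - A)⁻¹ B + D`. -/
def ssTf {σ ι κ : Type} [Fintype σ] [DecidableEq σ]
    (A : Matrix σ σ ℝ) (B : Matrix σ ι ℝ) (C : Matrix κ σ ℝ) (D : Matrix κ ι ℝ) (z : ℂ) :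
    Matrix κ ι ℂ :=
  C.map Complex.ofReal * (z • (1 : Matrix σ σ ℂ) - A.map Complex.ofReal)⁻¹ *
    B.map Complex.ofReal + D.map Complex.ofReal

/-- Largest singular value: the operator norm for Euclidean norms. -/
def sigmaMax {ι κ : Type} [Fintype ι] [DecidableEq ι] [Fintype κ] (P : Matrix κ ι ℂ) : ℝ :=
  ‖LinearMap.toContinuousLinearMap (Matrix.toEuclideanLin P)‖

/-- The values `σ_max(G(e^{jθ}))`, `θ ∈ [0, π]`. -/
def gains {ι κ : Type} [Fintype ι] [DecidableEq ι] [Fintype κ] (G : Sig ι → Sig κ) : Set ℝ :=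
  (fun θ : ℝ => sigmaMax (tf G (Complex.exp (θ * Complex.I)))) '' Set.Icc 0 Real.pi

/-- The discrete-time `H^∞` norm. -/
def hinfNorm {ι κ : Type} [Fintype ι] [DecidableEq ι] [Fintype κ] (G : Sig ι → Sig κ) : ℝ :=
  sSup (gains G)

/-! ### Continuous-time systems given by real rational transfer functions -/

/-- Proper. -/
def IsProper (G : RatFunc ℝ) : Prop := G.num.degree ≤ G.denom.degree

/-- Strictly proper. -/
def IsStrictlyProper (G : RatFunc ℝ) : Prop := G.num.degree < G.denom.degree

/-- Stable: every pole has negative real part. -/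
def IsStable (G : RatFunc ℝ) : Prop :=
  ∀ s : ℂ, Polynomial.aeval s G.denom = 0 → s.re < 0

/-- The value `G(∞)` of a proper `G` (`G.denom` is monic). -/
def feedthrough (G : RatFunc ℝ) : ℝ := G.num.coeff G.denom.natDegree

/-- The function part `α` of the impulse response `G(∞) δ + α` of a stable proper `G`:
continuous on `[0, ∞)`, integrable, with Laplace transform `G(s) - G(∞)` for `Re s ≥ 0`.
These conditions determine `α` on `[0, ∞)`. -/
structure IsImpulseResponse (G : RatFunc ℝ) (α : ℝ → ℝ) : Prop where
  cont : ContinuousOn α (Set.Ici 0)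
  integrable : MeasureTheory.IntegrableOn α (Set.Ioi 0)
  laplace : ∀ s : ℂ, 0 ≤ s.re →
    ∫ t in Set.Ioi (0 : ℝ), Complex.exp (-(s * t)) * (α t : ℂ)
      = G.eval (algebraMap ℝ ℂ) s - (feedthrough G : ℂ)

/-- The inverse Laplace transform of `G(s) - G(∞)`. -/
def impulseResponse (G : RatFunc ℝ) : ℝ → ℝ :=
  Classical.epsilon (IsImpulseResponse G)

/-- The continuous-time convolution system with transfer function `G`, on signals
`u : [0, ∞) → ℝ`. -/
def ctSystem (G : RatFunc ℝ) (u : ℝ → ℝ) (t : ℝ) : ℝ :=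
  feedthrough G * u t + ∫ τ in (0 : ℝ)..t, impulseResponse G τ * u (t - τ)

/-- The ideal sampler with period `h`. -/
def sampler (h : ℝ) (u : ℝ → ℝ) : Sig Unit := fun n _ => u (n * h)

/-- The zero-order hold with period `h`. -/
def hold (h : ℝ) (ψ : Sig Unit) (t : ℝ) : ℝ :=
  ∑' n : ℕ, ψ n () * (Set.Ico 0 h).indicator (fun _ => (1 : ℝ)) (t - n * h)

/-- `lift(S_{h/N} G H_{h/N}, N)`. -/
def fastLift (h : ℝ) (N : ℕ) (G : RatFunc ℝ) : Sig (Fin N) → Sig (Fin N) :=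
  lift N (fun ψ => sampler (h / N) (ctSystem G (hold (h / N) ψ)))

/-! ### The fast sample/hold approximations of the error systems -/

/-- `H_N = [1, …, 1]ᵀ`. -/
def colOnes (N : ℕ) : Matrix (Fin N) Unit ℝ := Matrix.of fun _ _ => 1

/-- `S_N = [1, 0, …, 0]`. -/
def rowFirst (N : ℕ) : Matrix Unit (Fin N) ℝ := Matrix.of fun _ j => if (j : ℕ) = 0 then 1 else 0

/-- `blkdiag(𝟏_p, …, 𝟏_p)` with `L` blocks. -/
def blkOnes (L p : ℕ) : Matrix (Fin (L * p)) (Fin L) ℝ :=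
  Matrix.of fun i j => if (i : ℕ) / p = (j : ℕ) then 1 else 0

/-- `T₁(z) = z⁻ᵈ K_N(z) F_N(z)`. -/
def sysT1 (h : ℝ) (N d : ℕ) (Kc F : RatFunc ℝ) : Sig (Fin N) → Sig (Fin N) :=
  fun w => delay d (fastLift h N Kc (fastLift h N F w))

/-- `T₂(z) = S_N F_N(z)`. -/
def sysT2 (h : ℝ) (N : ℕ) (F : RatFunc ℝ) : Sig (Fin N) → Sig Unit :=
  fun w => gain (rowFirst N) (fastLift h N F w)

/-- Single rate: `E_N(z) = (z⁻ᵈ K_N(z) - H_N K(z) S_N) F_N(z)`, with an arbitrary delay `z⁻ᵈ`.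
For an analog delay of `m h` seconds, `d = m N` is the formula with `z^(-mN)`, and `d = m` is the
delay counted in the period `h` of the lifted systems. -/
def errSys (h : ℝ) (N d : ℕ) (Kc F : RatFunc ℝ) {M : ℕ} (a : Fin M → ℝ) :
    Sig (Fin N) → Sig (Fin N) :=
  fun w =>
    let u := fastLift h N F w
    delay d (fastLift h N Kc u) - gain (colOnes N) (fir a (gain (rowFirst N) u))

/-- The lifted filter `K̃(z) = lift(K(z), L) [1, 0, …, 0]ᵀ`. -/
def liftedFir (L : ℕ) {M : ℕ} (a : Fin M → ℝ) : Sig Unit → Sig (Fin L) :=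
  fun v => lift L (fir a) (gain (rowFirst L)ᵀ v)

/-- Multi-rate, `N = L p`: `E_{mr,N}(z) = (z⁻ᵈ K_N(z) - H̃_N K̃(z) S_N) F_N(z)`. -/
def errSysMR (h : ℝ) (L p d : ℕ) (Kc F : RatFunc ℝ) {M : ℕ} (a : Fin M → ℝ) :
    Sig (Fin (L * p)) → Sig (Fin (L * p)) :=
  fun w =>
    let u := fastLift h (L * p) F w
    delay d (fastLift h (L * p) Kc u) -
      gain (blkOnes L p) (liftedFir L a (gain (rowFirst (L * p)) u))

/-! ### State-space matrices -/

/-- `A_K`: ones on the superdiagonal. -/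
def firA (M : ℕ) : Matrix (Fin (M - 1)) (Fin (M - 1)) ℝ :=
  Matrix.of fun i j => if (j : ℕ) = (i : ℕ) + 1 then 1 else 0

/-- `B_K = [0, …, 0, 1]ᵀ`. -/
def firB (M : ℕ) : Matrix (Fin (M - 1)) Unit ℝ :=
  Matrix.of fun i _ => if (i : ℕ) + 1 = M - 1 then 1 else 0

/-- `C_K = [a_{M-1}, …, a_1]`. -/
def firC {M : ℕ} (a : Fin M → ℝ) : Matrix Unit (Fin (M - 1)) ℝ :=
  Matrix.of fun _ j => a ⟨M - 1 - j, by have := j.isLt; omega⟩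

/-- `D_K = a_0`. -/
def firD {M : ℕ} [NeZero M] (a : Fin M → ℝ) : Matrix Unit Unit ℝ :=
  Matrix.of fun _ _ => a 0

/-- `C̃_K`: the rows `C_K A_K^i`, `0 ≤ i < L`. -/
def liftedC (L : ℕ) {M : ℕ} (a : Fin M → ℝ) : Matrix (Fin L) (Fin (M - 1)) ℝ :=
  Matrix.of fun i j => (firC a * firA M ^ (i : ℕ)) () j

/-- `D̃_K`: the rows `D_K, C_K B_K, …, C_K A_K^{L-2} B_K`. -/
def liftedD (L : ℕ) {M : ℕ} [NeZero M] (a : Fin M → ℝ) : Matrix (Fin L) Unit ℝ :=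
  Matrix.of fun i _ =>
    if (i : ℕ) = 0 then firD a () () else (firC a * firA M ^ ((i : ℕ) - 1) * firB M) () ()

section blocks

variable {n₁ n₂ nK N : ℕ}

/-- The block matrix `A = [A₁ 0 0; 0 A₂ 0; 0 B_K C₂ A_K]`. -/
def blockA (A₁ : Matrix (Fin n₁) (Fin n₁) ℝ) (A₂ : Matrix (Fin n₂) (Fin n₂) ℝ)
    (C₂ : Matrix Unit (Fin n₂) ℝ) (AK : Matrix (Fin nK) (Fin nK) ℝ)
    (BK : Matrix (Fin nK) Unit ℝ) :
    Matrix (Fin n₁ ⊕ (Fin n₂ ⊕ Fin nK)) (Fin n₁ ⊕ (Fin n₂ ⊕ Fin nK)) ℝ :=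
  Matrix.fromBlocks A₁ 0 0 (Matrix.fromBlocks A₂ 0 (BK * C₂) AK)

/-- The block matrix `B = [B₁; B₂; 0]`. -/
def blockB (nK : ℕ) (B₁ : Matrix (Fin n₁) (Fin N) ℝ) (B₂ : Matrix (Fin n₂) (Fin N) ℝ) :
    Matrix (Fin n₁ ⊕ (Fin n₂ ⊕ Fin nK)) (Fin N) ℝ :=
  Matrix.fromRows B₁ (Matrix.fromRows B₂ 0)

/-- The block matrix `C = [C₁, -D_Q C₂, -C_Q]`, where `C_Q, D_Q` are the output matrices of the
FIR branch. -/
def blockC (C₁ : Matrix (Fin N) (Fin n₁) ℝ) (C₂ : Matrix Unit (Fin n₂) ℝ)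
    (CQ : Matrix (Fin N) (Fin nK) ℝ) (DQ : Matrix (Fin N) Unit ℝ) :
    Matrix (Fin N) (Fin n₁ ⊕ (Fin n₂ ⊕ Fin nK)) ℝ :=
  Matrix.fromCols C₁ (Matrix.fromCols (-(DQ * C₂)) (-CQ))

end blocks

/-! ### The linear matrix inequality and the optimization problem -/

section lmi

variable {σ : Type} [Fintype σ] [DecidableEq σ] {M N : ℕ}

/-- The symmetric matrix of the discrete-time bounded-real inequality. -/
def lmiMatrix (A : Matrix σ σ ℝ) (B : Matrix σ (Fin N) ℝ) (C : Matrix (Fin N) σ ℝ)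
    (D : Matrix (Fin N) (Fin N) ℝ) (X : Matrix σ σ ℝ) (γ : ℝ) :
    Matrix (σ ⊕ (Fin N ⊕ Fin N)) (σ ⊕ (Fin N ⊕ Fin N)) ℝ :=
  Matrix.fromBlocks
    (Aᵀ * X * A - X)
    (Matrix.fromCols (Aᵀ * X * B) Cᵀ)
    (Matrix.fromRows (Bᵀ * X * A) C)
    (Matrix.fromBlocks (Bᵀ * X * B - γ • (1 : Matrix (Fin N) (Fin N) ℝ)) Dᵀ
      D (-(γ • (1 : Matrix (Fin N) (Fin N) ℝ))))

/-- The feasible triples `(a, X, γ)`: `X > 0` and the linear matrix inequality is `< 0`. -/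
def feasible (A : Matrix σ σ ℝ) (B : Matrix σ (Fin N) ℝ)
    (C : (Fin M → ℝ) → Matrix (Fin N) σ ℝ) (D : (Fin M → ℝ) → Matrix (Fin N) (Fin N) ℝ) :
    Set ((Fin M → ℝ) × Matrix σ σ ℝ × ℝ) :=
  {q | q.2.1.PosDef ∧ (-(lmiMatrix A B (C q.1) (D q.1) q.2.1 q.2.2)).PosDef}

/-- `a` solves "minimize `γ` over the feasible triples": the infimum of `γ` over the feasible
triples with first entry `a` equals the infimum over all feasible triples. (The inequalities are
strict, so the infimum over `γ` itself is not attained.) -/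
def IsOptimalCoeff (S : Set ((Fin M → ℝ) × Matrix σ σ ℝ × ℝ)) (a : Fin M → ℝ) : Prop :=
  ∃ v : ℝ, IsGLB {γ | ∃ X, (a, X, γ) ∈ S} v ∧ IsGLB {γ | ∃ b X, (b, X, γ) ∈ S} v

/-- `A, B, C(a), D(a)` is a stable realization of the systems `E a` with `C, D` affine in `a`, and
minimizing the `H^∞` norm of `E a` over `a` is equivalent to the convex problem of minimizing `γ`
subject to the linear matrix inequality in `(a, X, γ)` and `X > 0`. -/
structure ReducesToLMI (E : (Fin M → ℝ) → Sig (Fin N) → Sig (Fin N))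
    (A : Matrix σ σ ℝ) (B : Matrix σ (Fin N) ℝ)
    (C : (Fin M → ℝ) → Matrix (Fin N) σ ℝ) (D : (Fin M → ℝ) → Matrix (Fin N) (Fin N) ℝ) :
    Prop where
  stable : IsSchur A
  affineC : ∃ f : (Fin M → ℝ) →ᵃ[ℝ] Matrix (Fin N) σ ℝ, ⇑f = C
  affineD : ∃ f : (Fin M → ℝ) →ᵃ[ℝ] Matrix (Fin N) (Fin N) ℝ, ⇑f = D
  /-- `E a` is the input-output map of the state-space system. -/
  realization : ∀ a, E a = ss A B (C a) (D a)
  /-- The transfer function of `E a` is `C(a) (zI - A)⁻¹ B + D(a)`, and its series converges. -/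
  transfer : ∀ a, ∀ z : ℂ, 1 ≤ ‖z‖ → HasSum (tfTerm (E a) z) (ssTf A B (C a) (D a) z)
  /-- The `H^∞` norm is a maximum over the frequencies. -/
  norm_attained : ∀ a, IsGreatest (gains (E a)) (hinfNorm (E a))
  kyp : ∀ a γ, hinfNorm (E a) < γ ↔ ∃ X, (a, X, γ) ∈ feasible A B C D
  /-- The matrix inequality is linear, i.e. affine in `(a, X, γ)`. -/
  affine_lmi : ∃ f : ((Fin M → ℝ) × Matrix σ σ ℝ × ℝ) →ᵃ[ℝ]
      Matrix (σ ⊕ (Fin N ⊕ Fin N)) (σ ⊕ (Fin N ⊕ Fin N)) ℝ,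
    ∀ a X γ, f (a, X, γ) = lmiMatrix A B (C a) (D a) X γ
  convex : Convex ℝ (feasible A B C D)
  value_at : ∀ a, IsGLB {γ | ∃ X, (a, X, γ) ∈ feasible A B C D} (hinfNorm (E a))
  value : IsGLB {γ | ∃ a X, (a, X, γ) ∈ feasible A B C D} (⨅ a, hinfNorm (E a))
  minimizers : ∀ a, (∀ b, hinfNorm (E a) ≤ hinfNorm (E b)) ↔
    IsOptimalCoeff (feasible A B C D) a

end lmi

end SampledData

end

/-!
Minimizing the `H^∞` norm of a sampled-data error system over the coefficients of an FIR filter is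
a convex problem because in a suitable realization only the output matrix depends on the
coefficients, and affinely so. The bounded-real lemma then turns a norm bound into a matrix
inequality that is linear in the coefficients, the Lyapunov matrix and the bound together.

*Realization.* The error system is the difference of `T₁` and the FIR branch driven by `T₂`
(`sub_gain_ss_eq_ss_block`). The FIR filter is a shift register (`fir_eq_ss`), and lifting a
scalar state-space system only iterates its state equation (`ssState_idlift`, `lift_ss`); this
also covers the multi-rate filter (`liftedFir_eq_ss`). The composite state matrix is block
triangular with Schur stable blocks.

*Bounded-real lemma* (`hinfNorm_lt_iff_exists_feasible`). No controllability is assumed. Given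
the matrix inequality, evaluate it along `z x = A x + B w` with `|z| = 1`: the terms with `X`
cancel and `|G(z) w| < γ |w|` remains (`hinfNorm_lt_of_lmi`). Conversely, let `W x` be the
supremum over all inputs and finite horizons of
`∑ₖ (γ⁻¹ |yₖ|² - γ |wₖ|² + ε (|xₖ|² + |wₖ|²))` from the initial state `x`. It is finite: Parseval's
identity on the unit circle bounds the energy of the forced response by the norm
(`sum_sqNorm_ss_le`; cutting the trajectory at time `P` costs a boundary term that vanishes as
`P → ∞`), and a Lyapunov function bounds the free response (`exists_lyapunov`). As a supremum of
costs that are quadratic in state and input jointly, `W` satisfies the parallelogram law,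
hence is a quadratic form `xᵀ X x` (`exists_quadratic_of_parallelogram`). Bellman's inequality for
`W` is the strict matrix inequality (`exists_dissipation`).

*Existence of realizations.* The strictly proper part of a stable rational transfer function has
the impulse response `C exp(tA) b` with the companion matrix `A` of the denominator; its Laplace
transform is found by integrating the differential equation, and Fourier inversion identifies it
with the impulse response of the system (`impulseResponse_eqOn`). Under a zero-order hold, sampling
gives the state matrix `exp(δA)` (`hasStableRealization_sampled`). It is Schur stable because every
eigenspace of `exp(δA)` contains an eigenvector of `A`, and series connection, delay and lifting
preserve stability.
-/

namespace SampledData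

open Matrix

/-! ### State-space systems -/

section systems

variable {σ τ ι κ μ : Type} [Fintype σ] [Fintype τ] [Fintype ι]

/-- The state is the convolution of the input with the powers of `A`. -/
theorem ssState_eq_sum [DecidableEq σ] (A : Matrix σ σ ℝ) (B : Matrix σ ι ℝ) (w : Sig ι) (k : ℕ) :
    ssState A B w k = ∑ j ∈ Finset.range k, (A ^ j * B) *ᵥ w (k - 1 - j) := by
  induction k with
  | zero => simp [ssState]
  | succ k ih =>
    rw [ssState, ih, Finset.sum_range_succ', Matrix.mulVec_sum]
    congr 1
    · refine Finset.sum_congr rfl fun j hj => ?_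
      rw [Matrix.mulVec_mulVec, ← Matrix.mul_assoc, ← pow_succ']
      congr 2
      omega
    · simp

theorem ss_gain [Fintype μ] (A : Matrix σ σ ℝ) (B : Matrix σ ι ℝ) (C : Matrix κ σ ℝ)
    (D : Matrix κ ι ℝ)
    (P : Matrix ι μ ℝ) (w : Sig μ) :
    ss A B C D (gain P w) = ss A (B * P) C (D * P) w := by
  have hx : ∀ k, ssState A B (gain P w) k = ssState A (B * P) w k := by
    intro k
    induction k with
    | zero => rfl
    | succ k ih => simp [ssState, ih, gain, Matrix.mulVec_mulVec]
  funext k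
  simp [ss, hx, gain, Matrix.mulVec_mulVec]

theorem gain_ss [Fintype κ] (A : Matrix σ σ ℝ) (B : Matrix σ ι ℝ) (C : Matrix κ σ ℝ)
    (D : Matrix κ ι ℝ)
    (P : Matrix μ κ ℝ) (w : Sig ι) :
    gain P (ss A B C D w) = ss A B (P * C) (P * D) w := by
  funext k
  simp [ss, gain, Matrix.mulVec_add, Matrix.mulVec_mulVec]

/-- The state of a cascade consists of the states of its two members. -/
theorem ssState_cascade [Fintype κ] (A₁ : Matrix σ σ ℝ) (B₁ : Matrix σ ι ℝ) (C₁ : Matrix κ σ ℝ)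
    (D₁ : Matrix κ ι ℝ) (A₂ : Matrix τ τ ℝ) (B₂ : Matrix τ κ ℝ) (w : Sig ι) (k : ℕ) :
    ssState (fromBlocks A₁ 0 (B₂ * C₁) A₂) (fromRows B₁ (B₂ * D₁)) w k =
      Sum.elim (ssState A₁ B₁ w k) (ssState A₂ B₂ (ss A₁ B₁ C₁ D₁ w) k) := by
  induction k with
  | zero => funext i; cases i <;> rfl
  | succ k ih =>
    funext i
    rw [ssState, ih, Matrix.fromBlocks_mulVec, Matrix.fromRows_mulVec]
    cases i with
    | inl i => simp [ssState]
    | inr i =>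
      simp [ssState, ss, Matrix.mulVec_add, Matrix.mulVec_mulVec]
      ring

theorem ss_cascade [Fintype κ] (A₁ : Matrix σ σ ℝ) (B₁ : Matrix σ ι ℝ) (C₁ : Matrix κ σ ℝ)
    (D₁ : Matrix κ ι ℝ) (A₂ : Matrix τ τ ℝ) (B₂ : Matrix τ κ ℝ) (C₂ : Matrix μ τ ℝ)
    (D₂ : Matrix μ κ ℝ) (w : Sig ι) :
    ss A₂ B₂ C₂ D₂ (ss A₁ B₁ C₁ D₁ w) =
      ss (fromBlocks A₁ 0 (B₂ * C₁) A₂) (fromRows B₁ (B₂ * D₁)) (fromCols (D₂ * C₁) C₂)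
        (D₂ * D₁) w := by
  funext k
  have h1 : ss (fromBlocks A₁ 0 (B₂ * C₁) A₂) (fromRows B₁ (B₂ * D₁)) (fromCols (D₂ * C₁) C₂)
      (D₂ * D₁) w k = fromCols (D₂ * C₁) C₂ *ᵥ
        Sum.elim (ssState A₁ B₁ w k) (ssState A₂ B₂ (ss A₁ B₁ C₁ D₁ w) k) +
        (D₂ * D₁) *ᵥ w k := by
    rw [← ssState_cascade]; rfl
  rw [h1, Matrix.fromCols_mulVec]
  have h2 : ss A₂ B₂ C₂ D₂ (ss A₁ B₁ C₁ D₁ w) k =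
    C₂ *ᵥ ssState A₂ B₂ (ss A₁ B₁ C₁ D₁ w) k + D₂ *ᵥ ss A₁ B₁ C₁ D₁ w k := rfl
  rw [h2]
  have h3 : ss A₁ B₁ C₁ D₁ w k = C₁ *ᵥ ssState A₁ B₁ w k + D₁ *ᵥ w k := rfl
  rw [h3]
  simp only [Sum.elim_comp_inl, Sum.elim_comp_inr, Matrix.mulVec_add, Matrix.mulVec_mulVec]
  abel

/-- Relabelling the state variables does not change the system. -/
theorem ss_reindex (e : σ ≃ τ) (A : Matrix σ σ ℝ) (B : Matrix σ ι ℝ) (C : Matrix κ σ ℝ)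
    (D : Matrix κ ι ℝ) :
    ss (A.submatrix e.symm e.symm) (B.submatrix e.symm id) (C.submatrix id e.symm) D =
      ss A B C D := by
  have hx : ∀ w k, ssState (A.submatrix e.symm e.symm) (B.submatrix e.symm id) w k =
      ssState A B w k ∘ e.symm := by
    intro w k
    induction k with
    | zero => rfl
    | succ k ih =>
      rw [ssState, ih, ssState, Matrix.submatrix_mulVec_equiv]
      funext i
      simp [Function.comp_assoc, Matrix.mulVec, dotProduct]
  funext w k
  simp only [ss, hx]
  rw [Matrix.submatrix_mulVec_equiv]
  simp [Function.comp_assoc]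

theorem delay_one_eq_ss [DecidableEq ι] (v : Sig ι) :
    delay 1 v = ss (0 : Matrix ι ι ℝ) 1 1 0 v := by
  funext k
  cases k with
  | zero => simp [delay, ss, ssState]
  | succ k => simp [delay, ss, ssState]

theorem delay_succ {ι : Type} (d : ℕ) (v : Sig ι) : delay (d + 1) v = delay 1 (delay d v) := by
  funext k
  unfold delay
  by_cases h1 : d + 1 ≤ k
  · rw [if_pos h1, if_pos (by omega), if_pos (by omega), show k - (d + 1) = k - 1 - d by omega]
  · rw [if_neg h1]
    by_cases h2 : 1 ≤ k
    · rw [if_pos h2, if_neg (by omega)]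
    · rw [if_neg h2]

@[simp] theorem delay_zero {ι : Type} (v : Sig ι) : delay 0 v = v := by
  funext k; simp [delay]

end systems

/-! ### Lifting -/

theorem idlift_apply (N : ℕ) (w : Sig (Fin N)) (k : ℕ) (i : Fin N) :
    idlift N w (k * N + i) () = w k i := by
  have hN : 0 < N := i.pos
  have hterm : ∀ j : Fin N,
      delay (j : ℕ) (upsample N (fun k (_ : Unit) => w k j)) (k * N + i) () =
        if j = i then w k i else 0 := by
    intro j
    unfold delay upsample
    by_cases hji : j = i
    · subst hji
      simp [Nat.mul_div_cancel _ hN]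
    · rw [if_neg hji]
      split_ifs with h1 h2
      · exfalso
        apply hji
        have h3 : (k * N + i - j + j) % N = (j : ℕ) % N := by
          rw [Nat.add_mod, Nat.mod_eq_zero_of_dvd h2]; simp
        rw [Nat.sub_add_cancel h1, Nat.mul_add_mod_self_right, Nat.mod_eq_of_lt i.isLt,
          Nat.mod_eq_of_lt j.isLt] at h3
        exact Fin.ext h3.symm
      · rfl
      · rfl
  simp only [idlift, Finset.sum_apply, hterm]
  simp

section lifting

variable {σ : Type} [Fintype σ] [DecidableEq σ]

/-- Input matrix of the lifting of a state-space system. -/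
def liftB (N : ℕ) (A : Matrix σ σ ℝ) (B : Matrix σ Unit ℝ) : Matrix σ (Fin N) ℝ :=
  Matrix.of fun s j => (A ^ (N - 1 - (j : ℕ)) * B) s ()

/-- Output matrix of the lifting of a state-space system. -/
def liftC (N : ℕ) (A : Matrix σ σ ℝ) (C : Matrix Unit σ ℝ) : Matrix (Fin N) σ ℝ :=
  Matrix.of fun i s => (C * A ^ (i : ℕ)) () s

/-- Direct feedthrough of the lifting of a state-space system: a lower triangular Toeplitz
matrix of impulse response coefficients. -/
def liftD (N : ℕ) (A : Matrix σ σ ℝ) (B : Matrix σ Unit ℝ) (C : Matrix Unit σ ℝ)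
    (D : Matrix Unit Unit ℝ) : Matrix (Fin N) (Fin N) ℝ :=
  Matrix.of fun i j => if j = i then D () () else
    if j < i then (C * A ^ ((i : ℕ) - 1 - (j : ℕ)) * B) () () else 0

/-- The fast state inside a frame of `N` samples, in terms of the state at the frame start. -/
theorem ssState_idlift (N : ℕ) (A : Matrix σ σ ℝ) (B : Matrix σ Unit ℝ) (w : Sig (Fin N))
    (k i : ℕ) (hi : i ≤ N) :
    ssState A B (idlift N w) (k * N + i) = A ^ i *ᵥ ssState A B (idlift N w) (k * N) +
      ∑ j : Fin N, if (j : ℕ) < i then (A ^ (i - 1 - (j : ℕ)) * B) *ᵥ (fun _ => w k j) else 0 := by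
  induction i with
  | zero => simp
  | succ i ih =>
    rw [← add_assoc, ssState, ih (by omega), Matrix.mulVec_add, Matrix.mulVec_mulVec, ← pow_succ',
      add_assoc]
    congr 1
    rw [Matrix.mulVec_sum]
    have hin : idlift N w (k * N + i) = fun _ => w k ⟨i, hi⟩ := by
      funext u
      exact idlift_apply N w k ⟨i, hi⟩
    rw [hin]
    have hsing : B *ᵥ (fun _ => w k ⟨i, hi⟩) =
        ∑ j : Fin N, if j = ⟨i, hi⟩ then B *ᵥ (fun _ => w k j) else 0 := by
      simp
    rw [hsing, ← Finset.sum_add_distrib]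
    refine Finset.sum_congr rfl fun j _ => ?_
    rcases lt_trichotomy (j : ℕ) i with hj | hj | hj
    · rw [if_pos hj, if_neg (fun h => by rw [h] at hj; exact lt_irrefl _ hj), if_pos (by omega),
        add_zero, Matrix.mulVec_mulVec, ← Matrix.mul_assoc, ← pow_succ']
      congr 3
      omega
    · have hj' : j = ⟨i, hi⟩ := Fin.ext hj
      rw [if_neg (by omega), if_pos hj', if_pos (by omega)]
      simp [hj]
    · rw [if_neg (by omega), if_neg (fun h => by rw [h] at hj; exact lt_irrefl _ hj),
        if_neg (by omega)]
      simp

theorem mulVec_unit {κ : Type} (P : Matrix κ Unit ℝ) (r : ℝ) (s : κ) :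
    (P *ᵥ fun _ => r) s = P s () * r := by
  simp [Matrix.mulVec, dotProduct]

theorem ssState_lift (N : ℕ) (A : Matrix σ σ ℝ) (B : Matrix σ Unit ℝ) (w : Sig (Fin N)) (k : ℕ) :
    ssState (A ^ N) (liftB N A B) w k = ssState A B (idlift N w) (k * N) := by
  induction k with
  | zero => simp [ssState]
  | succ k ih =>
    rw [ssState, ih, Nat.succ_mul, ssState_idlift N A B w k N le_rfl]
    congr 1
    funext s
    simp [liftB, Finset.sum_apply, Matrix.mulVec, dotProduct]

/-- The lifting of a scalar state-space system is a state-space system. -/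
theorem lift_ss (N : ℕ) (A : Matrix σ σ ℝ) (B : Matrix σ Unit ℝ) (C : Matrix Unit σ ℝ)
    (D : Matrix Unit Unit ℝ) :
    lift N (ss A B C D) = ss (A ^ N) (liftB N A B) (liftC N A C) (liftD N A B C D) := by
  funext w k i
  have h1 : lift N (ss A B C D) w k i = ss A B C D (idlift N w) (k * N + i) () := rfl
  have h2 : idlift N w (k * N + i) = fun _ => w k i := by
    funext u
    exact idlift_apply N w k i
  rw [h1]
  simp only [ss]
  rw [ssState_lift, ssState_idlift N A B w k i i.isLt.le, h2, Matrix.mulVec_add,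
    Matrix.mulVec_mulVec, Matrix.mulVec_sum, add_assoc]
  simp only [Pi.add_apply]
  congr 1
  rw [Finset.sum_apply, mulVec_unit]
  have hsing : D () () * w k i = ∑ j : Fin N, if j = i then D () () * w k j else 0 := by simp
  rw [hsing, ← Finset.sum_add_distrib]
  simp only [Matrix.mulVec, dotProduct, liftD, Matrix.of_apply]
  refine Finset.sum_congr rfl fun j _ => ?_
  rcases lt_trichotomy j i with hj | hj | hj
  · have hj' : (j : ℕ) < i := hj
    rw [if_pos hj', if_neg hj.ne, if_neg hj.ne, if_pos hj, add_zero]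
    have := mulVec_unit (C * (A ^ ((i : ℕ) - 1 - (j : ℕ)) * B)) (w k j) ()
    rw [← Matrix.mulVec_mulVec] at this
    rw [Matrix.mul_assoc, ← this]
    rfl
  · subst hj
    simp
  · have hj' : ¬ (j : ℕ) < i := fun h => absurd (Fin.lt_def.2 h) (not_lt.2 hj.le)
    rw [if_neg hj', if_neg hj.ne', if_neg hj.ne', if_neg (not_lt.2 hj.le)]
    simp

end lifting

/-! ### The FIR filter -/

/-- The state of the FIR realization is the shift register of the last `M - 1` inputs. -/
theorem ssState_fir (M : ℕ) (v : Sig Unit) (k : ℕ) (i : Fin (M - 1)) :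
    ssState (firA M) (firB M) v k i =
      if M - 1 ≤ k + i then v (k + i - (M - 1)) () else 0 := by
  induction k generalizing i with
  | zero =>
    rw [if_neg (by have := i.isLt; omega)]; rfl
  | succ k ih =>
    have hB : (firB M *ᵥ v k) i = if (i : ℕ) + 1 = M - 1 then v k () else 0 := by
      simp [firB, Matrix.mulVec, dotProduct]
    rw [ssState, Pi.add_apply, hB]
    have hA : (firA M *ᵥ ssState (firA M) (firB M) v k) i = ∑ j : Fin (M - 1),
        if (j : ℕ) = i + 1 then ssState (firA M) (firB M) v k j else 0 := by
      simp [firA, Matrix.mulVec, dotProduct]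
    rw [hA]
    by_cases hi : (i : ℕ) + 1 = M - 1
    · rw [if_pos hi, if_pos (by omega), Finset.sum_eq_zero, zero_add]
      · congr 1; omega
      · intro j _
        rw [if_neg (by have := j.isLt; omega)]
    · have hi' : (i : ℕ) + 1 < M - 1 := by have := i.isLt; omega
      rw [if_neg hi, add_zero, Finset.sum_eq_single ⟨i + 1, hi'⟩]
      · rw [if_pos rfl, ih]
        congr 1
        · simp; omega
        · simp only []
          congr 1; omega
      · intro j _ hj
        rw [if_neg]
        intro h
        exact hj (Fin.ext h)
      · intro h; exact absurd (Finset.mem_univ _) h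

theorem fir_eq_ss {M : ℕ} [NeZero M] (a : Fin M → ℝ) :
    fir a = ss (firA M) (firB M) (firC a) (firD a) := by
  obtain ⟨m, rfl⟩ : ∃ m, M = m + 1 := ⟨M - 1, by have := NeZero.pos M; omega⟩
  funext v k u
  have h0 : (0 : Fin (m + 1)) = ⟨0, by omega⟩ := Fin.ext (by simp)
  simp only [fir, Finset.sum_apply, Pi.smul_apply, smul_eq_mul]
  rw [Fin.sum_univ_succ]
  simp only [ss, Pi.add_apply]
  rw [add_comm]
  congr 1
  · simp only [firC, Matrix.mulVec, dotProduct, Matrix.of_apply, ssState_fir]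
    change _ = ∑ x : Fin m, _
    rw [← Equiv.sum_comp Fin.revPerm]
    refine Finset.sum_congr rfl fun j _ => ?_
    have hj := j.isLt
    congr 1
    · congr 1
      apply Fin.ext
      simp [Fin.val_rev]
      omega
    · simp only [delay, Fin.val_succ, Fin.revPerm_apply, Fin.val_rev]
      by_cases hk : m - (j + 1) + 1 ≤ k
      · rw [if_pos hk, if_pos (by simp; omega)]
        congr 1; simp; omega
      · rw [if_neg hk, if_neg (by simp; omega)]; rfl
  · simp [firD, Matrix.mulVec, dotProduct]

theorem liftedFir_eq_ss {L : ℕ} (hL : 0 < L) {M : ℕ} [NeZero M] (a : Fin M → ℝ) :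
    liftedFir L a = ss (firA M ^ L) (firA M ^ (L - 1) * firB M) (liftedC L a) (liftedD L a) := by
  funext v
  have h : liftedFir L a v = lift L (fir a) (gain (rowFirst L)ᵀ v) := rfl
  rw [h, fir_eq_ss, lift_ss, ss_gain]
  have hsum : ∀ f : Fin L → ℝ, (∑ j : Fin L, f j * (if (j : ℕ) = 0 then 1 else 0)) = f ⟨0, hL⟩ := by
    intro f
    rw [Finset.sum_eq_single ⟨0, hL⟩]
    · simp
    · intro j _ hj
      rw [if_neg (fun h => hj (Fin.ext h)), mul_zero]
    · intro h; exact absurd (Finset.mem_univ _) h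
  congr 1
  · ext s u
    simp only [Matrix.mul_apply (M := liftB _ _ _), rowFirst, Matrix.transpose_apply,
      Matrix.of_apply, hsum]
    simp [liftB]
  · ext i u
    simp only [Matrix.mul_apply (M := liftD _ _ _ _ _), rowFirst, Matrix.transpose_apply,
      Matrix.of_apply, hsum]
    simp only [liftD, liftedD, Matrix.of_apply]
    by_cases hi : (i : ℕ) = 0
    · rw [if_pos hi, if_pos (Fin.ext hi.symm)]
    · rw [if_neg hi, if_neg (fun h => hi (by rw [← h])), if_pos (Fin.lt_def.2 (by simp; omega))]
      simp

/-! ### Realization of the error systems -/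

section error

variable {n₁ n₂ nK N : ℕ}

theorem ssState_block (A₁ : Matrix (Fin n₁) (Fin n₁) ℝ) (B₁ : Matrix (Fin n₁) (Fin N) ℝ)
    (A₂ : Matrix (Fin n₂) (Fin n₂) ℝ) (B₂ : Matrix (Fin n₂) (Fin N) ℝ)
    (C₂ : Matrix Unit (Fin n₂) ℝ) (AK : Matrix (Fin nK) (Fin nK) ℝ)
    (BK : Matrix (Fin nK) Unit ℝ) (w : Sig (Fin N)) (k : ℕ) :
    ssState (blockA A₁ A₂ C₂ AK BK) (blockB nK B₁ B₂) w k =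
      Sum.elim (ssState A₁ B₁ w k)
        (Sum.elim (ssState A₂ B₂ w k) (ssState AK BK (ss A₂ B₂ C₂ 0 w) k)) := by
  rw [← ssState_cascade]
  induction k with
  | zero => funext i; cases i <;> rfl
  | succ k ih =>
    funext i
    rw [ssState, ih, blockA, blockB, Matrix.fromBlocks_mulVec, Matrix.fromRows_mulVec]
    cases i with
    | inl i => simp [ssState]
    | inr i => simp [ssState]

/-- Error signal between `T₁` and the FIR branch `P Q T₂`, as one state-space system. -/
theorem sub_gain_ss_eq_ss_block {κ : Type} [Fintype κ] (A₁ : Matrix (Fin n₁) (Fin n₁) ℝ)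
    (B₁ : Matrix (Fin n₁) (Fin N) ℝ)
    (C₁ : Matrix (Fin N) (Fin n₁) ℝ) (D₁ : Matrix (Fin N) (Fin N) ℝ)
    (A₂ : Matrix (Fin n₂) (Fin n₂) ℝ) (B₂ : Matrix (Fin n₂) (Fin N) ℝ)
    (C₂ : Matrix Unit (Fin n₂) ℝ) (AK : Matrix (Fin nK) (Fin nK) ℝ)
    (BK : Matrix (Fin nK) Unit ℝ) (CK : Matrix κ (Fin nK) ℝ) (DK : Matrix κ Unit ℝ)
    (P : Matrix (Fin N) κ ℝ) (w : Sig (Fin N)) :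
    ss A₁ B₁ C₁ D₁ w - gain P (ss AK BK CK DK (ss A₂ B₂ C₂ 0 w)) =
      ss (blockA A₁ A₂ C₂ AK BK) (blockB nK B₁ B₂) (blockC C₁ C₂ (P * CK) (P * DK)) D₁ w := by
  funext k
  have h1 : ss (blockA A₁ A₂ C₂ AK BK) (blockB nK B₁ B₂) (blockC C₁ C₂ (P * CK) (P * DK)) D₁ w k =
      blockC C₁ C₂ (P * CK) (P * DK) *ᵥ Sum.elim (ssState A₁ B₁ w k)
        (Sum.elim (ssState A₂ B₂ w k) (ssState AK BK (ss A₂ B₂ C₂ 0 w) k)) + D₁ *ᵥ w k := by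
    rw [← ssState_block]; rfl
  have h2 : ss A₂ B₂ C₂ 0 w k = C₂ *ᵥ ssState A₂ B₂ w k := by simp [ss]
  have h3 : gain P (ss AK BK CK DK (ss A₂ B₂ C₂ 0 w)) k =
      P *ᵥ (CK *ᵥ ssState AK BK (ss A₂ B₂ C₂ 0 w) k + DK *ᵥ ss A₂ B₂ C₂ 0 w k) := rfl
  rw [h1, Pi.sub_apply, h3, h2, blockC]
  simp only [Matrix.fromCols_mulVec, Sum.elim_comp_inl, Sum.elim_comp_inr, Matrix.mulVec_add,
    Matrix.mulVec_mulVec, Matrix.neg_mulVec, ss, Matrix.mul_assoc]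
  abel

end error

open Filter Topology

/-! ### Squared Euclidean norms -/

section sqNorm

variable {ι κ 𝕜 : Type} [Fintype ι] [Fintype κ] [RCLike 𝕜]

/-- The squared Euclidean norm of a real or complex vector. -/
noncomputable def sqNorm (v : ι → 𝕜) : ℝ := ∑ i, ‖v i‖ ^ 2

theorem sqNorm_eq_norm_sq (v : ι → 𝕜) : sqNorm v = ‖WithLp.toLp 2 v‖ ^ 2 := by
  rw [EuclideanSpace.norm_sq_eq]; rfl

theorem sqNorm_nonneg (v : ι → 𝕜) : 0 ≤ sqNorm v :=
  Finset.sum_nonneg fun _ _ => sq_nonneg _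

@[simp] theorem sqNorm_zero : sqNorm (0 : ι → 𝕜) = 0 := by simp [sqNorm]

theorem sqNorm_eq_zero {v : ι → 𝕜} : sqNorm v = 0 ↔ v = 0 := by
  rw [sqNorm_eq_norm_sq, sq_eq_zero_iff, norm_eq_zero, WithLp.toLp_eq_zero]

theorem sqNorm_pos {v : ι → 𝕜} (hv : v ≠ 0) : 0 < sqNorm v :=
  lt_of_le_of_ne (sqNorm_nonneg v) fun h => hv (sqNorm_eq_zero.1 h.symm)

theorem sqNorm_smul (c : 𝕜) (v : ι → 𝕜) : sqNorm (c • v) = ‖c‖ ^ 2 * sqNorm v := by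
  simp [sqNorm, Finset.mul_sum, mul_pow]

theorem sqNorm_parallelogram (v w : ι → 𝕜) :
    sqNorm (v + w) + sqNorm (v - w) = 2 * sqNorm v + 2 * sqNorm w := by
  have h := parallelogram_law_with_norm 𝕜 (WithLp.toLp 2 v) (WithLp.toLp 2 w)
  simp only [sqNorm_eq_norm_sq, WithLp.toLp_add, WithLp.toLp_sub]
  nlinarith [h]

/-- Young's inequality for the squared norm of a sum. -/
theorem sqNorm_add_le {η : ℝ} (hη : 0 < η) (v w : ι → 𝕜) :
    sqNorm (v + w) ≤ (1 + η) * sqNorm v + (1 + η⁻¹) * sqNorm w := by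
  simp only [sqNorm_eq_norm_sq, WithLp.toLp_add]
  set a := ‖WithLp.toLp 2 v‖
  set b := ‖WithLp.toLp 2 w‖
  have h1 : ‖WithLp.toLp 2 v + WithLp.toLp 2 w‖ ≤ a + b := norm_add_le _ _
  have h2 : ‖WithLp.toLp 2 v + WithLp.toLp 2 w‖ ^ 2 ≤ (a + b) ^ 2 :=
    pow_le_pow_left₀ (norm_nonneg _) h1 2
  have h3 : 0 ≤ η⁻¹ * (η * a - b) ^ 2 := mul_nonneg (inv_nonneg.2 hη.le) (sq_nonneg _)
  have h4 : η⁻¹ * (η * a - b) ^ 2 = η * a ^ 2 - 2 * (a * b) + η⁻¹ * b ^ 2 := by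
    field_simp
    ring
  nlinarith [h2, h3, h4]

/-- The squared Frobenius norm bounds the squared operator norm. -/
theorem sqNorm_mulVec_le (P : Matrix κ ι 𝕜) (v : ι → 𝕜) :
    sqNorm (P *ᵥ v) ≤ (∑ i, ∑ j, ‖P i j‖ ^ 2) * sqNorm v := by
  rw [sqNorm, Finset.sum_mul]
  refine Finset.sum_le_sum fun i _ => ?_
  have h1 : ‖(P *ᵥ v) i‖ ≤ ∑ j, ‖P i j‖ * ‖v j‖ := by
    refine (norm_sum_le _ _).trans (Finset.sum_le_sum fun j _ => (norm_mul_le _ _))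
  exact (pow_le_pow_left₀ (norm_nonneg _) h1 2).trans (Finset.sum_mul_sq_le_sq_mul_sq _ _ _)

theorem exists_sqNorm_mulVec_le (P : Matrix κ ι 𝕜) :
    ∃ c, 0 ≤ c ∧ ∀ v, sqNorm (P *ᵥ v) ≤ c * sqNorm v :=
  ⟨_, Finset.sum_nonneg fun _ _ => Finset.sum_nonneg fun _ _ => sq_nonneg _, sqNorm_mulVec_le P⟩

theorem sqNorm_eq_dotProduct (v : ι → ℝ) : sqNorm v = v ⬝ᵥ v := by
  simp [sqNorm, dotProduct, sq]

theorem sqNorm_ofReal (v : ι → ℝ) : sqNorm (fun i => (v i : ℂ)) = sqNorm v := by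
  simp [sqNorm]

theorem sqNorm_eq_re_add_im (v : ι → ℂ) :
    sqNorm v = sqNorm (fun i => (v i).re) + sqNorm (fun i => (v i).im) := by
  rw [sqNorm, sqNorm, sqNorm, ← Finset.sum_add_distrib]
  refine Finset.sum_congr rfl fun i _ => ?_
  rw [← Complex.normSq_eq_norm_sq, Complex.normSq_apply]
  simp [sq]

end sqNorm

/-! ### Schur stability -/

section schur

variable {σ τ : Type} [Fintype σ] [DecidableEq σ] [Fintype τ] [DecidableEq τ]

theorem mem_spectrum_iff_exists_eigenvector (P : Matrix σ σ ℂ) (μ : ℂ) :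
    μ ∈ spectrum ℂ P ↔ ∃ v : σ → ℂ, v ≠ 0 ∧ P *ᵥ v = μ • v := by
  rw [← Matrix.spectrum_toLin', ← Module.End.hasEigenvalue_iff_mem_spectrum]
  constructor
  · intro h
    obtain ⟨v, hv⟩ := h.exists_hasEigenvector
    exact ⟨v, hv.2, by simpa using hv.apply_eq_smul⟩
  · rintro ⟨v, hv, h⟩
    exact Module.End.hasEigenvalue_of_hasEigenvector
      (x := v) ⟨Module.End.mem_eigenspace_iff.2 (by simpa using h), hv⟩

/-- Schur stability through complex eigenvectors, which exist even where the real matrix has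
none. -/
theorem isSchur_iff {A : Matrix σ σ ℝ} : IsSchur A ↔
    ∀ (μ : ℂ) (v : σ → ℂ), v ≠ 0 → A.map Complex.ofReal *ᵥ v = μ • v → ‖μ‖ < 1 := by
  simp only [IsSchur, mem_spectrum_iff_exists_eigenvector]
  exact ⟨fun h μ v hv he => h μ ⟨v, hv, he⟩, fun h μ ⟨v, hv, he⟩ => h μ v hv he⟩

theorem map_ofReal_mul {ι κ σ : Type} [Fintype σ] (P : Matrix ι σ ℝ) (Q : Matrix σ κ ℝ) :
    (P * Q).map Complex.ofReal = P.map Complex.ofReal * Q.map Complex.ofReal :=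
  Matrix.map_mul (f := Complex.ofRealHom)

theorem map_ofReal_pow (P : Matrix σ σ ℝ) (k : ℕ) :
    (P ^ k).map Complex.ofReal = P.map Complex.ofReal ^ k :=
  map_pow (Complex.ofRealHom.mapMatrix) P k

theorem map_ofReal_mulVec {σ κ : Type} [Fintype σ] (P : Matrix κ σ ℝ) (v : σ → ℝ) :
    P.map Complex.ofReal *ᵥ (fun i => (v i : ℂ)) = fun i => (((P *ᵥ v) i : ℝ) : ℂ) := by
  funext i
  simp [Matrix.mulVec, dotProduct]

theorem isSchur_fromBlocks {A : Matrix σ σ ℝ} {B : Matrix τ σ ℝ} {D : Matrix τ τ ℝ}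
    (hA : IsSchur A) (hD : IsSchur D) : IsSchur (fromBlocks A 0 B D) := by
  rw [isSchur_iff] at *
  intro μ v hv he
  rw [Matrix.fromBlocks_map, Matrix.fromBlocks_mulVec] at he
  have h1 : A.map Complex.ofReal *ᵥ (v ∘ Sum.inl) = μ • (v ∘ Sum.inl) := by
    funext i
    simpa using congrFun he (Sum.inl i)
  by_cases hx : v ∘ Sum.inl = 0
  · refine hD μ (v ∘ Sum.inr) (fun hy => hv ?_) ?_
    · funext i
      cases i with
      | inl i => exact congrFun hx i
      | inr i => exact congrFun hy i
    · funext i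
      simpa [hx] using congrFun he (Sum.inr i)
  · exact hA μ _ hx h1

theorem isSchur_zero : IsSchur (0 : Matrix σ σ ℝ) := by
  rw [isSchur_iff]
  intro μ v hv he
  have h0 : μ • v = 0 := by rw [← he]; simp
  rcases smul_eq_zero.1 h0 with h | h
  · simp [h]
  · exact absurd h hv

theorem isSchur_pow {A : Matrix σ σ ℝ} (hA : IsSchur A) {N : ℕ} (hN : 0 < N) :
    IsSchur (A ^ N) := by
  intro μ hμ
  rw [map_ofReal_pow, spectrum.map_pow_of_pos _ hN] at hμ
  obtain ⟨ν, hν, rfl⟩ := hμ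
  simpa using pow_lt_one₀ (norm_nonneg ν) (hA ν hν) hN.ne'

theorem isSchur_submatrix (e : σ ≃ τ) {A : Matrix σ σ ℝ} (hA : IsSchur A) :
    IsSchur (A.submatrix e.symm e.symm) := by
  rw [isSchur_iff] at *
  intro μ v hv he
  refine hA μ (v ∘ e) (fun h => hv ?_) ?_
  · funext i
    simpa using congrFun h (e.symm i)
  · rw [← Matrix.submatrix_map, Matrix.submatrix_mulVec_equiv] at he
    funext i
    simpa using congrFun he (e i)

/-- An eigenvector of the shift matrix for a nonzero eigenvalue vanishes, from the last entry
upwards. -/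
theorem isSchur_firA (M : ℕ) : IsSchur (firA M) := by
  rw [isSchur_iff]
  intro μ v hv he
  by_contra! hμ
  have hμ0 : μ ≠ 0 := fun h => by rw [h, norm_zero] at hμ; linarith
  have key : ∀ k (i : Fin (M - 1)), M - 1 ≤ i + k + 1 → v i = 0 := by
    intro k
    induction k with
    | zero =>
      intro i hi
      have h := congrFun he i
      simp only [firA, Matrix.mulVec, dotProduct, Matrix.map_apply, Matrix.of_apply] at h
      rw [Finset.sum_eq_zero] at h
      · exact (mul_eq_zero.1 (h.symm : μ * v i = 0)).resolve_left hμ0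
      · intro j _
        rw [if_neg (by have := j.isLt; omega)]
        simp
    | succ k ih =>
      intro i hi
      have h := congrFun he i
      simp only [firA, Matrix.mulVec, dotProduct, Matrix.map_apply, Matrix.of_apply] at h
      rw [Finset.sum_eq_zero] at h
      · exact (mul_eq_zero.1 (h.symm : μ * v i = 0)).resolve_left hμ0
      · intro j _
        by_cases hj : (j : ℕ) = i + 1
        · rw [ih j (by omega), mul_zero]
        · rw [if_neg hj]; simp
  exact hv (funext fun i => key (M - 1) i (by omega))

/-- Gelfand's formula: the powers of a matrix with spectral radius below one decay
geometrically. -/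
theorem exists_norm_pow_le {P : Matrix σ σ ℂ} (hP : ∀ μ ∈ spectrum ℂ P, ‖μ‖ < 1) :
    ∃ c r : ℝ, 0 ≤ c ∧ 0 < r ∧ r < 1 ∧ ∀ k i j, ‖(P ^ k) i j‖ ≤ c * r ^ k := by
  rcases isEmpty_or_nonempty σ with hσ | hσ
  · exact ⟨0, 1 / 2, le_rfl, by norm_num, by norm_num, fun k i => isEmptyElim i⟩
  let _ : NormedRing (Matrix σ σ ℂ) := Matrix.linftyOpNormedRing
  let _ : NormedAlgebra ℂ (Matrix σ σ ℂ) := Matrix.linftyOpNormedAlgebra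
  have hrad : spectralRadius ℂ P < ((1 : NNReal) : ENNReal) :=
    spectrum.spectralRadius_lt_of_forall_lt P fun z hz => by
      have := hP z hz
      rw [← NNReal.coe_lt_coe]
      simpa using this
  obtain ⟨r, hr1, hr2⟩ := ENNReal.lt_iff_exists_nnreal_btwn.1 hrad
  have hr2' : (r : ℝ) < 1 := by exact_mod_cast hr2
  have hev := (spectrum.pow_nnnorm_pow_one_div_tendsto_nhds_spectralRadius P).eventually_lt_const
    hr1
  have hrpos : (0 : ℝ) < r := by
    have : (0 : ENNReal) < r := lt_of_le_of_lt (zero_le) hr1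
    exact_mod_cast this
  have hentry : ∀ (Q : Matrix σ σ ℂ) i j, ‖Q i j‖ ≤ ‖Q‖ := by
    intro Q i j
    have h1 : ‖Q i j‖₊ ≤ ‖Q‖₊ := by
      rw [Matrix.linfty_opNNNorm_def]
      exact (Finset.single_le_sum (f := fun j => ‖Q i j‖₊) (fun _ _ => zero_le)
        (Finset.mem_univ j)).trans
        (Finset.le_sup (f := fun i => ∑ j, ‖Q i j‖₊) (Finset.mem_univ i))
    exact_mod_cast h1
  obtain ⟨K, hK⟩ := eventually_atTop.1 hev
  have hbig : ∀ k, K + 1 ≤ k → ‖P ^ k‖ ≤ (r : ℝ) ^ k := by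
    intro k hk
    have h := hK k (by omega)
    have hk0 : (0 : ℝ) < k := by exact_mod_cast (by omega : 0 < k)
    have h2 := ENNReal.rpow_lt_rpow h hk0
    rw [← ENNReal.rpow_mul, one_div, inv_mul_cancel₀ hk0.ne', ENNReal.rpow_one,
      ENNReal.rpow_natCast] at h2
    have h3 : ‖P ^ k‖₊ < r ^ k := by exact_mod_cast h2
    have h4 : ‖P ^ k‖₊ ≤ r ^ k := h3.le
    exact_mod_cast h4
  refine ⟨1 + ∑ k ∈ Finset.range (K + 1), ‖P ^ k‖ / (r : ℝ) ^ k, r, ?_, hrpos, hr2', ?_⟩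
  · exact add_nonneg zero_le_one (Finset.sum_nonneg fun _ _ => by positivity)
  · intro k i j
    refine (hentry _ i j).trans ?_
    have hpk : (0 : ℝ) < (r : ℝ) ^ k := pow_pos hrpos k
    by_cases hk : K + 1 ≤ k
    · refine (hbig k hk).trans (le_mul_of_one_le_left hpk.le ?_)
      exact le_add_of_nonneg_right (Finset.sum_nonneg fun _ _ => by positivity)
    · have h1 : ‖P ^ k‖ / (r : ℝ) ^ k ≤ ∑ k ∈ Finset.range (K + 1), ‖P ^ k‖ / (r : ℝ) ^ k :=
        Finset.single_le_sum (f := fun k => ‖P ^ k‖ / (r : ℝ) ^ k)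
          (fun _ _ => by positivity) (Finset.mem_range.2 (by omega))
      have h2 : ‖P ^ k‖ = ‖P ^ k‖ / (r : ℝ) ^ k * (r : ℝ) ^ k := by field_simp
      rw [h2]
      exact mul_le_mul_of_nonneg_right (h1.trans (le_add_of_nonneg_left zero_le_one)) hpk.le

/-- The Neumann series of the resolvent outside the open unit disc. -/
theorem hasSum_resolvent {P : Matrix σ σ ℂ} (hP : ∀ μ ∈ spectrum ℂ P, ‖μ‖ < 1) {z : ℂ}
    (hz : 1 ≤ ‖z‖) :
    IsUnit (z • (1 : Matrix σ σ ℂ) - P) ∧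
    HasSum (fun k : ℕ => (z ^ (k + 1))⁻¹ • P ^ k) (z • (1 : Matrix σ σ ℂ) - P)⁻¹ := by
  have hz0 : z ≠ 0 := fun h => by rw [h, norm_zero] at hz; linarith
  obtain ⟨c, r, hc, hr0, hr1, hb⟩ := exists_norm_pow_le hP
  have hsum : Summable (fun k : ℕ => (z ^ (k + 1))⁻¹ • P ^ k) := by
    refine Pi.summable.2 fun i => Pi.summable.2 fun j => ?_
    refine Summable.of_norm_bounded
      ((summable_geometric_of_lt_one hr0.le hr1).mul_left c) fun k => ?_
    rw [Matrix.smul_apply, norm_smul, norm_inv, norm_pow]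
    refine (mul_le_of_le_one_left (norm_nonneg _) ?_).trans (hb k i j)
    exact inv_le_one_of_one_le₀ (one_le_pow₀ hz)
  have hmul := hsum.hasSum.mul_left (z • (1 : Matrix σ σ ℂ) - P)
  have hterm : ∀ k, (z • (1 : Matrix σ σ ℂ) - P) * ((z ^ (k + 1))⁻¹ • P ^ k) =
      (z ^ k)⁻¹ • P ^ k - (z ^ (k + 1))⁻¹ • P ^ (k + 1) := by
    intro k
    rw [sub_mul, smul_mul_smul_comm, one_mul, Matrix.mul_smul, ← pow_succ']
    congr 2
    rw [pow_succ, mul_inv]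
    field_simp
  simp only [hterm] at hmul
  have hone : (z • (1 : Matrix σ σ ℂ) - P) * ∑' k : ℕ, (z ^ (k + 1))⁻¹ • P ^ k = 1 := by
    refine tendsto_nhds_unique hmul.tendsto_sum_nat ?_
    simp only [Finset.sum_range_sub']
    have h0 : Tendsto (fun k : ℕ => (z ^ k)⁻¹ • P ^ k) atTop (𝓝 0) := by
      have h := hsum.tendsto_atTop_zero.const_smul z
      rw [smul_zero] at h
      refine h.congr fun k => ?_
      rw [smul_smul]
      congr 1
      rw [pow_succ, mul_inv]
      field_simp
    have h1 := h0.const_sub ((z ^ 0)⁻¹ • P ^ 0)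
    rw [sub_zero] at h1
    have h2 : (z ^ 0)⁻¹ • P ^ 0 = (1 : Matrix σ σ ℂ) := by simp
    rwa [h2] at h1 ⊢
  refine ⟨?_, ?_⟩
  · exact IsUnit.of_mul_eq_one _ hone
  · rw [Matrix.inv_eq_right_inv hone]
    exact hsum.hasSum

end schur

section transfer

variable {σ ι κ : Type} [Fintype σ] [Fintype ι] [DecidableEq ι]

theorem impulse_ss_zero (A : Matrix σ σ ℝ) (B : Matrix σ ι ℝ) (C : Matrix κ σ ℝ)
    (D : Matrix κ ι ℝ) : impulse (ss A B C D) 0 = D := by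
  ext i j
  simp [impulse, ss, ssState]

theorem impulse_ss_succ [DecidableEq σ] (A : Matrix σ σ ℝ) (B : Matrix σ ι ℝ) (C : Matrix κ σ ℝ)
    (D : Matrix κ ι ℝ) (k : ℕ) : impulse (ss A B C D) (k + 1) = C * A ^ k * B := by
  ext i j
  have hx : ∀ k, ssState A B (fun n => if n = 0 then Pi.single j 1 else 0) (k + 1) =
      (A ^ k * B) *ᵥ Pi.single j 1 := by
    intro k
    induction k with
    | zero => simp [ssState]
    | succ k ih =>
      rw [ssState, ih]
      simp only [Nat.add_eq_zero_iff, one_ne_zero, and_false, ↓reduceIte, Matrix.mulVec_zero,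
        add_zero, Matrix.mulVec_mulVec, pow_succ', Matrix.mul_assoc]
  simp only [impulse, ss, hx, Matrix.of_apply]
  simp only [Nat.add_eq_zero_iff, one_ne_zero, and_false, ↓reduceIte, Matrix.mulVec_zero, add_zero,
    Matrix.mulVec_mulVec]
  simp [Matrix.mul_assoc]

/-- The transfer function series of a stable state-space system converges to
`C (zI - A)⁻¹ B + D` on and outside the unit circle. -/
theorem hasSum_tfTerm_ss [DecidableEq σ] {A : Matrix σ σ ℝ} (hA : IsSchur A) (B : Matrix σ ι ℝ)
    (C : Matrix κ σ ℝ) (D : Matrix κ ι ℝ) {z : ℂ} (hz : 1 ≤ ‖z‖) :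
    HasSum (tfTerm (ss A B C D) z) (ssTf A B C D z) := by
  obtain ⟨-, hs⟩ := hasSum_resolvent (P := A.map Complex.ofReal) hA hz
  let φ : Matrix σ σ ℂ →+ Matrix κ ι ℂ :=
    { toFun := fun R => C.map Complex.ofReal * R * B.map Complex.ofReal
      map_zero' := by simp
      map_add' := fun R S => by rw [Matrix.mul_add, Matrix.add_mul] }
  have hφ : Continuous φ :=
    (continuous_const.matrix_mul continuous_id).matrix_mul continuous_const
  have h1 := hs.map φ hφ
  have h2 : HasSum (fun k => tfTerm (ss A B C D) z (k + 1))
      (φ (z • (1 : Matrix σ σ ℂ) - A.map Complex.ofReal)⁻¹) := by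
    refine h1.congr_fun ?_
    intro k
    rw [tfTerm, impulse_ss_succ, map_ofReal_mul, map_ofReal_mul, map_ofReal_pow]
    simp [φ]
  have h3 := (hasSum_nat_add_iff (f := tfTerm (ss A B C D) z) 1).1 h2
  simpa [tfTerm, impulse_ss_zero, ssTf, φ] using h3

end transfer

/-! ### Energy bounds for stable state equations -/

section energy

variable {σ ι : Type} [Fintype σ] [DecidableEq σ] [Fintype ι]

/-- A Lyapunov function for a stable state equation with input. It is a multiple of
`∑ₖ |Aᵏ x|²`. -/
theorem exists_lyapunov {A : Matrix σ σ ℝ} (hA : IsSchur A) (B : Matrix σ ι ℝ) :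
    ∃ (V : (σ → ℝ) → ℝ) (c : ℝ), 0 ≤ c ∧ (∀ x, 0 ≤ V x) ∧ (∀ x, V x ≤ c * sqNorm x) ∧
      ∀ x w, V (A *ᵥ x + B *ᵥ w) ≤ V x - sqNorm x + c * sqNorm w := by
  obtain ⟨c, r, hc, hr0, hr1, hb⟩ := exists_norm_pow_le (P := A.map Complex.ofReal) hA
  set K : ℝ := ∑ _i : σ, ∑ _j : σ, c ^ 2 with hK
  have hK0 : 0 ≤ K := Finset.sum_nonneg fun _ _ => Finset.sum_nonneg fun _ _ => sq_nonneg _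
  have hpow : ∀ k x, sqNorm (A ^ k *ᵥ x) ≤ (r ^ 2) ^ k * (K * sqNorm x) := by
    intro k x
    refine (sqNorm_mulVec_le _ _).trans ?_
    rw [← mul_assoc]
    refine mul_le_mul_of_nonneg_right ?_ (sqNorm_nonneg x)
    rw [hK, Finset.mul_sum]
    refine Finset.sum_le_sum fun i _ => ?_
    rw [Finset.mul_sum]
    refine Finset.sum_le_sum fun j _ => ?_
    have h1 := hb k i j
    rw [← map_ofReal_pow, Matrix.map_apply, Complex.norm_real] at h1
    calc ‖(A ^ k) i j‖ ^ 2 ≤ (c * r ^ k) ^ 2 := pow_le_pow_left₀ (norm_nonneg _) h1 2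
      _ = (r ^ 2) ^ k * c ^ 2 := by ring
  have hr2 : r ^ 2 < 1 := by nlinarith
  have hgeo : ∀ x : σ → ℝ, Summable fun k : ℕ => (r ^ 2) ^ k * (K * sqNorm x) := fun x =>
    (summable_geometric_of_lt_one (sq_nonneg r) hr2).mul_right _
  have hs : ∀ x : σ → ℝ, Summable fun k : ℕ => sqNorm (A ^ k *ᵥ x) := fun x =>
    Summable.of_nonneg_of_le (fun k => sqNorm_nonneg (A ^ k *ᵥ x)) (fun k => hpow k x) (hgeo x)
  let V : (σ → ℝ) → ℝ := fun x => ∑' k : ℕ, sqNorm (A ^ k *ᵥ x)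
  have hV0 : ∀ x, 0 ≤ V x := fun x => tsum_nonneg fun k => sqNorm_nonneg (A ^ k *ᵥ x)
  set c₁ : ℝ := (1 - r ^ 2)⁻¹ * K with hc₁
  have hc₁0 : 0 ≤ c₁ := mul_nonneg (inv_nonneg.2 (by linarith)) hK0
  have hV1 : ∀ x, V x ≤ c₁ * sqNorm x := by
    intro x
    refine ((hs x).tsum_le_tsum (fun k => hpow k x) (hgeo x)).trans (le_of_eq ?_)
    rw [tsum_mul_right, tsum_geometric_of_lt_one (sq_nonneg r) hr2, hc₁, mul_assoc]
  have hVA : ∀ x, V (A *ᵥ x) = V x - sqNorm x := by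
    intro x
    have h1 := (hs x).sum_add_tsum_nat_add 1
    have h2 : V (A *ᵥ x) = ∑' k : ℕ, sqNorm (A ^ (k + 1) *ᵥ x) := by
      simp only [V, Matrix.mulVec_mulVec, pow_succ]
    rw [h2]
    simp only [Finset.sum_range_one, pow_zero, Matrix.one_mulVec] at h1
    simp only [V]
    linarith
  have hVadd : ∀ {η : ℝ}, 0 < η → ∀ x y, V (x + y) ≤ (1 + η) * V x + (1 + η⁻¹) * V y := by
    intro η hη x y
    simp only [V]
    rw [← tsum_mul_left, ← tsum_mul_left, ← ((hs x).mul_left _).tsum_add ((hs y).mul_left _)]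
    refine (hs _).tsum_le_tsum (fun k => ?_) (((hs x).mul_left _).add ((hs y).mul_left _))
    rw [Matrix.mulVec_add]
    exact sqNorm_add_le hη _ _
  obtain ⟨b, hb0, hB⟩ := exists_sqNorm_mulVec_le B
  -- `η` is chosen such that the term `η V x` costs at most half of the decrease `|x|²`.
  set η : ℝ := (2 * (c₁ + 1))⁻¹ with hη
  have hη0 : 0 < η := by positivity
  have hηc : η * c₁ ≤ 1 / 2 := by
    rw [hη, inv_mul_le_iff₀ (by positivity)]; linarith
  refine ⟨fun x => 2 * V x, 2 * c₁ + 2 * ((1 + η⁻¹) * (c₁ * b)), ?_, ?_, ?_, ?_⟩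
  · positivity
  · intro x; have := hV0 x; positivity
  · intro x
    have h1 := hV1 x
    have h2 : 0 ≤ 2 * ((1 + η⁻¹) * (c₁ * b)) * sqNorm x :=
      mul_nonneg (by positivity) (sqNorm_nonneg x)
    show 2 * V x ≤ _
    nlinarith
  · intro x w
    have h1 := hVadd hη0 (A *ᵥ x) (B *ᵥ w)
    rw [hVA] at h1
    have h2 : V (B *ᵥ w) ≤ c₁ * b * sqNorm w := by
      refine (hV1 _).trans ?_
      rw [mul_assoc c₁ b]
      exact mul_le_mul_of_nonneg_left (hB w) hc₁0
    have h3 : (1 + η⁻¹) * V (B *ᵥ w) ≤ (1 + η⁻¹) * (c₁ * b * sqNorm w) :=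
      mul_le_mul_of_nonneg_left h2 (by positivity)
    have h4 : η * V x ≤ 1 / 2 * sqNorm x := by
      calc η * V x ≤ η * (c₁ * sqNorm x) := mul_le_mul_of_nonneg_left (hV1 x) hη0.le
        _ = η * c₁ * sqNorm x := by ring
        _ ≤ _ := mul_le_mul_of_nonneg_right hηc (sqNorm_nonneg x)
    have h5 : 0 ≤ η * sqNorm x := mul_nonneg hη0.le (sqNorm_nonneg x)
    have h6 : 0 ≤ 2 * c₁ * sqNorm w := mul_nonneg (by positivity) (sqNorm_nonneg w)
    show 2 * V _ ≤ 2 * V x - _ + _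
    nlinarith

end energy

/-! ### Largest singular value and frequency response -/

section frequency

variable {σ ι κ : Type} [Fintype σ] [DecidableEq σ] [Fintype ι] [DecidableEq ι] [Fintype κ]

theorem sigmaMax_nonneg (P : Matrix κ ι ℂ) : 0 ≤ sigmaMax P := norm_nonneg _

theorem sqNorm_mulVec_le_sigmaMax (P : Matrix κ ι ℂ) (v : ι → ℂ) :
    sqNorm (P *ᵥ v) ≤ sigmaMax P ^ 2 * sqNorm v := by
  have h := (LinearMap.toContinuousLinearMap (Matrix.toEuclideanLin P)).le_opNorm (WithLp.toLp 2 v)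
  rw [sqNorm_eq_norm_sq, sqNorm_eq_norm_sq, ← mul_pow]
  exact pow_le_pow_left₀ (norm_nonneg _) h 2

theorem sigmaMax_le {P : Matrix κ ι ℂ} {c : ℝ} (hc : 0 ≤ c)
    (h : ∀ v, sqNorm (P *ᵥ v) ≤ c ^ 2 * sqNorm v) : sigmaMax P ≤ c := by
  refine ContinuousLinearMap.opNorm_le_bound _ hc fun v => ?_
  have h1 := h (WithLp.ofLp v)
  rw [sqNorm_eq_norm_sq, sqNorm_eq_norm_sq, ← mul_pow] at h1
  exact le_of_pow_le_pow_left₀ two_ne_zero (by positivity) h1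

/-- Strict version of `sigmaMax_le`; the maximum of `|P v|` on the unit sphere is attained. -/
theorem sigmaMax_lt {P : Matrix κ ι ℂ} {c : ℝ} (hc : 0 < c)
    (h : ∀ v, v ≠ 0 → sqNorm (P *ᵥ v) < c ^ 2 * sqNorm v) : sigmaMax P < c := by
  rcases isEmpty_or_nonempty ι with hι | hι
  · refine lt_of_le_of_lt (sigmaMax_le le_rfl fun v => ?_) hc
    rw [Subsingleton.elim v 0]; simp
  let f : EuclideanSpace ℂ ι → ℝ := fun v =>
    ‖LinearMap.toContinuousLinearMap (Matrix.toEuclideanLin P) v‖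
  obtain ⟨v, hv, hmax⟩ := (isCompact_sphere (0 : EuclideanSpace ℂ ι) 1).exists_isMaxOn
    (NormedSpace.sphere_nonempty.2 zero_le_one) (f := f) (by fun_prop)
  have hv1 : ‖v‖ = 1 := by simpa using hv
  have hv0 : WithLp.ofLp v ≠ 0 := by
    intro h0
    have : v = 0 := by
      rw [← WithLp.toLp_ofLp 2 v, h0]; rfl
    rw [this, norm_zero] at hv1
    exact zero_ne_one hv1
  have hfv : f v < c := by
    have h1 := h _ hv0
    rw [sqNorm_eq_norm_sq, sqNorm_eq_norm_sq, WithLp.toLp_ofLp, hv1, one_pow, mul_one] at h1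
    exact lt_of_pow_lt_pow_left₀ 2 hc.le h1
  refine lt_of_le_of_lt (ContinuousLinearMap.opNorm_le_of_unit_norm (norm_nonneg _) ?_) hfv
  intro x hx
  exact hmax (by simpa using hx)

theorem continuous_sigmaMax : Continuous (sigmaMax : Matrix κ ι ℂ → ℝ) := by
  have h : Continuous fun P : Matrix κ ι ℂ =>
      LinearMap.toContinuousLinearMap (Matrix.toEuclideanLin P) :=
    LinearMap.continuous_of_finiteDimensional
      (LinearMap.toContinuousLinearMap.toLinearMap ∘ₗ
        (Matrix.toEuclideanLin (𝕜 := ℂ) (m := κ) (n := ι)).toLinearMap)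
  exact h.norm

theorem sigmaMax_map_star_le (P : Matrix κ ι ℂ) : sigmaMax (P.map star) ≤ sigmaMax P := by
  refine sigmaMax_le (sigmaMax_nonneg P) fun v => ?_
  have h1 := sqNorm_mulVec_le_sigmaMax P (star v)
  have h2 : sqNorm (star v) = sqNorm v := by simp [sqNorm]
  have h3 : sqNorm (P.map star *ᵥ v) = sqNorm (P *ᵥ star v) := by
    have : P.map star *ᵥ v = star (P *ᵥ star v) := by
      funext i
      simp [Matrix.mulVec, dotProduct]
    rw [this]; simp [sqNorm]
  rw [h3, ← h2]
  exact h1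

/-- A real system has complex conjugate frequency responses at `z` and at its conjugate. -/
theorem ssTf_star {ι κ : Type} (A : Matrix σ σ ℝ) (B : Matrix σ ι ℝ) (C : Matrix κ σ ℝ)
    (D : Matrix κ ι ℝ)
    (z : ℂ) : ssTf A B C D (star z) = (ssTf A B C D z).map star := by
  have hR : ∀ {m n : Type} (Q : Matrix m n ℝ),
      (Q.map Complex.ofReal).map star = Q.map Complex.ofReal := by
    intro m n Q; ext i j; simp
  have hmul : ∀ {l m n : Type} [Fintype m] (Q : Matrix l m ℂ) (R : Matrix m n ℂ),
      (Q * R).map star = Q.map star * R.map star := by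
    intro l m n _ Q R
    exact Matrix.map_mul (f := starRingEnd ℂ)
  have hinv : ∀ Q : Matrix σ σ ℂ, (Q⁻¹).map star = (Q.map star)⁻¹ := by
    intro Q
    have h := congrArg Matrix.transpose (Matrix.conjTranspose_nonsing_inv Q)
    rw [Matrix.conjTranspose, Matrix.transpose_map, Matrix.transpose_transpose,
      Matrix.transpose_nonsing_inv] at h
    rw [h, Matrix.conjTranspose, Matrix.transpose_map, Matrix.transpose_transpose]
  have hres : (z • (1 : Matrix σ σ ℂ) - A.map Complex.ofReal).map star =
      star z • (1 : Matrix σ σ ℂ) - A.map Complex.ofReal := by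
    ext i j
    by_cases hij : i = j <;> simp [hij]
  rw [ssTf, ssTf, Matrix.map_add _ (fun a b => star_add a b), hmul, hmul, hinv, hR, hR, hR, hres]

theorem continuousOn_resolvent {A : Matrix σ σ ℝ} (hA : IsSchur A) :
    ContinuousOn (fun z : ℂ => (z • (1 : Matrix σ σ ℂ) - A.map Complex.ofReal)⁻¹)
      {z | 1 ≤ ‖z‖} := by
  intro z hz
  have hu := (hasSum_resolvent (P := A.map Complex.ofReal) hA hz).1
  have h1 : Continuous fun z : ℂ => z • (1 : Matrix σ σ ℂ) - A.map Complex.ofReal :=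
    (continuous_id.smul continuous_const).sub continuous_const
  have h2 : ContinuousAt (fun P : Matrix σ σ ℂ => P⁻¹)
      (z • (1 : Matrix σ σ ℂ) - A.map Complex.ofReal) := by
    refine continuousAt_matrix_inv _ ?_
    obtain ⟨u, hu'⟩ := (Matrix.isUnit_iff_isUnit_det _).1 hu
    rw [← hu']
    exact NormedRing.inverse_continuousAt u
  exact (ContinuousAt.comp (f := fun z : ℂ => z • (1 : Matrix σ σ ℂ) - A.map Complex.ofReal)
    h2 h1.continuousAt).continuousWithinAt

theorem continuousOn_ssTf {ι κ : Type} {A : Matrix σ σ ℝ} (hA : IsSchur A) (B : Matrix σ ι ℝ)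
    (C : Matrix κ σ ℝ) (D : Matrix κ ι ℝ) : ContinuousOn (ssTf A B C D) {z | 1 ≤ ‖z‖} := by
  have h : Continuous fun R : Matrix σ σ ℂ =>
      C.map Complex.ofReal * R * B.map Complex.ofReal + D.map Complex.ofReal :=
    ((continuous_const.matrix_mul continuous_id).matrix_mul continuous_const).add continuous_const
  exact h.comp_continuousOn (continuousOn_resolvent hA)

theorem tf_ss {κ : Type} {A : Matrix σ σ ℝ} (hA : IsSchur A) (B : Matrix σ ι ℝ) (C : Matrix κ σ ℝ)
    (D : Matrix κ ι ℝ) {z : ℂ} (hz : 1 ≤ ‖z‖) : tf (ss A B C D) z = ssTf A B C D z :=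
  (hasSum_tfTerm_ss hA B C D hz).tsum_eq

/-- The maximum over frequencies in the `H^∞` norm is attained. -/
theorem isGreatest_gains_ss {A : Matrix σ σ ℝ} (hA : IsSchur A) (B : Matrix σ ι ℝ)
    (C : Matrix κ σ ℝ) (D : Matrix κ ι ℝ) :
    IsGreatest (gains (ss A B C D)) (hinfNorm (ss A B C D)) := by
  have hcont : ContinuousOn
      (fun θ : ℝ => sigmaMax (tf (ss A B C D) (Complex.exp (θ * Complex.I))))
        (Set.Icc 0 Real.pi) := by
    have h1 : Continuous fun θ : ℝ => Complex.exp (θ * Complex.I) := by fun_prop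
    have h2 : Continuous fun θ : ℝ => ssTf A B C D (Complex.exp (θ * Complex.I)) :=
      (continuousOn_ssTf hA B C D).comp_continuous h1 fun θ => by
        simp [Complex.norm_exp_ofReal_mul_I]
    refine (continuous_sigmaMax.comp h2).continuousOn.congr fun θ _ => ?_
    rw [tf_ss hA B C D (by simp [Complex.norm_exp_ofReal_mul_I])]
    rfl
  have hne : (gains (ss A B C D)).Nonempty :=
    (Set.nonempty_Icc.2 Real.pi_pos.le).image _
  exact (isCompact_Icc.image_of_continuousOn hcont).isGreatest_sSup hne

/-- The gains on the upper half circle bound those on the whole circle, since a real system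
has conjugate gains at conjugate points. -/
theorem sigmaMax_ssTf_le {A : Matrix σ σ ℝ} (hA : IsSchur A) (B : Matrix σ ι ℝ)
    (C : Matrix κ σ ℝ) (D : Matrix κ ι ℝ) {z : ℂ} (hz : ‖z‖ = 1) :
    sigmaMax (ssTf A B C D z) ≤ hinfNorm (ss A B C D) := by
  have hub := (isGreatest_gains_ss hA B C D).2
  have hupper : ∀ z : ℂ, ‖z‖ = 1 → 0 ≤ z.arg →
      sigmaMax (ssTf A B C D z) ≤ hinfNorm (ss A B C D) := by
    intro z hz harg
    refine hub ⟨z.arg, ⟨harg, Complex.arg_le_pi z⟩, ?_⟩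
    have hexp : Complex.exp (z.arg * Complex.I) = z := by
      have h := Complex.norm_mul_exp_arg_mul_I z
      rwa [hz, Complex.ofReal_one, one_mul] at h
    simp only [hexp]
    rw [tf_ss hA B C D hz.ge]
  rcases le_or_gt 0 z.arg with harg | harg
  · exact hupper z hz harg
  · have h1 : ssTf A B C D z = (ssTf A B C D (star z)).map star := by
      rw [← ssTf_star, star_star]
    rw [h1]
    refine (sigmaMax_map_star_le _).trans (hupper _ (by simpa using hz) ?_)
    have h2 := Complex.arg_conj z
    rw [if_neg (by linarith [Real.pi_pos])] at h2
    exact (h2.trans_ge (by linarith) : (0 : ℝ) ≤ (starRingEnd ℂ z).arg)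

theorem hinfNorm_ss_nonneg {A : Matrix σ σ ℝ} (hA : IsSchur A) (B : Matrix σ ι ℝ)
    (C : Matrix κ σ ℝ) (D : Matrix κ ι ℝ) : 0 ≤ hinfNorm (ss A B C D) :=
  (sigmaMax_nonneg _).trans (sigmaMax_ssTf_le hA B C D (z := 1) (by simp))

end frequency

/-! ### Trajectories and the energy gain in the time domain -/

section timeDomain

variable {σ ι κ : Type} [Fintype σ] [Fintype ι] [Fintype κ]

/-- State trajectory of `x[k+1] = A x[k] + B w[k]` with initial state `x`. -/
def stateFrom (A : Matrix σ σ ℝ) (B : Matrix σ ι ℝ) (x : σ → ℝ) (w : Sig ι) : ℕ → σ → ℝ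
  | 0 => x
  | k + 1 => A *ᵥ stateFrom A B x w k + B *ᵥ w k

theorem stateFrom_zero_eq (A : Matrix σ σ ℝ) (B : Matrix σ ι ℝ) (w : Sig ι) (k : ℕ) :
    stateFrom A B 0 w k = ssState A B w k := by
  induction k with
  | zero => rfl
  | succ k ih => rw [stateFrom, ih, ssState]

theorem stateFrom_add (A : Matrix σ σ ℝ) (B : Matrix σ ι ℝ) (x y : σ → ℝ) (w v : Sig ι) (k : ℕ) :
    stateFrom A B (x + y) (w + v) k = stateFrom A B x w k + stateFrom A B y v k := by
  induction k with
  | zero => rfl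
  | succ k ih =>
    simp only [stateFrom, ih, Pi.add_apply, Matrix.mulVec_add]
    abel

theorem stateFrom_smul (A : Matrix σ σ ℝ) (B : Matrix σ ι ℝ) (c : ℝ) (x : σ → ℝ) (w : Sig ι)
    (k : ℕ) : stateFrom A B (c • x) (c • w) k = c • stateFrom A B x w k := by
  induction k with
  | zero => rfl
  | succ k ih => simp only [stateFrom, ih, Pi.smul_apply, Matrix.mulVec_smul, smul_add]

theorem stateFrom_congr (A : Matrix σ σ ℝ) (B : Matrix σ ι ℝ) (x : σ → ℝ) {w v : Sig ι} {T : ℕ}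
    (h : ∀ k < T, w k = v k) {k : ℕ} (hk : k ≤ T) :
    stateFrom A B x w k = stateFrom A B x v k := by
  induction k with
  | zero => rfl
  | succ k ih => rw [stateFrom, stateFrom, ih (by omega), h k (by omega)]

theorem stateFrom_succ' (A : Matrix σ σ ℝ) (B : Matrix σ ι ℝ) (x : σ → ℝ) (w : Sig ι) (k : ℕ) :
    stateFrom A B x w (k + 1) =
      stateFrom A B (A *ᵥ x + B *ᵥ w 0) (fun n => w (n + 1)) k := by
  induction k with
  | zero => rfl
  | succ k ih => rw [stateFrom, ih, stateFrom]

theorem exists_sum_sqNorm_state_le [DecidableEq σ] {A : Matrix σ σ ℝ} (hA : IsSchur A)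
    (B : Matrix σ ι ℝ) :
    ∃ c, 0 ≤ c ∧ ∀ x w T, ∑ k ∈ Finset.range T, sqNorm (stateFrom A B x w k) ≤
      c * (sqNorm x + ∑ k ∈ Finset.range T, sqNorm (w k)) := by
  obtain ⟨V, c, hc, hV0, hV1, hV2⟩ := exists_lyapunov hA B
  refine ⟨c, hc, fun x w T => ?_⟩
  have key : ∑ k ∈ Finset.range T, sqNorm (stateFrom A B x w k) + V (stateFrom A B x w T) ≤
      V x + c * ∑ k ∈ Finset.range T, sqNorm (w k) := by
    induction T with
    | zero => simp [stateFrom]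
    | succ T ih =>
      rw [Finset.sum_range_succ, Finset.sum_range_succ, mul_add]
      have h := hV2 (stateFrom A B x w T) (w T)
      rw [stateFrom]
      linarith
  have h1 := hV1 x
  have h2 := hV0 (stateFrom A B x w T)
  rw [mul_add]
  linarith

/-- The truncated series `∑_{k < P} yₖ uᵏ`. -/
def truncSeries {κ : Type} (y : ℕ → κ → ℝ) (P : ℕ) (u : ℂ) : κ → ℂ :=
  ∑ k ∈ Finset.range P, u ^ k • fun i => (y k i : ℂ)

theorem truncSeries_succ {κ : Type} (y : ℕ → κ → ℝ) (P : ℕ) (u : ℂ) :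
    truncSeries y (P + 1) u = truncSeries y P u + u ^ P • fun i => (y P i : ℂ) :=
  Finset.sum_range_succ _ _

theorem continuous_sqNorm_truncSeries (y : ℕ → κ → ℝ) (P : ℕ) :
    Continuous fun u => sqNorm (truncSeries y P u) := by
  simp only [sqNorm, truncSeries, Finset.sum_apply, Pi.smul_apply, smul_eq_mul]
  fun_prop

/-- Parseval's identity for finite real vector sequences. -/
theorem sum_sqNorm_eq_circleAverage (y : ℕ → κ → ℝ) (P : ℕ) :
    ∑ k ∈ Finset.range P, sqNorm (y k) =
      Real.circleAverage (fun u => sqNorm (truncSeries y P u)) 0 1 := by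
  let p : κ → Polynomial ℂ := fun i =>
    ∑ k ∈ Finset.range P, Polynomial.monomial k (y k i : ℂ)
  have hev : ∀ i u, (p i).eval u = truncSeries y P u i := by
    intro i u
    simp only [p, truncSeries, Polynomial.eval_finsetSum, Polynomial.eval_monomial,
      Finset.sum_apply, Pi.smul_apply, smul_eq_mul, mul_comm]
  have hco : ∀ i k, (p i).coeff k = if k < P then (y k i : ℂ) else 0 := by
    intro i k
    simp [p, Polynomial.coeff_monomial]
  have hpars : ∀ i, ∑ k ∈ Finset.range P, ‖y k i‖ ^ 2 =
      Real.circleAverage (fun u => ‖truncSeries y P u i‖ ^ 2) 0 1 := by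
    intro i
    simp only [← hev]
    rw [← Polynomial.sum_sq_norm_coeff_eq_circleAverage]
    have h1 : ∀ k ∈ Finset.range P, ‖y k i‖ ^ 2 = ‖(p i).coeff k‖ ^ 2 := by
      intro k hk
      rw [hco, if_pos (Finset.mem_range.1 hk), Complex.norm_real]
    rw [Finset.sum_congr rfl h1]
    symm
    refine Finset.sum_subset ?_ ?_
    · intro k hk
      rw [Finset.mem_range]
      by_contra hkP
      rw [Polynomial.mem_support_iff, hco, if_neg hkP] at hk
      exact hk rfl
    · intro k _ hk
      rw [Polynomial.notMem_support_iff.1 hk]; simp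
  simp only [sqNorm]
  rw [Finset.sum_comm, Real.circleAverage_fun_sum]
  · exact Finset.sum_congr rfl fun i _ => hpars i
  · intro i _
    refine ContinuousOn.circleIntegrable zero_le_one (Continuous.continuousOn ?_)
    simp only [truncSeries, Finset.sum_apply, Pi.smul_apply, smul_eq_mul]
    fun_prop

theorem truncSeries_mulVec {κ : Type} (Q : Matrix κ ι ℝ) (w : ℕ → ι → ℝ) (P : ℕ) (u : ℂ) :
    truncSeries (fun k => Q *ᵥ w k) P u = Q.map Complex.ofReal *ᵥ truncSeries w P u := by
  simp only [truncSeries, Matrix.mulVec_sum, Matrix.mulVec_smul, map_ofReal_mulVec]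

theorem truncSeries_add {κ : Type} (y v : ℕ → κ → ℝ) (P : ℕ) (u : ℂ) :
    truncSeries (fun k => y k + v k) P u = truncSeries y P u + truncSeries v P u := by
  simp only [truncSeries, ← Finset.sum_add_distrib, ← smul_add]
  refine Finset.sum_congr rfl fun k _ => ?_
  congr 1
  funext i
  simp

/-- The state equation in the frequency domain; cutting the trajectory at time `P` leaves a
boundary term. -/
theorem smul_truncSeries_state (A : Matrix σ σ ℝ) (B : Matrix σ ι ℝ) (w : Sig ι) (P : ℕ)
    {z : ℂ} (hz : z ≠ 0) :
    z • truncSeries (ssState A B w) P z⁻¹ =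
      A.map Complex.ofReal *ᵥ truncSeries (ssState A B w) P z⁻¹ +
        B.map Complex.ofReal *ᵥ truncSeries w P z⁻¹ -
        (z * z⁻¹ ^ P) • fun i => (ssState A B w P i : ℂ) := by
  induction P with
  | zero =>
    funext i
    simp [truncSeries, ssState]
  | succ P ih =>
    have h1 : (fun i => (ssState A B w (P + 1) i : ℂ)) =
        A.map Complex.ofReal *ᵥ (fun i => (ssState A B w P i : ℂ)) +
        B.map Complex.ofReal *ᵥ (fun i => (w P i : ℂ)) := by
      funext i
      rw [map_ofReal_mulVec, map_ofReal_mulVec, ssState]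
      simp
    rw [truncSeries_succ, truncSeries_succ, h1, smul_add, ih, Matrix.mulVec_add,
      Matrix.mulVec_add, Matrix.mulVec_smul, Matrix.mulVec_smul, smul_smul]
    have h2 : z * z⁻¹ ^ (P + 1) = z⁻¹ ^ P := by
      rw [pow_succ]; field_simp
    rw [h2, smul_add]
    abel

/-- A frequency domain gain bound is a bound for the energy gain on every finite horizon. -/
theorem sum_sqNorm_ss_le [DecidableEq σ] {A : Matrix σ σ ℝ} (hA : IsSchur A)
    (B : Matrix σ ι ℝ) (C : Matrix κ σ ℝ) (D : Matrix κ ι ℝ) {g : ℝ}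
    (hg : ∀ z : ℂ, ‖z‖ = 1 → ∀ v, sqNorm (ssTf A B C D z *ᵥ v) ≤ g * sqNorm v)
    {η : ℝ} (hη : 0 < η) (w : Sig ι) (T : ℕ) :
    ∑ k ∈ Finset.range T, sqNorm (ss A B C D w k) ≤
      (1 + η) * g * ∑ k ∈ Finset.range T, sqNorm (w k) := by
  -- Only the inputs before time `T` matter, so the input may be cut off there.
  let w' : Sig ι := fun k => if k < T then w k else 0
  have hw' : ∀ k < T, w k = w' k := fun k hk => by simp [w', hk]
  have hy : ∀ k ∈ Finset.range T, sqNorm (ss A B C D w k) = sqNorm (ss A B C D w' k) := by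
    intro k hk
    have hk' := Finset.mem_range.1 hk
    have hx := stateFrom_congr A B 0 hw' hk'.le
    rw [stateFrom_zero_eq, stateFrom_zero_eq] at hx
    simp only [ss, hx, hw' k hk']
  have hsw : ∀ P, T ≤ P → ∑ k ∈ Finset.range P, sqNorm (w' k) =
      ∑ k ∈ Finset.range T, sqNorm (w k) := by
    intro P hP
    rw [← Finset.sum_subset (Finset.range_mono hP)]
    · exact Finset.sum_congr rfl fun k hk => by rw [hw' k (Finset.mem_range.1 hk)]
    · intro k _ hk
      have : ¬ k < T := fun h => hk (Finset.mem_range.2 h)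
      simp [w', this]
  -- A uniform bound for `C (zI - A)⁻¹` on the unit circle.
  obtain ⟨b, hb⟩ : ∃ b, ∀ z : ℂ, ‖z‖ = 1 →
      (∑ i, ∑ j, ‖(C.map Complex.ofReal *
        (z • (1 : Matrix σ σ ℂ) - A.map Complex.ofReal)⁻¹) i j‖ ^ 2) ≤ b := by
    have hc : ContinuousOn (fun z : ℂ => ∑ i, ∑ j, ‖(C.map Complex.ofReal *
        (z • (1 : Matrix σ σ ℂ) - A.map Complex.ofReal)⁻¹) i j‖ ^ 2) (Metric.sphere 0 1) := by
      have h1 : Continuous fun R : Matrix σ σ ℂ => ∑ i, ∑ j,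
          ‖(C.map Complex.ofReal * R) i j‖ ^ 2 := by
        refine continuous_finsetSum _ fun i _ => continuous_finsetSum _ fun j _ => ?_
        exact (((continuous_const.matrix_mul continuous_id).matrix_elem i j).norm).pow 2
      refine h1.comp_continuousOn ((continuousOn_resolvent hA).mono fun z hz => ?_)
      have : ‖z‖ = 1 := by simpa using hz
      exact this.ge
    obtain ⟨b, hb⟩ := (isCompact_sphere (0 : ℂ) 1).bddAbove_image hc
    exact ⟨b, fun z hz => hb ⟨z, by simpa using hz, rfl⟩⟩
  have hP : ∀ P, T ≤ P → ∑ k ∈ Finset.range T, sqNorm (ss A B C D w k) ≤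
      (1 + η) * g * ∑ k ∈ Finset.range T, sqNorm (w k) +
        (1 + η⁻¹) * (b * sqNorm (ssState A B w' P)) := by
    intro P hTP
    have h1 : ∑ k ∈ Finset.range T, sqNorm (ss A B C D w k) ≤
        ∑ k ∈ Finset.range P, sqNorm (ss A B C D w' k) := by
      rw [Finset.sum_congr rfl hy]
      exact Finset.sum_le_sum_of_subset_of_nonneg (Finset.range_mono hTP)
        fun _ _ _ => sqNorm_nonneg _
    refine h1.trans ?_
    rw [sum_sqNorm_eq_circleAverage, ← hsw P hTP, sum_sqNorm_eq_circleAverage w']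
    set E : ℝ := (1 + η⁻¹) * (b * sqNorm (ssState A B w' P)) with hE
    have hint : CircleIntegrable (fun u => sqNorm (truncSeries w' P u)) 0 1 :=
      (continuous_sqNorm_truncSeries w' P).continuousOn.circleIntegrable zero_le_one
    have h2 : (1 + η) * g * Real.circleAverage (fun u => sqNorm (truncSeries w' P u)) 0 1 + E =
        Real.circleAverage (fun u => (1 + η) * g * sqNorm (truncSeries w' P u) + E) 0 1 := by
      have hint' : CircleIntegrable (fun u => (1 + η) * g * sqNorm (truncSeries w' P u)) 0 1 :=
        hint.const_mul ((1 + η) * g)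
      have h3 := Real.circleAverage_fun_add hint' (circleIntegrable_const E 0 1)
      rw [h3, Real.circleAverage_const]
      congr 1
      exact (Real.circleAverage_fun_smul (a := (1 + η) * g)).symm
    rw [h2]
    refine Real.circleAverage_mono
      ((continuous_sqNorm_truncSeries _ P).continuousOn.circleIntegrable zero_le_one)
      ((((continuous_sqNorm_truncSeries w' P).const_mul _).add
        continuous_const).continuousOn.circleIntegrable zero_le_one) ?_
    intro u hu
    have hu1 : ‖u‖ = 1 := by simpa using hu
    have hu0 : u ≠ 0 := fun h => by rw [h, norm_zero] at hu1; exact zero_ne_one hu1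
    obtain ⟨z, rfl⟩ : ∃ z, u = z⁻¹ := ⟨u⁻¹, (inv_inv u).symm⟩
    have hz0 : z ≠ 0 := fun h => hu0 (by simp [h])
    have hz1 : ‖z‖ = 1 := by simpa using hu1
    have hstate := smul_truncSeries_state A B w' P hz0
    set Xh := truncSeries (ssState A B w') P z⁻¹
    set Wh := truncSeries w' P z⁻¹
    set R := (z • (1 : Matrix σ σ ℂ) - A.map Complex.ofReal)⁻¹
    set e : σ → ℂ := -((z * z⁻¹ ^ P) • fun i => (ssState A B w' P i : ℂ))
    have hX : Xh = R *ᵥ (B.map Complex.ofReal *ᵥ Wh + e) := by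
      have hu := (hasSum_resolvent (P := A.map Complex.ofReal) hA hz1.ge).1
      have h3 : (z • (1 : Matrix σ σ ℂ) - A.map Complex.ofReal) *ᵥ Xh =
          B.map Complex.ofReal *ᵥ Wh + e := by
        rw [Matrix.sub_mulVec, Matrix.smul_mulVec, Matrix.one_mulVec, hstate]
        simp only [e]
        abel
      rw [← h3, Matrix.mulVec_mulVec, Matrix.nonsing_inv_mul _
        ((Matrix.isUnit_iff_isUnit_det _).1 hu), Matrix.one_mulVec]
    have hY : truncSeries (ss A B C D w') P z⁻¹ =
        ssTf A B C D z *ᵥ Wh + (C.map Complex.ofReal * R) *ᵥ e := by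
      have h3 : truncSeries (ss A B C D w') P z⁻¹ =
          C.map Complex.ofReal *ᵥ Xh + D.map Complex.ofReal *ᵥ Wh := by
        rw [← truncSeries_mulVec, ← truncSeries_mulVec, ← truncSeries_add]
        rfl
      rw [h3, hX, ssTf, Matrix.add_mulVec, Matrix.mulVec_add, Matrix.mulVec_add]
      simp only [Matrix.mulVec_mulVec, Matrix.mul_assoc]
      abel
    have he : sqNorm e = sqNorm (ssState A B w' P) := by
      have h3 : e = (-(z * z⁻¹ ^ P)) • fun i => (ssState A B w' P i : ℂ) := by
        simp only [e, neg_smul]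
      rw [h3, sqNorm_smul, sqNorm_ofReal]
      simp [hz1]
    rw [hY]
    refine (sqNorm_add_le hη _ _).trans (add_le_add ?_ ?_)
    · rw [mul_assoc]
      exact mul_le_mul_of_nonneg_left (hg z hz1 Wh) (by positivity)
    · rw [hE]
      refine mul_le_mul_of_nonneg_left ?_ (by positivity)
      refine (sqNorm_mulVec_le _ _).trans ?_
      rw [he]
      exact mul_le_mul_of_nonneg_right (hb z hz1) (sqNorm_nonneg _)
  -- The state tends to zero since its energy is finite.
  have hlim : Tendsto (fun P => sqNorm (ssState A B w' P)) atTop (𝓝 0) := by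
    obtain ⟨c, hc0, hc⟩ := exists_sum_sqNorm_state_le hA B
    refine (summable_of_sum_range_le (c := c * ∑ k ∈ Finset.range T, sqNorm (w k))
      (fun P => sqNorm_nonneg _) fun P => ?_).tendsto_atTop_zero
    have h1 := hc 0 w' P
    simp only [stateFrom_zero_eq, sqNorm_zero, zero_add] at h1
    refine h1.trans (mul_le_mul_of_nonneg_left ?_ hc0)
    rw [← hsw (max P T) (le_max_right _ _)]
    exact Finset.sum_le_sum_of_subset_of_nonneg (Finset.range_mono (le_max_left _ _))
      fun _ _ _ => sqNorm_nonneg _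
  have hlim2 : Tendsto (fun P => (1 + η) * g * ∑ k ∈ Finset.range T, sqNorm (w k) +
      (1 + η⁻¹) * (b * sqNorm (ssState A B w' P))) atTop
      (𝓝 ((1 + η) * g * ∑ k ∈ Finset.range T, sqNorm (w k))) := by
    simpa using ((hlim.const_mul b).const_mul (1 + η⁻¹)).const_add
      ((1 + η) * g * ∑ k ∈ Finset.range T, sqNorm (w k))
  exact ge_of_tendsto hlim2 (eventually_atTop.2 ⟨T, hP⟩)

end timeDomain

/-! ### Quadratic functions from the parallelogram law -/

section parallelogram

variable {σ : Type} [Fintype σ]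

/-- The Jordan-von Neumann argument: a function that satisfies the parallelogram law and is
bounded by a multiple of the squared norm is a quadratic form. -/
theorem exists_quadratic_of_parallelogram [DecidableEq σ] (W : (σ → ℝ) → ℝ)
    (hpar : ∀ x y, W (x + y) + W (x - y) = 2 * W x + 2 * W y) {c : ℝ}
    (hbd : ∀ x, |W x| ≤ c * sqNorm x) :
    ∃ X : Matrix σ σ ℝ, Xᵀ = X ∧ ∀ x, W x = x ⬝ᵥ X *ᵥ x := by
  have hc0 : ∀ x : σ → ℝ, 0 ≤ c * sqNorm x := fun x => (abs_nonneg _).trans (hbd x)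
  have hW0 : W 0 = 0 := by
    have h := hbd 0
    rw [sqNorm_zero, mul_zero] at h
    exact abs_eq_zero.1 (le_antisymm h (abs_nonneg _))
  have hneg : ∀ y, W (-y) = W y := by
    intro y
    have h := hpar 0 y
    rw [zero_add, zero_sub, hW0] at h
    linarith
  let q : (σ → ℝ) → (σ → ℝ) → ℝ := fun y x => W (x + y) - W x - W y
  have hadd : ∀ y x z, q y (x + z) = q y x + q y z := by
    intro y x z
    have h1 := hpar (x + z) y
    have h2 := hpar x (z - y)
    have h3 := hpar (x + y) z
    have h4 := hpar y z
    have e1 : x + (z - y) = x + z - y := by abel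
    have e2 : x - (z - y) = x + y - z := by abel
    have e3 : x + y + z = x + z + y := by abel
    have e4 : W (z - y) = W (y - z) := by rw [← hneg, neg_sub]
    have e5 : z + y = y + z := add_comm _ _
    rw [e1, e2, e4] at h2
    rw [e3] at h3
    simp only [q, e5]
    linarith
  have hsymm : ∀ x y, q y x = q x y := by
    intro x y
    simp only [q, add_comm x y]
    ring
  have hqb : ∀ y x, |q y x| ≤ 3 * (c * sqNorm x) + 3 * (c * sqNorm y) := by
    intro y x
    have h1 := abs_le.1 (hbd (x + y))
    have h2 := abs_le.1 (hbd x)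
    have h3 := abs_le.1 (hbd y)
    have h4 := sqNorm_parallelogram x y
    have h5 := hc0 (x - y)
    have h6 : c * sqNorm (x + y) + c * sqNorm (x - y) =
        2 * (c * sqNorm x) + 2 * (c * sqNorm y) := by
      rw [← mul_add, h4]; ring
    simp only [q]
    rw [abs_le]
    constructor <;> linarith
  -- Boundedness turns additivity into real linearity.
  have hnat : ∀ y (n : ℕ) x, q y ((n : ℝ) • x) = n * q y x := by
    intro y n x
    induction n with
    | zero =>
      simp only [q]; simp [hW0]
    | succ n ih =>
      rw [Nat.cast_succ, add_smul, one_smul, hadd, ih]; ring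
  have hcont : ∀ y, Continuous (AddMonoidHom.mk' (q y) (hadd y)) := by
    intro y
    refine continuous_of_continuousAt_zero _ ?_
    rw [ContinuousAt, map_zero, Metric.tendsto_nhds]
    intro ε hε
    set K := 3 * |c| + 3 * (c * sqNorm y) with hK
    have hK0 : 0 ≤ K := by have := hc0 y; positivity
    obtain ⟨n, hn⟩ := exists_nat_gt (K / ε)
    have hn0 : (0 : ℝ) < n := lt_of_le_of_lt (by positivity) hn
    have hsq : Tendsto (fun x : σ → ℝ => sqNorm ((n : ℝ) • x)) (𝓝 0) (𝓝 0) := by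
      have h1 : Continuous fun x : σ → ℝ => sqNorm ((n : ℝ) • x) := by
        simp only [sqNorm, Pi.smul_apply]
        fun_prop
      have h2 := h1.tendsto 0
      rwa [smul_zero, sqNorm_zero] at h2
    filter_upwards [hsq.eventually_lt_const zero_lt_one] with x hx
    rw [dist_zero_right, Real.norm_eq_abs]
    have h1 := hqb y ((n : ℝ) • x)
    rw [hnat, abs_mul, abs_of_pos hn0] at h1
    have h2 : c * sqNorm ((n : ℝ) • x) ≤ |c| := by
      calc c * sqNorm ((n : ℝ) • x) ≤ |c| * sqNorm ((n : ℝ) • x) :=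
            mul_le_mul_of_nonneg_right (le_abs_self c) (sqNorm_nonneg _)
        _ ≤ |c| * 1 := mul_le_mul_of_nonneg_left hx.le (abs_nonneg c)
        _ = |c| := mul_one _
    have h3 : n * |q y x| ≤ K := by rw [hK]; linarith
    have h4 : K < ε * n := by rwa [div_lt_iff₀' hε] at hn
    show |q y x| < ε
    by_contra! h5
    nlinarith
  let L : (σ → ℝ) → (σ → ℝ) →ₗ[ℝ] ℝ := fun y =>
    ((AddMonoidHom.mk' (q y) (hadd y)).toRealLinearMap (hcont y) : (σ → ℝ) →L[ℝ] ℝ)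
  have hL : ∀ y x, L y x = q y x := fun y x => rfl
  let b : (σ → ℝ) →ₗ[ℝ] (σ → ℝ) →ₗ[ℝ] ℝ := LinearMap.mk₂ ℝ (fun x y => q y x)
    (fun x x' y => hadd y x x') (fun r x y => by rw [← hL, ← hL, map_smul])
    (fun x y y' => by rw [hsymm, hadd, hsymm y, hsymm y'])
    (fun r x y => by rw [hsymm, hsymm x y, ← hL, ← hL, map_smul])
  have hb : ∀ x y, b x y = q y x := fun x y => rfl
  refine ⟨(1 / 2 : ℝ) • LinearMap.toMatrix₂' ℝ b, ?_, ?_⟩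
  · ext i j
    rw [Matrix.transpose_apply, Matrix.smul_apply, Matrix.smul_apply, LinearMap.toMatrix₂'_apply,
      LinearMap.toMatrix₂'_apply, hb, hb, hsymm]
  · intro x
    have h1 : b x x = x ⬝ᵥ LinearMap.toMatrix₂' ℝ b *ᵥ x := by
      rw [← Matrix.toLinearMap₂'_apply', Matrix.toLinearMap₂'_toMatrix']
    have h2 := hpar x x
    rw [sub_self, hW0] at h2
    have h3 : b x x = 2 * W x := by
      rw [hb]; simp only [q]; linarith
    rw [Matrix.smul_mulVec, dotProduct_smul, ← h1, h3, smul_eq_mul]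
    ring

end parallelogram

/-! ### The bounded-real lemma -/

section kyp

variable {σ : Type} [Fintype σ] {N : ℕ}

/-- The quadratic form of the bounded-real inequality. -/
theorem dotProduct_lmiMatrix_mulVec (A : Matrix σ σ ℝ) (B : Matrix σ (Fin N) ℝ)
    (C : Matrix (Fin N) σ ℝ) (D : Matrix (Fin N) (Fin N) ℝ) {X : Matrix σ σ ℝ} (hX : Xᵀ = X)
    (γ : ℝ) (x : σ → ℝ) (w u : Fin N → ℝ) :
    Sum.elim x (Sum.elim w u) ⬝ᵥ lmiMatrix A B C D X γ *ᵥ Sum.elim x (Sum.elim w u) =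
      (A *ᵥ x + B *ᵥ w) ⬝ᵥ X *ᵥ (A *ᵥ x + B *ᵥ w) - x ⬝ᵥ X *ᵥ x - γ * sqNorm w +
        2 * (u ⬝ᵥ (C *ᵥ x + D *ᵥ w)) - γ * sqNorm u := by
  have hT : ∀ {m n : Type} [Fintype m] [Fintype n] (Q : Matrix m n ℝ) (v : n → ℝ) (y : m → ℝ),
      v ⬝ᵥ Qᵀ *ᵥ y = (Q *ᵥ v) ⬝ᵥ y := by
    intro m n _ _ Q v y
    rw [Matrix.dotProduct_mulVec, Matrix.vecMul_transpose]
  have hXs : ∀ a b : σ → ℝ, a ⬝ᵥ X *ᵥ b = b ⬝ᵥ X *ᵥ a := by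
    intro a b
    rw [Matrix.dotProduct_mulVec, ← Matrix.mulVec_transpose, hX, dotProduct_comm]
  rw [lmiMatrix, Matrix.fromBlocks_mulVec]
  simp only [Sum.elim_comp_inl, Sum.elim_comp_inr, Matrix.fromCols_mulVec, Matrix.fromRows_mulVec,
    Matrix.fromBlocks_mulVec]
  rw [← sub_eq_zero]
  simp only [sumElim_dotProduct_sumElim, dotProduct_add, Matrix.sub_mulVec, Matrix.neg_mulVec,
    Matrix.smul_mulVec, Matrix.one_mulVec, dotProduct_sub, dotProduct_neg, dotProduct_smul,
    ← Matrix.mulVec_mulVec, hT, Matrix.mulVec_add, add_dotProduct, smul_eq_mul,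
    sqNorm_eq_dotProduct, Sum.elim_add_add]
  rw [dotProduct_comm (C *ᵥ x) u, dotProduct_comm (D *ᵥ w) u, hXs (B *ᵥ w) (A *ᵥ x)]
  ring

theorem posDef_iff_forall {ι : Type} [Fintype ι] {P : Matrix ι ι ℝ} :
    P.PosDef ↔ Pᵀ = P ∧ ∀ v : ι → ℝ, v ≠ 0 → 0 < v ⬝ᵥ P *ᵥ v := by
  rw [Matrix.posDef_iff_dotProduct_mulVec, Matrix.IsHermitian,
    Matrix.conjTranspose_eq_transpose_of_trivial]
  simp only [star_trivial]

theorem transpose_lmiMatrix (A : Matrix σ σ ℝ) (B : Matrix σ (Fin N) ℝ)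
    (C : Matrix (Fin N) σ ℝ) (D : Matrix (Fin N) (Fin N) ℝ) {X : Matrix σ σ ℝ} (hX : Xᵀ = X)
    (γ : ℝ) : (lmiMatrix A B C D X γ)ᵀ = lmiMatrix A B C D X γ := by
  rw [lmiMatrix, Matrix.fromBlocks_transpose, Matrix.fromBlocks_transpose,
    Matrix.transpose_fromCols, Matrix.transpose_fromRows]
  simp [Matrix.transpose_mul, hX, Matrix.mul_assoc]

/-- The LMI with `X > 0` as a statement on the quadratic form. -/
theorem mem_feasible_iff {M : ℕ} (A : Matrix σ σ ℝ) (B : Matrix σ (Fin N) ℝ)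
    (C : (Fin M → ℝ) → Matrix (Fin N) σ ℝ) (D : (Fin M → ℝ) → Matrix (Fin N) (Fin N) ℝ)
    (a : Fin M → ℝ) (X : Matrix σ σ ℝ) (γ : ℝ) :
    (a, X, γ) ∈ feasible A B C D ↔ Xᵀ = X ∧ (∀ x, x ≠ 0 → 0 < x ⬝ᵥ X *ᵥ x) ∧
      ∀ x w u, (x ≠ 0 ∨ w ≠ 0 ∨ u ≠ 0) →
        (A *ᵥ x + B *ᵥ w) ⬝ᵥ X *ᵥ (A *ᵥ x + B *ᵥ w) - x ⬝ᵥ X *ᵥ x - γ * sqNorm w +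
        2 * (u ⬝ᵥ (C a *ᵥ x + D a *ᵥ w)) - γ * sqNorm u < 0 := by
  have hmem : (a, X, γ) ∈ feasible A B C D ↔
    X.PosDef ∧ (-(lmiMatrix A B (C a) (D a) X γ)).PosDef := Iff.rfl
  rw [hmem, posDef_iff_forall, posDef_iff_forall, and_assoc]
  refine and_congr_right fun hX => and_congr_right fun _ => ?_
  rw [Matrix.transpose_neg, transpose_lmiMatrix A B _ _ hX]
  simp only [true_and, Matrix.neg_mulVec, dotProduct_neg]
  constructor
  · intro h x w u hne
    rw [← dotProduct_lmiMatrix_mulVec A B (C a) (D a) hX]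
    have h1 := h (Sum.elim x (Sum.elim w u)) (fun h0 => by
      have hx : x = 0 := funext fun i => congrFun h0 (Sum.inl i)
      have hw : w = 0 := funext fun i => congrFun h0 (Sum.inr (Sum.inl i))
      have hu : u = 0 := funext fun i => congrFun h0 (Sum.inr (Sum.inr i))
      rcases hne with h | h | h <;> contradiction)
    linarith
  · intro h v hv
    have hdec : v = Sum.elim (v ∘ Sum.inl)
        (Sum.elim (v ∘ Sum.inr ∘ Sum.inl) (v ∘ Sum.inr ∘ Sum.inr)) := by
      funext i
      rcases i with i | i | i <;> rfl
    rw [hdec, dotProduct_lmiMatrix_mulVec A B (C a) (D a) hX]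
    have h1 := h (v ∘ Sum.inl) (v ∘ Sum.inr ∘ Sum.inl) (v ∘ Sum.inr ∘ Sum.inr) (by
      by_contra! hall
      apply hv
      rw [hdec, hall.1, hall.2.1, hall.2.2]
      funext i
      rcases i with i | i | i <;> rfl)
    linarith

/-- The LMI bounds the `H^∞` norm: along `z x = A x + B w` with `|z| = 1` the terms with `X`
cancel. -/
theorem hinfNorm_lt_of_lmi [DecidableEq σ] [NeZero N] {A : Matrix σ σ ℝ} (hA : IsSchur A)
    (B : Matrix σ (Fin N) ℝ) (C : Matrix (Fin N) σ ℝ) (D : Matrix (Fin N) (Fin N) ℝ)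
    {X : Matrix σ σ ℝ} {γ : ℝ}
    (h : ∀ x w u, (x ≠ 0 ∨ w ≠ 0 ∨ u ≠ 0) →
        (A *ᵥ x + B *ᵥ w) ⬝ᵥ X *ᵥ (A *ᵥ x + B *ᵥ w) - x ⬝ᵥ X *ᵥ x - γ * sqNorm w +
        2 * (u ⬝ᵥ (C *ᵥ x + D *ᵥ w)) - γ * sqNorm u < 0) :
    hinfNorm (ss A B C D) < γ := by
  have hγ : 0 < γ := by
    have h1 := h 0 0 (fun _ => 1) (Or.inr (Or.inr fun h0 =>
      one_ne_zero (congrFun h0 (⟨0, NeZero.pos N⟩ : Fin N))))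
    have h2 := sqNorm_nonneg (fun _ : Fin N => (1 : ℝ))
    simp only [Matrix.mulVec_zero, add_zero, dotProduct_zero, sqNorm_zero, mul_zero, sub_zero,
      zero_sub] at h1
    by_contra! h3
    nlinarith
  -- The choice `u = y / γ` eliminates the third block.
  have hreal : ∀ x w, (x ≠ 0 ∨ w ≠ 0) →
      (A *ᵥ x + B *ᵥ w) ⬝ᵥ X *ᵥ (A *ᵥ x + B *ᵥ w) - x ⬝ᵥ X *ᵥ x +
        γ⁻¹ * sqNorm (C *ᵥ x + D *ᵥ w) - γ * sqNorm w < 0 := by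
    intro x w hne
    have h1 := h x w (γ⁻¹ • (C *ᵥ x + D *ᵥ w)) (by tauto)
    rw [smul_dotProduct, ← sqNorm_eq_dotProduct, sqNorm_smul, smul_eq_mul] at h1
    have h2 : γ * (‖γ⁻¹‖ ^ 2 * sqNorm (C *ᵥ x + D *ᵥ w)) = γ⁻¹ * sqNorm (C *ᵥ x + D *ᵥ w) := by
      rw [Real.norm_eq_abs, sq_abs]; field_simp
    rw [h2] at h1
    linarith
  have hfreq : ∀ z : ℂ, ‖z‖ = 1 → sigmaMax (ssTf A B C D z) < γ := by
    intro z hz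
    refine sigmaMax_lt hγ fun w hw => ?_
    have hu := (hasSum_resolvent (P := A.map Complex.ofReal) hA hz.ge).1
    set x : σ → ℂ := (z • (1 : Matrix σ σ ℂ) - A.map Complex.ofReal)⁻¹ *ᵥ
      (B.map Complex.ofReal *ᵥ w) with hx
    have hzx : z • x = A.map Complex.ofReal *ᵥ x + B.map Complex.ofReal *ᵥ w := by
      have h1 : (z • (1 : Matrix σ σ ℂ) - A.map Complex.ofReal) *ᵥ x =
          B.map Complex.ofReal *ᵥ w := by
        rw [hx, Matrix.mulVec_mulVec, Matrix.mul_nonsing_inv _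
          ((Matrix.isUnit_iff_isUnit_det _).1 hu), Matrix.one_mulVec]
      rw [Matrix.sub_mulVec, Matrix.smul_mulVec, Matrix.one_mulVec] at h1
      rw [← h1]; abel
    have hy : ssTf A B C D z *ᵥ w = C.map Complex.ofReal *ᵥ x + D.map Complex.ofReal *ᵥ w := by
      rw [ssTf, Matrix.add_mulVec, hx]
      simp only [Matrix.mulVec_mulVec, Matrix.mul_assoc]
    have hre : ∀ {m n : Type} [Fintype n] (Q : Matrix m n ℝ) (v : n → ℂ),
        (fun i => ((Q.map Complex.ofReal *ᵥ v) i).re) = Q *ᵥ fun i => (v i).re := by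
      intro m n _ Q v
      funext i
      simp [Matrix.mulVec, dotProduct]
    have him : ∀ {m n : Type} [Fintype n] (Q : Matrix m n ℝ) (v : n → ℂ),
        (fun i => ((Q.map Complex.ofReal *ᵥ v) i).im) = Q *ᵥ fun i => (v i).im := by
      intro m n _ Q v
      funext i
      simp [Matrix.mulVec, dotProduct]
    set xr : σ → ℝ := fun i => (x i).re
    set xi : σ → ℝ := fun i => (x i).im
    set wr : Fin N → ℝ := fun i => (w i).re
    set wi : Fin N → ℝ := fun i => (w i).im
    have hsr : A *ᵥ xr + B *ᵥ wr = z.re • xr - z.im • xi := by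
      rw [← hre, ← hre]
      funext i
      have h1 := congrArg Complex.re (congrFun hzx i)
      simp only [Pi.smul_apply, smul_eq_mul, Complex.mul_re, Pi.add_apply, Complex.add_re] at h1
      simp only [Pi.add_apply, Pi.sub_apply, Pi.smul_apply, smul_eq_mul]
      exact h1.symm
    have hsi : A *ᵥ xi + B *ᵥ wi = z.re • xi + z.im • xr := by
      rw [← him, ← him]
      funext i
      have h1 := congrArg Complex.im (congrFun hzx i)
      simp only [Pi.smul_apply, smul_eq_mul, Complex.mul_im, Pi.add_apply, Complex.add_im] at h1
      simp only [Pi.add_apply, Pi.smul_apply, smul_eq_mul]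
      exact h1.symm
    have hyr : (fun i => ((ssTf A B C D z *ᵥ w) i).re) = C *ᵥ xr + D *ᵥ wr := by
      rw [hy, ← hre, ← hre]; rfl
    have hyi : (fun i => ((ssTf A B C D z *ᵥ w) i).im) = C *ᵥ xi + D *ᵥ wi := by
      rw [hy, ← him, ← him]; rfl
    have hle : ∀ x w, (A *ᵥ x + B *ᵥ w) ⬝ᵥ X *ᵥ (A *ᵥ x + B *ᵥ w) - x ⬝ᵥ X *ᵥ x +
        γ⁻¹ * sqNorm (C *ᵥ x + D *ᵥ w) - γ * sqNorm w ≤ 0 := by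
      intro x w
      by_cases hne : x ≠ 0 ∨ w ≠ 0
      · exact (hreal x w hne).le
      · push Not at hne
        rw [hne.1, hne.2]; simp
    have h1 := hle xr wr
    have h2 := hle xi wi
    have h12 : (A *ᵥ xr + B *ᵥ wr) ⬝ᵥ X *ᵥ (A *ᵥ xr + B *ᵥ wr) - xr ⬝ᵥ X *ᵥ xr +
        γ⁻¹ * sqNorm (C *ᵥ xr + D *ᵥ wr) - γ * sqNorm wr +
        ((A *ᵥ xi + B *ᵥ wi) ⬝ᵥ X *ᵥ (A *ᵥ xi + B *ᵥ wi) - xi ⬝ᵥ X *ᵥ xi +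
        γ⁻¹ * sqNorm (C *ᵥ xi + D *ᵥ wi) - γ * sqNorm wi) < 0 := by
      by_cases hwr : wr = 0
      · have hwi : wi ≠ 0 := fun h0 => hw (funext fun i =>
          Complex.ext (congrFun hwr i) (congrFun h0 i))
        have := hreal xi wi (Or.inr hwi)
        linarith
      · have := hreal xr wr (Or.inr hwr)
        linarith
    have hz2 : z.re ^ 2 + z.im ^ 2 = 1 := by
      have h3 := Complex.sq_norm z
      rw [hz, Complex.normSq_apply] at h3
      nlinarith
    have hcancel : (A *ᵥ xr + B *ᵥ wr) ⬝ᵥ X *ᵥ (A *ᵥ xr + B *ᵥ wr) +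
        (A *ᵥ xi + B *ᵥ wi) ⬝ᵥ X *ᵥ (A *ᵥ xi + B *ᵥ wi) =
        xr ⬝ᵥ X *ᵥ xr + xi ⬝ᵥ X *ᵥ xi := by
      rw [hsr, hsi]
      simp only [Matrix.mulVec_add, Matrix.mulVec_sub, Matrix.mulVec_smul, add_dotProduct,
        sub_dotProduct, dotProduct_add, dotProduct_sub, smul_dotProduct, dotProduct_smul,
        smul_eq_mul]
      linear_combination (xr ⬝ᵥ X *ᵥ xr + xi ⬝ᵥ X *ᵥ xi) * hz2
    rw [sqNorm_eq_re_add_im (ssTf A B C D z *ᵥ w), sqNorm_eq_re_add_im w, hyr, hyi]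
    have h3 : γ⁻¹ * (sqNorm (C *ᵥ xr + D *ᵥ wr) + sqNorm (C *ᵥ xi + D *ᵥ wi)) <
        γ * (sqNorm wr + sqNorm wi) := by linarith
    rw [inv_mul_lt_iff₀ hγ] at h3
    calc _ < γ * (γ * (sqNorm wr + sqNorm wi)) := h3
      _ = _ := by ring
  obtain ⟨θ, -, hθ⟩ := (isGreatest_gains_ss hA B C D).1
  rw [← hθ]
  have h1 : ‖Complex.exp (θ * Complex.I)‖ = 1 := Complex.norm_exp_ofReal_mul_I θ
  simp only [tf_ss hA B C D h1.ge]
  exact hfreq _ h1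

/-- The stage cost of the optimal control problem whose value function solves the bounded-real
inequality. The terms with `ε` make the inequality strict. -/
noncomputable def stageCost (C : Matrix (Fin N) σ ℝ) (D : Matrix (Fin N) (Fin N) ℝ) (γ ε : ℝ)
    (x : σ → ℝ)
    (w : Fin N → ℝ) : ℝ :=
  γ⁻¹ * sqNorm (C *ᵥ x + D *ᵥ w) - γ * sqNorm w + ε * (sqNorm x + sqNorm w)

/-- Accumulated stage cost over the horizon `T`, from the initial state `x`. -/
noncomputable def totalCost (A : Matrix σ σ ℝ) (B : Matrix σ (Fin N) ℝ) (C : Matrix (Fin N) σ ℝ)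
    (D : Matrix (Fin N) (Fin N) ℝ) (γ ε : ℝ) (x : σ → ℝ) (w : Sig (Fin N)) (T : ℕ) : ℝ :=
  ∑ k ∈ Finset.range T, stageCost C D γ ε (stateFrom A B x w k) (w k)

/-- If the `H^∞` norm is below `γ`, the total cost is bounded uniformly in input and horizon. -/
theorem exists_totalCost_le [DecidableEq σ] {A : Matrix σ σ ℝ} (hA : IsSchur A)
    (B : Matrix σ (Fin N) ℝ)
    (C : Matrix (Fin N) σ ℝ) (D : Matrix (Fin N) (Fin N) ℝ) {γ : ℝ}
    (h : hinfNorm (ss A B C D) < γ) :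
    ∃ ε c : ℝ, 0 < ε ∧ ∀ x w T, totalCost A B C D γ ε x w T ≤ c * sqNorm x := by
  set g := hinfNorm (ss A B C D) with hgdef
  have hg0 : 0 ≤ g := hinfNorm_ss_nonneg hA B C D
  have hγ : 0 < γ := lt_of_le_of_lt hg0 h
  obtain ⟨c, hc0, hc⟩ := exists_sum_sqNorm_state_le hA B
  obtain ⟨cC, hcC0, hcC⟩ := exists_sqNorm_mulVec_le C
  -- The slack `γ² - g²` pays for splitting off the free response (twice, with `η`) and for `ε`.
  obtain ⟨η, hη0, hη⟩ : ∃ η : ℝ, 0 < η ∧ γ⁻¹ * ((1 + η) * ((1 + η) * g ^ 2)) < γ := by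
    have hlim : Tendsto (fun η : ℝ => γ⁻¹ * ((1 + η) * ((1 + η) * g ^ 2))) (𝓝[>] 0)
        (𝓝 (γ⁻¹ * ((1 + 0) * ((1 + 0) * g ^ 2)))) := by
      refine tendsto_nhdsWithin_of_tendsto_nhds (Continuous.tendsto ?_ 0)
      fun_prop
    have hlt : γ⁻¹ * ((1 + 0) * ((1 + 0) * g ^ 2)) < γ := by
      rw [inv_mul_lt_iff₀ hγ]; nlinarith
    obtain ⟨η, h1, h2⟩ := ((hlim.eventually_lt_const hlt).and self_mem_nhdsWithin).exists
    exact ⟨η, h2, h1⟩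
  set δ := γ - γ⁻¹ * ((1 + η) * ((1 + η) * g ^ 2)) with hδ
  have hδ0 : 0 < δ := by rw [hδ]; linarith
  set ε := δ / (c + 1) with hε
  have hε0 : 0 < ε := by positivity
  have hεc : ε * (c + 1) = δ := by rw [hε]; field_simp
  refine ⟨ε, γ⁻¹ * ((1 + η⁻¹) * (cC * c)) + ε * c, hε0, fun x w T => ?_⟩
  have hsplit : ∀ k, stateFrom A B x w k = ssState A B w k + stateFrom A B x 0 k := by
    intro k
    rw [← stateFrom_zero_eq, ← stateFrom_add, zero_add, add_zero]
  have hfree := hc x 0 T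
  have hzero : ∑ k ∈ Finset.range T, sqNorm ((0 : Sig (Fin N)) k) = 0 :=
    Finset.sum_eq_zero fun k _ => sqNorm_zero
  rw [hzero, add_zero] at hfree
  have hforced := sum_sqNorm_ss_le hA B C D (g := g ^ 2) (fun z hz v =>
    (sqNorm_mulVec_le_sigmaMax _ v).trans (mul_le_mul_of_nonneg_right
      (pow_le_pow_left₀ (sigmaMax_nonneg _) (sigmaMax_ssTf_le hA B C D hz) 2)
      (sqNorm_nonneg v))) hη0 w T
  have hstate := hc x w T
  set SW := ∑ k ∈ Finset.range T, sqNorm (w k)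
  have hout : ∑ k ∈ Finset.range T, sqNorm (C *ᵥ stateFrom A B x w k + D *ᵥ w k) ≤
      (1 + η) * ((1 + η) * g ^ 2 * SW) + (1 + η⁻¹) * (cC * (c * sqNorm x)) := by
    have h1 : ∀ k, sqNorm (C *ᵥ stateFrom A B x w k + D *ᵥ w k) ≤
        (1 + η) * sqNorm (ss A B C D w k) +
          (1 + η⁻¹) * (cC * sqNorm (stateFrom A B x 0 k)) := by
      intro k
      have e1 : C *ᵥ stateFrom A B x w k + D *ᵥ w k =
          ss A B C D w k + C *ᵥ stateFrom A B x 0 k := by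
        rw [hsplit, Matrix.mulVec_add, ss]; abel
      rw [e1]
      refine (sqNorm_add_le hη0 _ _).trans (add_le_add le_rfl ?_)
      exact mul_le_mul_of_nonneg_left (hcC _) (by positivity)
    refine (Finset.sum_le_sum fun k _ => h1 k).trans ?_
    rw [Finset.sum_add_distrib, ← Finset.mul_sum, ← Finset.mul_sum, ← Finset.mul_sum]
    gcongr
  have htotal : totalCost A B C D γ ε x w T =
      γ⁻¹ * ∑ k ∈ Finset.range T, sqNorm (C *ᵥ stateFrom A B x w k + D *ᵥ w k) - γ * SW +
        ε * (∑ k ∈ Finset.range T, sqNorm (stateFrom A B x w k) + SW) := by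
    simp only [totalCost, stageCost, Finset.sum_add_distrib, Finset.sum_sub_distrib,
      ← Finset.mul_sum, SW]
  rw [htotal]
  have h1 := mul_le_mul_of_nonneg_left hout (inv_nonneg.2 hγ.le)
  have h2 := mul_le_mul_of_nonneg_left hstate hε0.le
  have h3 : γ * SW = ε * (c + 1) * SW + γ⁻¹ * ((1 + η) * ((1 + η) * g ^ 2)) * SW := by
    rw [hεc, hδ]; ring
  rw [h3]
  nlinarith

/-- The value function of the optimal control problem: the supremum of the total cost. -/
noncomputable def valueFun (A : Matrix σ σ ℝ) (B : Matrix σ (Fin N) ℝ) (C : Matrix (Fin N) σ ℝ)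
    (D : Matrix (Fin N) (Fin N) ℝ) (γ ε : ℝ) (x : σ → ℝ) : ℝ :=
  ⨆ q : Sig (Fin N) × ℕ, totalCost A B C D γ ε x q.1 q.2

/-- If the `H^∞` norm is below `γ`, the value function is a quadratic form, and dynamic
programming gives a strict dissipation inequality for it. -/
theorem exists_dissipation [DecidableEq σ] {A : Matrix σ σ ℝ} (hA : IsSchur A)
    (B : Matrix σ (Fin N) ℝ)
    (C : Matrix (Fin N) σ ℝ) (D : Matrix (Fin N) (Fin N) ℝ) {γ : ℝ}
    (h : hinfNorm (ss A B C D) < γ) :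
    ∃ (ε : ℝ) (X : Matrix σ σ ℝ), 0 < ε ∧ Xᵀ = X ∧ (∀ x, ε * sqNorm x ≤ x ⬝ᵥ X *ᵥ x) ∧
      ∀ x w, stageCost C D γ ε x w + (A *ᵥ x + B *ᵥ w) ⬝ᵥ X *ᵥ (A *ᵥ x + B *ᵥ w) ≤
        x ⬝ᵥ X *ᵥ x := by
  have hγ : 0 < γ := lt_of_le_of_lt (hinfNorm_ss_nonneg hA B C D) h
  obtain ⟨ε, c, hε, hbd⟩ := exists_totalCost_le hA B C D h
  let J : (σ → ℝ) → Sig (Fin N) → ℕ → ℝ := totalCost A B C D γ ε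
  let W : (σ → ℝ) → ℝ := valueFun A B C D γ ε
  have hBdd : ∀ x, BddAbove (Set.range fun q : Sig (Fin N) × ℕ => J x q.1 q.2) := fun x =>
    ⟨c * sqNorm x, by rintro _ ⟨q, rfl⟩; exact hbd x q.1 q.2⟩
  have hJW : ∀ x w T, J x w T ≤ W x := fun x w T => le_ciSup (hBdd x) (w, T)
  have hWle : ∀ {x r}, (∀ w T, J x w T ≤ r) → W x ≤ r := fun {x r} hr =>
    ciSup_le fun q => hr q.1 q.2
  have hW0 : ∀ x, 0 ≤ W x := fun x => by simpa [J, totalCost] using hJW x 0 0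
  have hWc : ∀ x, W x ≤ c * sqNorm x := fun x => hWle (hbd x)
  -- Stopping the input at time `T` and lengthening the horizon does not lower the cost.
  have hpad : ∀ x w T T', T ≤ T' → J x w T ≤ J x (fun k => if k < T then w k else 0) T' := by
    intro x w T T' hT
    have h1 : J x w T = J x (fun k => if k < T then w k else 0) T := by
      refine Finset.sum_congr rfl fun k hk => ?_
      have hk' := Finset.mem_range.1 hk
      rw [stateFrom_congr A B x (v := fun k => if k < T then w k else 0) (T := T)
        (fun k hk => by simp [hk]) hk'.le]
      simp only [if_pos hk']
    rw [h1]
    refine Finset.sum_le_sum_of_subset_of_nonneg (Finset.range_mono hT) fun k _ hk => ?_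
    have hk' : ¬ k < T := fun h => hk (Finset.mem_range.2 h)
    simp only [if_neg hk', stageCost, sqNorm_zero, mul_zero, sub_zero, add_zero]
    exact add_nonneg (mul_nonneg (inv_nonneg.2 hγ.le) (sqNorm_nonneg _))
      (mul_nonneg hε.le (sqNorm_nonneg _))
  have hstage : ∀ x y w v, stageCost C D γ ε (x + y) (w + v) + stageCost C D γ ε (x - y) (w - v) =
      2 * stageCost C D γ ε x w + 2 * stageCost C D γ ε y v := by
    intro x y w v
    have h1 := sqNorm_parallelogram (C *ᵥ x + D *ᵥ w) (C *ᵥ y + D *ᵥ v)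
    have h2 := sqNorm_parallelogram x y
    have h3 := sqNorm_parallelogram w v
    have e1 : C *ᵥ (x + y) + D *ᵥ (w + v) = C *ᵥ x + D *ᵥ w + (C *ᵥ y + D *ᵥ v) := by
      rw [Matrix.mulVec_add, Matrix.mulVec_add]; abel
    have e2 : C *ᵥ (x - y) + D *ᵥ (w - v) = C *ᵥ x + D *ᵥ w - (C *ᵥ y + D *ᵥ v) := by
      rw [Matrix.mulVec_sub, Matrix.mulVec_sub]; abel
    simp only [stageCost, e1, e2]
    linear_combination γ⁻¹ * h1 + ε * h2 + (ε - γ) * h3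
  have hJpar : ∀ x y w v T, J (x + y) (w + v) T + J (x - y) (w - v) T =
      2 * J x w T + 2 * J y v T := by
    intro x y w v T
    have hsub : ∀ k, stateFrom A B (x - y) (w - v) k =
        stateFrom A B x w k - stateFrom A B y v k := by
      intro k
      have h1 := stateFrom_add A B (x - y) y (w - v) v k
      rw [sub_add_cancel, sub_add_cancel] at h1
      rw [h1]; abel
    simp only [J, totalCost]
    rw [← Finset.sum_add_distrib, Finset.mul_sum, Finset.mul_sum, ← Finset.sum_add_distrib]
    refine Finset.sum_congr rfl fun k _ => ?_
    rw [stateFrom_add, hsub, Pi.add_apply, Pi.sub_apply, hstage]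
  have hsuper : ∀ x y, 2 * W x + 2 * W y ≤ W (x + y) + W (x - y) := by
    intro x y
    have h1 : ∀ w T v S, 2 * J x w T + 2 * J y v S ≤ W (x + y) + W (x - y) := by
      intro w T v S
      have hw := hpad x w T (max T S) (le_max_left _ _)
      have hv := hpad y v S (max T S) (le_max_right _ _)
      set w' : Sig (Fin N) := fun k => if k < T then w k else 0
      set v' : Sig (Fin N) := fun k => if k < S then v k else 0
      have hp := hJpar x y w' v' (max T S)
      have ha := hJW (x + y) (w' + v') (max T S)
      have hb := hJW (x - y) (w' - v') (max T S)
      linarith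
    have h2 : ∀ v S, W x ≤ (W (x + y) + W (x - y) - 2 * J y v S) / 2 := fun v S =>
      hWle fun w T => by have := h1 w T v S; linarith
    have h3 : W y ≤ (W (x + y) + W (x - y) - 2 * W x) / 2 :=
      hWle fun v S => by have := h2 v S; linarith
    linarith
  have hscale : ∀ (r : ℝ) x, 0 < r → r ^ 2 * W x ≤ W (r • x) := by
    intro r x hr
    have h1 : ∀ w T, J (r • x) (r • w) T = r ^ 2 * J x w T := by
      intro w T
      simp only [J, totalCost]
      rw [Finset.mul_sum]
      refine Finset.sum_congr rfl fun k _ => ?_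
      rw [stateFrom_smul]
      simp only [stageCost, Pi.smul_apply, Matrix.mulVec_smul, ← smul_add, sqNorm_smul,
        Real.norm_eq_abs, sq_abs]
      ring
    have h2 : W x ≤ W (r • x) / r ^ 2 := hWle fun w T => by
      rw [le_div_iff₀ (by positivity), mul_comm, ← h1]
      exact hJW _ _ _
    rwa [le_div_iff₀ (by positivity), mul_comm] at h2
  have hpar : ∀ x y, W (x + y) + W (x - y) = 2 * W x + 2 * W y := by
    intro x y
    refine le_antisymm ?_ (hsuper x y)
    have h1 := hsuper (x + y) (x - y)
    have e1 : x + y + (x - y) = (2 : ℝ) • x := by rw [two_smul]; abel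
    have e2 : x + y - (x - y) = (2 : ℝ) • y := by rw [two_smul]; abel
    rw [e1, e2] at h1
    have half : ∀ x, W ((2 : ℝ) • x) ≤ 4 * W x := by
      intro x
      have h2 := hscale (1 / 2) ((2 : ℝ) • x) (by norm_num)
      rw [smul_smul] at h2
      norm_num at h2
      linarith
    have h3 := half x
    have h4 := half y
    linarith
  obtain ⟨X, hX, hWX⟩ := exists_quadratic_of_parallelogram W hpar (c := c) fun x => by
    rw [abs_of_nonneg (hW0 x)]; exact hWc x
  -- Bellman's inequality: the first step followed by an arbitrary continuation.
  have hbell : ∀ x w, stageCost C D γ ε x w + W (A *ᵥ x + B *ᵥ w) ≤ W x := by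
    intro x w
    have h1 : W (A *ᵥ x + B *ᵥ w) ≤ W x - stageCost C D γ ε x w := hWle fun v T => by
      have h2 := hJW x (fun k => Nat.casesOn k w v) (T + 1)
      have h3 : J x (fun k => Nat.casesOn k w v) (T + 1) =
          J (A *ᵥ x + B *ᵥ w) v T + stageCost C D γ ε x w := by
        simp only [J, totalCost]
        rw [Finset.sum_range_succ']
        congr 1
        refine Finset.sum_congr rfl fun k _ => ?_
        rw [stateFrom_succ']
        rfl
      linarith
    linarith
  refine ⟨ε, X, hε, hX, fun x => ?_, fun x w => ?_⟩
  · rw [← hWX]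
    have h1 := hbell x 0
    have h2 := hW0 (A *ᵥ x + B *ᵥ 0)
    have h3 : ε * sqNorm x ≤ stageCost C D γ ε x 0 := by
      simp only [stageCost, sqNorm_zero, mul_zero, sub_zero, add_zero]
      exact le_add_of_nonneg_left (mul_nonneg (inv_nonneg.2 hγ.le) (sqNorm_nonneg _))
    linarith
  · rw [← hWX, ← hWX]
    exact hbell x w

/-- Strict bounded-real lemma, without controllability or observability assumptions. -/
theorem hinfNorm_lt_iff_exists_feasible [DecidableEq σ] [NeZero N] {M : ℕ} {A : Matrix σ σ ℝ}
    (hA : IsSchur A)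
    (B : Matrix σ (Fin N) ℝ) (C : (Fin M → ℝ) → Matrix (Fin N) σ ℝ)
    (D : (Fin M → ℝ) → Matrix (Fin N) (Fin N) ℝ) (a : Fin M → ℝ) (γ : ℝ) :
    hinfNorm (ss A B (C a) (D a)) < γ ↔ ∃ X, (a, X, γ) ∈ feasible A B C D := by
  constructor
  · intro h
    have hγ : 0 < γ := lt_of_le_of_lt (hinfNorm_ss_nonneg hA B (C a) (D a)) h
    obtain ⟨ε, X, hε, hX, hpos, hdis⟩ := exists_dissipation hA B (C a) (D a) h
    refine ⟨X, (mem_feasible_iff A B C D a X γ).2 ⟨hX, fun x hx =>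
      lt_of_lt_of_le (mul_pos hε (sqNorm_pos hx)) (hpos x), fun x w u hne => ?_⟩⟩
    have h1 := hdis x w
    simp only [stageCost] at h1
    set y := C a *ᵥ x + D a *ᵥ w with hy
    -- Completion of the square in `u`.
    have h2 : sqNorm (y - γ • u) = sqNorm y - 2 * γ * (u ⬝ᵥ y) + γ ^ 2 * sqNorm u := by
      simp only [sqNorm_eq_dotProduct, sub_dotProduct, dotProduct_sub, smul_dotProduct,
        dotProduct_smul, smul_eq_mul, dotProduct_comm y u]
      ring
    have h3 : γ⁻¹ * sqNorm (y - γ • u) = γ⁻¹ * sqNorm y - 2 * (u ⬝ᵥ y) + γ * sqNorm u := by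
      rw [h2]; field_simp
    have h4 : 0 ≤ γ⁻¹ * sqNorm (y - γ • u) := mul_nonneg (inv_nonneg.2 hγ.le) (sqNorm_nonneg _)
    have hx0 := sqNorm_nonneg x
    have hw0 := sqNorm_nonneg w
    by_cases hxw : x = 0 ∧ w = 0
    · have hu : u ≠ 0 := by tauto
      have h5 := mul_pos hγ (sqNorm_pos hu)
      rw [hy, hxw.1, hxw.2]
      simp only [Matrix.mulVec_zero, add_zero, dotProduct_zero, sqNorm_zero, mul_zero, sub_zero]
      linarith
    · have h5 : 0 < sqNorm x + sqNorm w := by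
        by_cases hx : x = 0
        · exact add_pos_of_nonneg_of_pos hx0 (sqNorm_pos fun hw => hxw ⟨hx, hw⟩)
        · exact add_pos_of_pos_of_nonneg (sqNorm_pos hx) hw0
      have h6 := mul_pos hε h5
      linarith
  · rintro ⟨X, hX⟩
    exact hinfNorm_lt_of_lmi hA B (C a) (D a) ((mem_feasible_iff A B C D a X γ).1 hX).2.2

end kyp

/-! ### Reduction of the norm minimization to the matrix inequality -/

section reduction

variable {σ : Type} [Fintype σ] {M N : ℕ}

theorem lmiMatrix_add (A : Matrix σ σ ℝ) (B : Matrix σ (Fin N) ℝ) (C C' : Matrix (Fin N) σ ℝ)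
    (D D' : Matrix (Fin N) (Fin N) ℝ) (X X' : Matrix σ σ ℝ) (γ γ' : ℝ) :
    lmiMatrix A B (C + C') (D + D') (X + X') (γ + γ') =
      lmiMatrix A B C D X γ + lmiMatrix A B C' D' X' γ' := by
  ext i j
  rcases i with i | i | i <;> rcases j with j | j | j <;>
    simp [lmiMatrix, Matrix.mul_add, Matrix.add_mul, add_smul] <;> ring

theorem lmiMatrix_smul (A : Matrix σ σ ℝ) (B : Matrix σ (Fin N) ℝ) (r : ℝ)
    (C : Matrix (Fin N) σ ℝ) (D : Matrix (Fin N) (Fin N) ℝ) (X : Matrix σ σ ℝ) (γ : ℝ) :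
    lmiMatrix A B (r • C) (r • D) (r • X) (r • γ) = r • lmiMatrix A B C D X γ := by
  ext i j
  rcases i with i | i | i <;> rcases j with j | j | j <;>
    simp [lmiMatrix, mul_smul] <;> ring

theorem exists_affineMap_lmiMatrix (A : Matrix σ σ ℝ) (B : Matrix σ (Fin N) ℝ)
    (C : (Fin M → ℝ) →ᵃ[ℝ] Matrix (Fin N) σ ℝ) (D : (Fin M → ℝ) →ᵃ[ℝ] Matrix (Fin N) (Fin N) ℝ) :
    ∃ f : ((Fin M → ℝ) × Matrix σ σ ℝ × ℝ) →ᵃ[ℝ]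
      Matrix (σ ⊕ (Fin N ⊕ Fin N)) (σ ⊕ (Fin N ⊕ Fin N)) ℝ,
      ∀ a X γ, f (a, X, γ) = lmiMatrix A B (C a) (D a) X γ :=
  ⟨{ toFun := fun q => lmiMatrix A B (C q.1) (D q.1) q.2.1 q.2.2
     linear :=
      { toFun := fun q => lmiMatrix A B (C.linear q.1) (D.linear q.1) q.2.1 q.2.2
        map_add' := fun p q => by
          rw [Prod.fst_add, Prod.snd_add, map_add, map_add]
          exact lmiMatrix_add _ _ _ _ _ _ _ _ _ _
        map_smul' := fun r q => by
          rw [Prod.smul_fst, Prod.smul_snd, map_smul, map_smul]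
          exact lmiMatrix_smul _ _ _ _ _ _ _ }
     map_vadd' := fun p v => by
       simp only [vadd_eq_add, Prod.fst_add, Prod.snd_add]
       rw [← vadd_eq_add v.1 p.1, AffineMap.map_vadd, AffineMap.map_vadd, vadd_eq_add, vadd_eq_add]
       exact lmiMatrix_add _ _ _ _ _ _ _ _ _ _ }, fun _ _ _ => rfl⟩

theorem convex_posDef {ι : Type} [Fintype ι] : Convex ℝ {P : Matrix ι ι ℝ | P.PosDef} := by
  intro P hP Q hQ s t hs ht hst
  rw [Set.mem_ofPred_eq, posDef_iff_forall] at *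
  refine ⟨by rw [Matrix.transpose_add, Matrix.transpose_smul, Matrix.transpose_smul, hP.1, hQ.1],
    fun v hv => ?_⟩
  rw [Matrix.add_mulVec, Matrix.smul_mulVec, Matrix.smul_mulVec, dotProduct_add, dotProduct_smul,
    dotProduct_smul, smul_eq_mul, smul_eq_mul]
  have h1 := hP.2 v hv
  have h2 := hQ.2 v hv
  rcases hs.eq_or_lt with rfl | hs'
  · rw [zero_add] at hst
    rw [hst]; linarith
  · have := mul_pos hs' h1
    have := mul_nonneg ht h2.le
    linarith

theorem convex_feasible (A : Matrix σ σ ℝ) (B : Matrix σ (Fin N) ℝ)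
    (C : (Fin M → ℝ) →ᵃ[ℝ] Matrix (Fin N) σ ℝ) (D : (Fin M → ℝ) →ᵃ[ℝ] Matrix (Fin N) (Fin N) ℝ) :
    Convex ℝ (feasible A B C D) := by
  obtain ⟨f, hf⟩ := exists_affineMap_lmiMatrix A B C D
  have h1 : Convex ℝ {q : (Fin M → ℝ) × Matrix σ σ ℝ × ℝ | q.2.1.PosDef} :=
    convex_posDef.linear_preimage
      (LinearMap.fst ℝ (Matrix σ σ ℝ) ℝ ∘ₗ LinearMap.snd ℝ (Fin M → ℝ) (Matrix σ σ ℝ × ℝ))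
  have h2 : Convex ℝ {q : (Fin M → ℝ) × Matrix σ σ ℝ × ℝ |
      (-(lmiMatrix A B (C q.1) (D q.1) q.2.1 q.2.2)).PosDef} := by
    have h3 := (convex_posDef (ι := σ ⊕ (Fin N ⊕ Fin N))).affine_preimage (-f)
    have h4 : ∀ q, (-f) q = -(lmiMatrix A B (C q.1) (D q.1) q.2.1 q.2.2) := fun q =>
      congrArg Neg.neg (hf q.1 q.2.1 q.2.2)
    refine (congrArg (Convex ℝ) (Set.ext fun q => ?_)).mp h3
    rw [Set.mem_preimage, Set.mem_ofPred_eq, Set.mem_ofPred_eq, h4]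
  exact h1.inter h2

/-- A stable state-space family with affine output matrices reduces to the LMI problem. -/
theorem reducesToLMI_of_realization [DecidableEq σ] [NeZero N]
    (E : (Fin M → ℝ) → Sig (Fin N) → Sig (Fin N)) {A : Matrix σ σ ℝ} (hA : IsSchur A)
    (B : Matrix σ (Fin N) ℝ) {C : (Fin M → ℝ) → Matrix (Fin N) σ ℝ}
    {D : (Fin M → ℝ) → Matrix (Fin N) (Fin N) ℝ}
    (hC : ∃ f : (Fin M → ℝ) →ᵃ[ℝ] Matrix (Fin N) σ ℝ, ⇑f = C)
    (hD : ∃ f : (Fin M → ℝ) →ᵃ[ℝ] Matrix (Fin N) (Fin N) ℝ, ⇑f = D)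
    (hE : ∀ a, E a = ss A B (C a) (D a)) : ReducesToLMI E A B C D := by
  have hkyp : ∀ a γ, hinfNorm (E a) < γ ↔ ∃ X, (a, X, γ) ∈ feasible A B C D := fun a γ => by
    rw [hE]; exact hinfNorm_lt_iff_exists_feasible hA B C D a γ
  have h0 : ∀ a, 0 ≤ hinfNorm (E a) := fun a => by
    rw [hE]; exact hinfNorm_ss_nonneg hA B (C a) (D a)
  have hbdd : BddBelow (Set.range fun a => hinfNorm (E a)) :=
    ⟨0, by rintro _ ⟨a, rfl⟩; exact h0 a⟩
  have hat : ∀ a, IsGLB {γ | ∃ X, (a, X, γ) ∈ feasible A B C D} (hinfNorm (E a)) := by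
    intro a
    have hset : {γ | ∃ X, (a, X, γ) ∈ feasible A B C D} = Set.Ioi (hinfNorm (E a)) := by
      ext γ
      exact (hkyp a γ).symm
    rw [hset]
    exact isGLB_Ioi
  have hval : IsGLB {γ | ∃ a X, (a, X, γ) ∈ feasible A B C D} (⨅ a, hinfNorm (E a)) := by
    constructor
    · rintro γ ⟨a, X, hX⟩
      exact (ciInf_le hbdd a).trans ((hkyp a γ).2 ⟨X, hX⟩).le
    · intro b hb
      refine le_ciInf fun a => (hat a).2 ?_
      rintro γ ⟨X, hX⟩
      exact hb ⟨a, X, hX⟩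
  have hmin : ∀ a, (∀ b, hinfNorm (E a) ≤ hinfNorm (E b)) ↔
      IsOptimalCoeff (feasible A B C D) a := by
    intro a
    constructor
    · intro h
      refine ⟨_, hat a, ?_⟩
      have heq : hinfNorm (E a) = ⨅ b, hinfNorm (E b) :=
        le_antisymm (le_ciInf h) (ciInf_le hbdd a)
      rw [heq]
      exact hval
    · rintro ⟨v, hv1, hv2⟩ b
      rw [(hat a).unique hv1, hv2.unique hval]
      exact ciInf_le hbdd b
  obtain ⟨f, rfl⟩ := hC
  obtain ⟨g, rfl⟩ := hD
  exact
    { stable := hA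
      affineC := ⟨f, rfl⟩
      affineD := ⟨g, rfl⟩
      realization := hE
      transfer := fun a z hz => by rw [hE]; exact hasSum_tfTerm_ss hA B (f a) (g a) hz
      norm_attained := fun a => by rw [hE]; exact isGreatest_gains_ss hA B (f a) (g a)
      kyp := hkyp
      affine_lmi := exists_affineMap_lmiMatrix A B f g
      convex := convex_feasible A B f g
      value_at := hat
      value := hval
      minimizers := hmin }

variable {n₁ n₂ nK : ℕ}

theorem isSchur_blockA {A₁ : Matrix (Fin n₁) (Fin n₁) ℝ} {A₂ : Matrix (Fin n₂) (Fin n₂) ℝ}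
    (C₂ : Matrix Unit (Fin n₂) ℝ) {AK : Matrix (Fin nK) (Fin nK) ℝ} (BK : Matrix (Fin nK) Unit ℝ)
    (h₁ : IsSchur A₁) (h₂ : IsSchur A₂) (hK : IsSchur AK) :
    IsSchur (blockA A₁ A₂ C₂ AK BK) :=
  isSchur_fromBlocks h₁ (isSchur_fromBlocks h₂ hK)

theorem exists_affineMap_blockC {κ : Type} [Fintype κ] (C₁ : Matrix (Fin N) (Fin n₁) ℝ)
    (C₂ : Matrix Unit (Fin n₂) ℝ) (P : Matrix (Fin N) κ ℝ)
    {CK : (Fin M → ℝ) → Matrix κ (Fin nK) ℝ} {DK : (Fin M → ℝ) → Matrix κ Unit ℝ}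
    (hC : IsLinearMap ℝ CK) (hD : IsLinearMap ℝ DK) :
    ∃ f : (Fin M → ℝ) →ᵃ[ℝ] Matrix (Fin N) (Fin n₁ ⊕ (Fin n₂ ⊕ Fin nK)) ℝ,
      ⇑f = fun a => blockC C₁ C₂ (P * CK a) (P * DK a) := by
  let l : (Fin M → ℝ) →ₗ[ℝ] Matrix (Fin N) (Fin n₁ ⊕ (Fin n₂ ⊕ Fin nK)) ℝ :=
    { toFun := fun a => blockC 0 C₂ (P * CK a) (P * DK a)
      map_add' := fun a b => by
        ext i j
        rcases j with j | j | j <;>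
          simp [blockC, hC.map_add, hD.map_add, Matrix.mul_add, Matrix.add_mul, add_comm]
      map_smul' := fun r a => by
        ext i j
        rcases j with j | j | j <;> simp [blockC, hC.map_smul, hD.map_smul] }
  refine ⟨l.toAffineMap + AffineMap.const ℝ _ (blockC C₁ C₂ 0 0), ?_⟩
  funext a
  ext i j
  rcases j with j | j | j <;> simp [l, blockC]

theorem isLinearMap_firC : IsLinearMap ℝ (firC : (Fin M → ℝ) → Matrix Unit (Fin (M - 1)) ℝ) :=
  ⟨fun _ _ => rfl, fun _ _ => rfl⟩

theorem isLinearMap_firD [NeZero M] : IsLinearMap ℝ (firD : (Fin M → ℝ) → Matrix Unit Unit ℝ) :=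
  ⟨fun _ _ => rfl, fun _ _ => rfl⟩

theorem isLinearMap_liftedC (L : ℕ) :
    IsLinearMap ℝ (liftedC L : (Fin M → ℝ) → Matrix (Fin L) (Fin (M - 1)) ℝ) := by
  constructor
  · intro a b
    ext i j
    simp [liftedC, isLinearMap_firC.map_add, Matrix.add_mul]
  · intro r a
    ext i j
    simp [liftedC, isLinearMap_firC.map_smul]

theorem isLinearMap_liftedD (L : ℕ) [NeZero M] :
    IsLinearMap ℝ (liftedD L : (Fin M → ℝ) → Matrix (Fin L) Unit ℝ) := by
  constructor
  · intro a b
    ext i j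
    by_cases hi : (i : ℕ) = 0 <;>
      simp [liftedD, hi, isLinearMap_firC.map_add, isLinearMap_firD.map_add, Matrix.add_mul]
  · intro r a
    ext i j
    by_cases hi : (i : ℕ) = 0 <;>
      simp [liftedD, hi, isLinearMap_firC.map_smul, isLinearMap_firD.map_smul]

/-- The single-rate error system reduces to the linear matrix inequality of its block
realization. -/
theorem reducesToLMI_errSys [NeZero N] [NeZero M] {h : ℝ} {d : ℕ} {Kc F : RatFunc ℝ}
    {A₁ : Matrix (Fin n₁) (Fin n₁) ℝ} {B₁ : Matrix (Fin n₁) (Fin N) ℝ}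
    {C₁ : Matrix (Fin N) (Fin n₁) ℝ} {D₁ : Matrix (Fin N) (Fin N) ℝ}
    {A₂ : Matrix (Fin n₂) (Fin n₂) ℝ} {B₂ : Matrix (Fin n₂) (Fin N) ℝ}
    {C₂ : Matrix Unit (Fin n₂) ℝ} (h₁ : IsSchur A₁) (h₂ : IsSchur A₂)
    (hT₁ : sysT1 h N d Kc F = ss A₁ B₁ C₁ D₁) (hT₂ : sysT2 h N F = ss A₂ B₂ C₂ 0) :
    ReducesToLMI (fun a : Fin M → ℝ => errSys h N d Kc F a)
      (blockA A₁ A₂ C₂ (firA M) (firB M)) (blockB (M - 1) B₁ B₂)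
      (fun a => blockC C₁ C₂ (colOnes N * firC a) (colOnes N * firD a)) (fun _ => D₁) := by
  refine reducesToLMI_of_realization _ (isSchur_blockA C₂ _ h₁ h₂ (isSchur_firA M)) _
    (exists_affineMap_blockC C₁ C₂ _ isLinearMap_firC isLinearMap_firD)
    ⟨AffineMap.const ℝ _ D₁, rfl⟩ fun a => ?_
  funext w
  have hE : errSys h N d Kc F a w =
    sysT1 h N d Kc F w - gain (colOnes N) (fir a (sysT2 h N F w)) := rfl
  rw [hE, hT₁, hT₂, fir_eq_ss, sub_gain_ss_eq_ss_block]

/-- The multi-rate error system reduces to the linear matrix inequality of its block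
realization, in which the FIR filter enters through its lifted realization. -/
theorem reducesToLMI_errSysMR {L p : ℕ} (hL : 0 < L) (hp : 0 < p) [NeZero M] {h : ℝ} {d : ℕ}
    {Kc F : RatFunc ℝ}
    {A₁ : Matrix (Fin n₁) (Fin n₁) ℝ} {B₁ : Matrix (Fin n₁) (Fin (L * p)) ℝ}
    {C₁ : Matrix (Fin (L * p)) (Fin n₁) ℝ} {D₁ : Matrix (Fin (L * p)) (Fin (L * p)) ℝ}
    {A₂ : Matrix (Fin n₂) (Fin n₂) ℝ} {B₂ : Matrix (Fin n₂) (Fin (L * p)) ℝ}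
    {C₂ : Matrix Unit (Fin n₂) ℝ} (h₁ : IsSchur A₁) (h₂ : IsSchur A₂)
    (hT₁ : sysT1 h (L * p) d Kc F = ss A₁ B₁ C₁ D₁)
    (hT₂ : sysT2 h (L * p) F = ss A₂ B₂ C₂ 0) :
    ReducesToLMI (fun a : Fin M → ℝ => errSysMR h L p d Kc F a)
      (blockA A₁ A₂ C₂ (firA M ^ L) (firA M ^ (L - 1) * firB M)) (blockB (M - 1) B₁ B₂)
      (fun a => blockC C₁ C₂ (blkOnes L p * liftedC L a) (blkOnes L p * liftedD L a))
      (fun _ => D₁) := by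
  have : NeZero (L * p) := ⟨(Nat.mul_pos hL hp).ne'⟩
  refine reducesToLMI_of_realization _
    (isSchur_blockA C₂ _ h₁ h₂ (isSchur_pow (isSchur_firA M) hL)) _
    (exists_affineMap_blockC C₁ C₂ _ (isLinearMap_liftedC L) (isLinearMap_liftedD L))
    ⟨AffineMap.const ℝ _ D₁, rfl⟩ fun a => ?_
  funext w
  have hE : errSysMR h L p d Kc F a w =
    sysT1 h (L * p) d Kc F w - gain (blkOnes L p) (liftedFir L a (sysT2 h (L * p) F w)) := rfl
  rw [hE, hT₁, hT₂, liftedFir_eq_ss hL, sub_gain_ss_eq_ss_block]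

end reduction

/-! ### Stable realizations of interconnections -/

section realizable

variable {ι κ μ : Type} [Fintype ι]

/-- The system `G` has a finite-dimensional Schur stable state-space realization with direct
feedthrough `D`. -/
def HasStableRealization (G : Sig ι → Sig κ) (D : Matrix κ ι ℝ) : Prop :=
  ∃ (σ : Type) (_ : Fintype σ) (_ : DecidableEq σ) (A : Matrix σ σ ℝ) (B : Matrix σ ι ℝ)
    (C : Matrix κ σ ℝ), IsSchur A ∧ G = ss A B C D

theorem HasStableRealization.exists_fin {G : Sig ι → Sig κ} {D : Matrix κ ι ℝ}
    (h : HasStableRealization G D) :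
    ∃ (n : ℕ) (A : Matrix (Fin n) (Fin n) ℝ) (B : Matrix (Fin n) ι ℝ) (C : Matrix κ (Fin n) ℝ),
      IsSchur A ∧ G = ss A B C D := by
  obtain ⟨σ, _, _, A, B, C, hA, rfl⟩ := h
  exact ⟨Fintype.card σ, _, _, _, isSchur_submatrix (Fintype.equivFin σ) hA,
    (ss_reindex (Fintype.equivFin σ) A B C D).symm⟩

theorem HasStableRealization.comp [Fintype κ] {G₂ : Sig κ → Sig μ} {G₁ : Sig ι → Sig κ}
    {D₂ : Matrix μ κ ℝ}
    {D₁ : Matrix κ ι ℝ} (h₂ : HasStableRealization G₂ D₂) (h₁ : HasStableRealization G₁ D₁) :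
    HasStableRealization (fun w => G₂ (G₁ w)) (D₂ * D₁) := by
  obtain ⟨σ, _, _, A₁, B₁, C₁, hA₁, rfl⟩ := h₁
  obtain ⟨τ, _, _, A₂, B₂, C₂, hA₂, rfl⟩ := h₂
  exact ⟨σ ⊕ τ, inferInstance, inferInstance, _, _, _, isSchur_fromBlocks hA₁ hA₂,
    funext fun w => ss_cascade A₁ B₁ C₁ D₁ A₂ B₂ C₂ D₂ w⟩

theorem HasStableRealization.gain [Fintype κ] {G : Sig ι → Sig κ} {D : Matrix κ ι ℝ}
    (h : HasStableRealization G D) (P : Matrix μ κ ℝ) :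
    HasStableRealization (fun w => SampledData.gain P (G w)) (P * D) := by
  obtain ⟨σ, _, _, A, B, C, hA, rfl⟩ := h
  exact ⟨σ, inferInstance, inferInstance, _, _, _, hA, funext fun w => gain_ss A B C D P w⟩

theorem hasStableRealization_delay_one [DecidableEq ι] :
    HasStableRealization (delay 1 : Sig ι → Sig ι) 0 :=
  ⟨ι, inferInstance, inferInstance, 0, 1, 1, isSchur_zero, funext delay_one_eq_ss⟩

/-- A delay by at least one step removes the direct feedthrough. -/
theorem HasStableRealization.delay [Fintype κ] [DecidableEq κ] {G : Sig ι → Sig κ}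
    {D : Matrix κ ι ℝ}
    (h : HasStableRealization G D) (d : ℕ) :
    HasStableRealization (fun w => SampledData.delay d (G w)) (if d = 0 then D else 0) := by
  induction d with
  | zero => simpa using h
  | succ d ih =>
    have h1 := hasStableRealization_delay_one.comp ih
    rw [Matrix.zero_mul] at h1
    have e : (fun w => SampledData.delay (d + 1) (G w)) =
        fun w => SampledData.delay 1 (SampledData.delay d (G w)) :=
      funext fun w => delay_succ d (G w)
    rw [e, if_neg (Nat.succ_ne_zero d)]
    exact h1

/-- Lifting a strictly causal scalar system gives a strictly lower triangular feedthrough, whose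
first row vanishes. -/
theorem HasStableRealization.lift {G : Sig Unit → Sig Unit} {D : Matrix Unit Unit ℝ}
    (h : HasStableRealization G D) {N : ℕ} (hN : 0 < N) :
    ∃ D' : Matrix (Fin N) (Fin N) ℝ, HasStableRealization (SampledData.lift N G) D' ∧
      (D = 0 → rowFirst N * D' = 0) := by
  obtain ⟨σ, _, _, A, B, C, hA, rfl⟩ := h
  refine ⟨liftD N A B C D, ⟨σ, inferInstance, inferInstance, _, _, _, isSchur_pow hA hN,
    lift_ss N A B C D⟩, ?_⟩
  rintro rfl
  ext u j
  rw [Matrix.mul_apply, Finset.sum_eq_zero, Matrix.zero_apply]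
  intro i _
  simp only [rowFirst, liftD, Matrix.of_apply]
  by_cases hi : (i : ℕ) = 0
  · rw [if_neg (fun h : j < i => by rw [Fin.lt_def, hi] at h; omega)]
    simp
  · rw [if_neg hi, zero_mul]

end realizable

open NormedSpace

/-! ### Matrix exponentials of Hurwitz matrices -/

section hurwitz

variable {σ : Type} [Fintype σ] [DecidableEq σ]

/-- Continuous-time stability: all eigenvalues have negative real part. -/
def IsHurwitz (A : Matrix σ σ ℝ) : Prop :=
  ∀ (μ : ℂ) (v : σ → ℂ), v ≠ 0 → A.map Complex.ofReal *ᵥ v = μ • v → μ.re < 0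

open scoped Matrix.Norms.Operator in
theorem hasDerivAt_exp_smul_apply (A : Matrix σ σ ℝ) (t : ℝ) (i j : σ) :
    HasDerivAt (fun t : ℝ => exp (t • A) i j) ((A * exp (t • A)) i j) t :=
  hasDerivAt_pi.1 (hasDerivAt_pi.1 (hasDerivAt_exp_smul_const' (𝕂 := ℝ) A t) i) j

theorem exp_add_smul (A : Matrix σ σ ℝ) (s t : ℝ) :
    exp ((s + t) • A) = exp (s • A) * exp (t • A) := by
  rw [add_smul]
  exact Matrix.exp_add_of_commute _ _ (((Commute.refl A).smul_left s).smul_right t)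

theorem exp_natCast_mul_smul (A : Matrix σ σ ℝ) (k : ℕ) (t : ℝ) :
    exp (((k : ℝ) * t) • A) = exp (t • A) ^ k := by
  induction k with
  | zero => simp
  | succ k ih => rw [Nat.cast_succ, add_mul, one_mul, exp_add_smul, ih, pow_succ]

theorem map_ofReal_exp (A : Matrix σ σ ℝ) :
    (exp A).map Complex.ofReal = exp (A.map Complex.ofReal) := by
  have hc : Continuous (Complex.ofRealHom.mapMatrix (m := σ)) :=
    continuous_id.matrix_map Complex.continuous_ofReal
  open scoped Matrix.Norms.Operator in
  exact NormedSpace.map_exp (Complex.ofRealHom.mapMatrix (m := σ)) hc A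

theorem exp_mulVec_of_eigenvector {P : Matrix σ σ ℂ} {v : σ → ℂ} {μ : ℂ} (h : P *ᵥ v = μ • v) :
    exp P *ᵥ v = Complex.exp μ • v := by
  have h1 : HasSum (fun n : ℕ => ((n.factorial : ℂ)⁻¹) • P ^ n) (exp P) := by
    open scoped Matrix.Norms.Operator in
    exact exp_series_hasSum_exp' P
  have h2 : HasSum (fun n : ℕ => ((n.factorial : ℂ)⁻¹) • μ ^ n) (Complex.exp μ) := by
    rw [Complex.exp_eq_exp_ℂ]
    exact exp_series_hasSum_exp' μ
  have hpow : ∀ n : ℕ, P ^ n *ᵥ v = μ ^ n • v := by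
    intro n
    induction n with
    | zero => simp
    | succ n ih => rw [pow_succ', ← Matrix.mulVec_mulVec, ih, Matrix.mulVec_smul, h, smul_smul,
        pow_succ]
  let φ : Matrix σ σ ℂ →+ (σ → ℂ) :=
    { toFun := fun Q => Q *ᵥ v
      map_zero' := Matrix.zero_mulVec v
      map_add' := fun Q R => Matrix.add_mulVec Q R v }
  have h3 : HasSum (fun n : ℕ => (((n.factorial : ℂ)⁻¹) • μ ^ n) • v) (exp P *ᵥ v) := by
    have h4 := h1.map φ (continuous_id.matrix_mulVec continuous_const)
    refine h4.congr_fun fun n => ?_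
    simp only [φ, Function.comp_apply, AddMonoidHom.coe_mk, ZeroHom.coe_mk, Matrix.smul_mulVec,
      hpow, smul_smul, smul_eq_mul]
  exact h3.unique (h2.smul_const v)

/-- The exponential of a Hurwitz matrix is Schur stable. Since `A` commutes with `exp A`, every
eigenspace of `exp A` contains an eigenvector of `A`. -/
theorem IsHurwitz.isSchur_exp {A : Matrix σ σ ℝ} (hA : IsHurwitz A) {t : ℝ} (ht : 0 < t) :
    IsSchur (exp (t • A)) := by
  rw [isSchur_iff]
  intro ν v hv he
  set P : Matrix σ σ ℂ := A.map Complex.ofReal with hP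
  have hexp : (exp (t • A)).map Complex.ofReal = exp ((t : ℂ) • P) := by
    rw [map_ofReal_exp]
    congr 1
    ext i j
    simp [hP]
  rw [hexp] at he
  have hcomm : Commute P (exp ((t : ℂ) • P)) := by
    open scoped Matrix.Norms.Operator in
    exact ((Commute.refl P).smul_right (t : ℂ)).exp_right
  let W : Submodule ℂ (σ → ℂ) := Module.End.eigenspace (Matrix.toLin' (exp ((t : ℂ) • P))) ν
  have hW : ∀ u, u ∈ W ↔ exp ((t : ℂ) • P) *ᵥ u = ν • u := fun u => by
    rw [Module.End.mem_eigenspace_iff, Matrix.toLin'_apply]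
  have hmaps : ∀ u ∈ W, Matrix.toLin' P u ∈ W := by
    intro u hu
    rw [hW] at *
    rw [Matrix.toLin'_apply, Matrix.mulVec_mulVec, ← hcomm.eq, ← Matrix.mulVec_mulVec, hu,
      Matrix.mulVec_smul]
  have : Nontrivial W := ⟨⟨⟨v, (hW v).2 he⟩, 0, fun h => hv (congrArg Subtype.val h)⟩⟩
  obtain ⟨μ, hμ⟩ := Module.End.exists_eigenvalue ((Matrix.toLin' P).restrict hmaps)
  obtain ⟨⟨u, huW⟩, hu1⟩ := hμ.exists_hasEigenvector
  have hu0 : u ≠ 0 := fun h => hu1.2 (Subtype.ext h)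
  have huP : P *ᵥ u = μ • u := by
    simpa using congrArg Subtype.val hu1.apply_eq_smul
  have hre := hA μ u hu0 huP
  have h1 : ((t : ℂ) • P) *ᵥ u = ((t : ℂ) * μ) • u := by
    rw [Matrix.smul_mulVec, huP, smul_smul]
  have h2 := exp_mulVec_of_eigenvector h1
  rw [(hW u).1 huW] at h2
  have h3 : ν = Complex.exp ((t : ℂ) * μ) := smul_left_injective ℂ hu0 h2
  rw [h3, Complex.norm_exp, Real.exp_lt_one_iff]
  simpa using mul_neg_of_pos_of_neg ht hre

theorem continuous_exp_smul_apply (A : Matrix σ σ ℝ) (i j : σ) :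
    Continuous fun t : ℝ => exp (t • A) i j :=
  continuous_iff_continuousAt.2 fun t => (hasDerivAt_exp_smul_apply A t i j).continuousAt

theorem IsHurwitz.exists_abs_exp_le {A : Matrix σ σ ℝ} (hA : IsHurwitz A) :
    ∃ K lam : ℝ, 0 ≤ K ∧ 0 < lam ∧ ∀ t, 0 ≤ t → ∀ i j,
      |exp (t • A) i j| ≤ K * Real.exp (-lam * t) := by
  obtain ⟨c, r, hc, hr0, hr1, hb⟩ := exists_norm_pow_le
    (P := (exp ((1 : ℝ) • A)).map Complex.ofReal) (hA.isSchur_exp one_pos)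
  obtain ⟨K₁, hK₁⟩ : ∃ K₁, ∀ s ∈ Set.Icc (0 : ℝ) 1, ∀ i j, |exp (s • A) i j| ≤ K₁ := by
    have hcont : Continuous fun s : ℝ => ∑ i, ∑ j, |exp (s • A) i j| :=
      continuous_finsetSum _ fun i _ => continuous_finsetSum _ fun j _ =>
        (continuous_exp_smul_apply A i j).abs
    obtain ⟨K₁, hK₁⟩ := (isCompact_Icc (a := (0 : ℝ)) (b := 1)).bddAbove_image hcont.continuousOn
    refine ⟨K₁, fun s hs i j => le_trans ?_ (hK₁ ⟨s, hs, rfl⟩)⟩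
    exact (Finset.single_le_sum (f := fun j => |exp (s • A) i j|) (fun _ _ => abs_nonneg _)
      (Finset.mem_univ j)).trans
      (Finset.single_le_sum (f := fun i => ∑ j, |exp (s • A) i j|)
        (fun _ _ => Finset.sum_nonneg fun _ _ => abs_nonneg _) (Finset.mem_univ i))
  set K₂ := max K₁ 0
  have hK₂0 : 0 ≤ K₂ := le_max_right _ _
  have hlog : Real.log r < 0 := Real.log_neg hr0 hr1
  refine ⟨∑ _k : σ, c * r⁻¹ * K₂, -Real.log r, Finset.sum_nonneg fun _ _ => by positivity,
    neg_pos.2 hlog, fun t ht i j => ?_⟩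
  have hsplit : exp (t • A) = exp ((1 : ℝ) • A) ^ ⌊t⌋₊ * exp ((t - ⌊t⌋₊) • A) := by
    rw [← exp_natCast_mul_smul, ← exp_add_smul]
    congr 2
    ring
  have hfl := Nat.floor_le ht
  have hfl2 := Nat.lt_floor_add_one t
  have hpow : r ^ ⌊t⌋₊ ≤ r⁻¹ * Real.exp (- -Real.log r * t) := by
    have h1 : r ^ ⌊t⌋₊ = Real.exp (Real.log r * ⌊t⌋₊) := by
      rw [mul_comm, Real.exp_nat_mul, Real.exp_log hr0]
    have h2 : r⁻¹ = Real.exp (-Real.log r) := by rw [Real.exp_neg, Real.exp_log hr0]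
    rw [h1, h2, ← Real.exp_add, Real.exp_le_exp]
    nlinarith
  rw [hsplit, Matrix.mul_apply, Finset.sum_mul]
  refine (Finset.abs_sum_le_sum_abs _ _).trans (Finset.sum_le_sum fun k _ => ?_)
  rw [abs_mul]
  have h3 := hb ⌊t⌋₊ i k
  rw [← map_ofReal_pow, Matrix.map_apply, Complex.norm_real, Real.norm_eq_abs] at h3
  have h4 : |exp ((t - ⌊t⌋₊) • A) k j| ≤ K₂ :=
    (hK₁ (t - ⌊t⌋₊) ⟨by linarith, by linarith⟩ k j).trans (le_max_left _ _)
  calc _ ≤ (c * r ^ ⌊t⌋₊) * K₂ := mul_le_mul h3 h4 (abs_nonneg _) (by positivity)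
    _ ≤ (c * (r⁻¹ * Real.exp (- -Real.log r * t))) * K₂ := by gcongr
    _ = _ := by ring

/-- Solution of `x' = A x`, `x(0) = b`. -/
noncomputable def expResponse (A : Matrix σ σ ℝ) (b : σ → ℝ) (t : ℝ) : σ → ℝ := exp (t • A) *ᵥ b

theorem hasDerivAt_expResponse (A : Matrix σ σ ℝ) (b : σ → ℝ) (t : ℝ) (i : σ) :
    HasDerivAt (fun t => expResponse A b t i) ((A *ᵥ expResponse A b t) i) t := by
  have h := HasDerivAt.fun_sum (u := Finset.univ) fun j _ =>
    (hasDerivAt_exp_smul_apply A t i j).mul_const (b j)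
  rw [expResponse, Matrix.mulVec_mulVec]
  exact h

theorem continuous_expResponse (A : Matrix σ σ ℝ) (b : σ → ℝ) (i : σ) :
    Continuous fun t => expResponse A b t i :=
  continuous_iff_continuousAt.2 fun t => (hasDerivAt_expResponse A b t i).continuousAt

theorem IsHurwitz.exists_abs_expResponse_le {A : Matrix σ σ ℝ} (hA : IsHurwitz A) (b : σ → ℝ) :
    ∃ K lam : ℝ, 0 < lam ∧ ∀ t, 0 ≤ t → ∀ i,
      |expResponse A b t i| ≤ K * Real.exp (-lam * t) := by
  obtain ⟨K, lam, hK, hlam, h⟩ := hA.exists_abs_exp_le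
  refine ⟨∑ j, K * |b j|, lam, hlam, fun t ht i => ?_⟩
  rw [expResponse, Matrix.mulVec, dotProduct, Finset.sum_mul]
  refine (Finset.abs_sum_le_sum_abs _ _).trans (Finset.sum_le_sum fun j _ => ?_)
  rw [abs_mul]
  calc _ ≤ K * Real.exp (-lam * t) * |b j| :=
        mul_le_mul_of_nonneg_right (h t ht i j) (abs_nonneg _)
    _ = _ := by ring

theorem IsHurwitz.integrableOn_expResponse {A : Matrix σ σ ℝ} (hA : IsHurwitz A) (b : σ → ℝ)
    (i : σ) : MeasureTheory.IntegrableOn (fun t => expResponse A b t i) (Set.Ioi 0) := by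
  obtain ⟨K, lam, hlam, h⟩ := hA.exists_abs_expResponse_le b
  have hint : MeasureTheory.IntegrableOn (fun t => K * Real.exp (-lam * t)) (Set.Ioi 0) :=
    (exp_neg_integrableOn_Ioi 0 hlam).const_mul K
  refine MeasureTheory.Integrable.mono' hint
    (continuous_expResponse A b i).aestronglyMeasurable.restrict ?_
  refine (MeasureTheory.ae_restrict_iff' measurableSet_Ioi).2 (Eventually.of_forall fun t ht => ?_)
  exact h t (le_of_lt ht) i

theorem integrableOn_exp_mul {f : ℝ → ℝ} (hf : MeasureTheory.IntegrableOn f (Set.Ioi 0)) {s : ℂ}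
    (hs : 0 ≤ s.re) :
    MeasureTheory.IntegrableOn (fun t : ℝ => Complex.exp (-(s * t)) * (f t : ℂ)) (Set.Ioi 0) := by
  refine MeasureTheory.Integrable.bdd_mul (c := 1) hf.ofReal ?_ ?_
  · have h : Continuous fun t : ℝ => Complex.exp (-(s * t)) := by fun_prop
    exact h.aestronglyMeasurable.restrict
  · refine (MeasureTheory.ae_restrict_iff' measurableSet_Ioi).2
      (Eventually.of_forall fun t ht => ?_)
    rw [Complex.norm_exp, Real.exp_le_one_iff]
    have : 0 ≤ s.re * t := mul_nonneg hs (le_of_lt ht)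
    simpa using this

/-- The Laplace transform of `exp (tA) b` solves `(sI - A) X = b`. -/
theorem IsHurwitz.laplace_expResponse {A : Matrix σ σ ℝ} (hA : IsHurwitz A) (b : σ → ℝ) {s : ℂ}
    (hs : 0 ≤ s.re) :
    (s • (1 : Matrix σ σ ℂ) - A.map Complex.ofReal) *ᵥ
      (fun i => ∫ t in Set.Ioi (0 : ℝ), Complex.exp (-(s * t)) * (expResponse A b t i : ℂ)) =
      fun i => (b i : ℂ) := by
  funext i
  set x := expResponse A b with hx
  have hint : ∀ j, MeasureTheory.IntegrableOn
      (fun t : ℝ => Complex.exp (-(s * t)) * (x t j : ℂ)) (Set.Ioi 0) := fun j =>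
    integrableOn_exp_mul (hA.integrableOn_expResponse b j) hs
  have hderiv : ∀ t : ℝ, HasDerivAt (fun t : ℝ => Complex.exp (-(s * t)) * (x t i : ℂ))
      (∑ j, (A i j : ℂ) * (Complex.exp (-(s * t)) * (x t j : ℂ)) -
        s * (Complex.exp (-(s * t)) * (x t i : ℂ))) t := by
    intro t
    have h1 : HasDerivAt (fun t : ℝ => Complex.exp (-(s * t)))
        (Complex.exp (-(s * t)) * (-s)) t := by
      have h2 : HasDerivAt (fun t : ℝ => -(s * (t : ℂ))) (-s) t := by
        simpa using ((hasDerivAt_id (t : ℝ)).ofReal_comp.const_mul s).fun_neg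
      exact h2.cexp
    refine (h1.fun_mul (hasDerivAt_expResponse A b t i).ofReal_comp).congr_deriv ?_
    have hsum : ((A *ᵥ x t) i : ℝ) = ∑ j, A i j * x t j := rfl
    rw [← hx, hsum, Complex.ofReal_sum, Finset.mul_sum]
    rw [sub_eq_add_neg, add_comm]
    congr 1
    swap
    · ring
    · exact Finset.sum_congr rfl fun j _ => by rw [Complex.ofReal_mul]; ring
  have hint' : MeasureTheory.IntegrableOn (fun t : ℝ =>
      ∑ j, (A i j : ℂ) * (Complex.exp (-(s * t)) * (x t j : ℂ)) -
        s * (Complex.exp (-(s * t)) * (x t i : ℂ))) (Set.Ioi 0) :=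
    (MeasureTheory.integrable_finsetSum _ fun j _ => (hint j).const_mul _).sub
      ((hint i).const_mul s)
  have hlim : Tendsto (fun t : ℝ => Complex.exp (-(s * t)) * (x t i : ℂ)) atTop (𝓝 0) := by
    obtain ⟨K, lam, hlam, h⟩ := hA.exists_abs_expResponse_le b
    have h0 : Tendsto (fun t : ℝ => K * Real.exp (-lam * t)) atTop (𝓝 0) := by
      have h1 : Tendsto (fun t : ℝ => -lam * t) atTop atBot :=
        tendsto_id.const_mul_atTop_of_neg (neg_lt_zero.2 hlam)
      simpa using (Real.tendsto_exp_atBot.comp h1).const_mul K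
    refine squeeze_zero_norm' ?_ h0
    filter_upwards [eventually_ge_atTop (0 : ℝ)] with t ht
    rw [norm_mul, Complex.norm_real, Real.norm_eq_abs]
    have h2 : ‖Complex.exp (-(s * t))‖ ≤ 1 := by
      rw [Complex.norm_exp, Real.exp_le_one_iff]
      simpa using mul_nonneg hs ht
    exact (mul_le_of_le_one_left (abs_nonneg _) h2).trans (h t ht i)
  have hFTC := MeasureTheory.integral_Ioi_of_hasDerivAt_of_tendsto'
    (fun t _ => hderiv t) hint' hlim
  rw [MeasureTheory.integral_sub
    (MeasureTheory.integrable_finsetSum _ fun j _ => (hint j).const_mul _)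
    ((hint i).const_mul s),
    MeasureTheory.integral_finsetSum _ fun j _ => (hint j).const_mul _] at hFTC
  simp only [MeasureTheory.integral_const_mul] at hFTC
  have hx0 : x 0 i = b i := by simp [hx, expResponse]
  rw [hx0] at hFTC
  rw [Matrix.sub_mulVec, Matrix.smul_mulVec, Matrix.one_mulVec]
  simp only [Pi.sub_apply, Pi.smul_apply, smul_eq_mul]
  have hA' : (A.map Complex.ofReal *ᵥ fun j =>
      ∫ t in Set.Ioi (0 : ℝ), Complex.exp (-(s * t)) * (x t j : ℂ)) i =
      ∑ j, (A i j : ℂ) * ∫ t in Set.Ioi (0 : ℝ), Complex.exp (-(s * t)) * (x t j : ℂ) := by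
    simp [Matrix.mulVec, dotProduct]
  rw [hA']
  simp only [Complex.ofReal_zero, mul_zero, neg_zero, Complex.exp_zero, one_mul, zero_sub] at hFTC
  linear_combination -hFTC

end hurwitz

open Polynomial MeasureTheory

/-! ### Impulse responses of stable rational transfer functions -/

section impulseResponse

/-- Companion matrix of the monic polynomial `q`, with the coefficients in the last row. -/
def companion (q : ℝ[X]) : Matrix (Fin q.natDegree) (Fin q.natDegree) ℝ :=
  Matrix.of fun i j => (if (j : ℕ) = i + 1 then 1 else 0) -
    if (i : ℕ) + 1 = q.natDegree then q.coeff j else 0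

/-- The last unit vector. -/
def companionInput (q : ℝ[X]) : Fin q.natDegree → ℝ :=
  fun i => if (i : ℕ) + 1 = q.natDegree then 1 else 0

theorem companion_mulVec (q : ℝ[X]) (v : Fin q.natDegree → ℂ) (i : Fin q.natDegree) :
    ((companion q).map Complex.ofReal *ᵥ v) i =
      (if h : (i : ℕ) + 1 < q.natDegree then v ⟨i + 1, h⟩ else 0) -
        if (i : ℕ) + 1 = q.natDegree then ∑ j : Fin q.natDegree, (q.coeff j : ℂ) * v j else 0 := by
  have h1 : ((companion q).map Complex.ofReal *ᵥ v) i =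
      ∑ j : Fin q.natDegree, (if (j : ℕ) = i + 1 then v j else 0) -
        ∑ j : Fin q.natDegree, if (i : ℕ) + 1 = q.natDegree then (q.coeff j : ℂ) * v j else 0 := by
    rw [← Finset.sum_sub_distrib, Matrix.mulVec, dotProduct]
    refine Finset.sum_congr rfl fun j _ => ?_
    simp only [companion, Matrix.map_apply, Matrix.of_apply, Complex.ofReal_sub, sub_mul]
    congr 1 <;> split_ifs <;> simp
  rw [h1]
  congr 1
  · split_ifs with h
    · rw [Finset.sum_eq_single ⟨i + 1, h⟩]
      · simp
      · intro j _ hj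
        rw [if_neg fun h' => hj (Fin.ext h')]
      · intro h'; exact absurd (Finset.mem_univ _) h'
    · refine Finset.sum_eq_zero fun j _ => if_neg ?_
      have := j.isLt
      omega
  · split_ifs <;> simp

/-- The vector of powers `sⁱ` solves `(sI - A) v = q(s) b` for the companion matrix `A`. -/
theorem resolvent_companion_mulVec {q : ℝ[X]} (hq : q.Monic) (s : ℂ) :
    (s • (1 : Matrix _ _ ℂ) - (companion q).map Complex.ofReal) *ᵥ
        (fun i : Fin q.natDegree => s ^ (i : ℕ)) =
      aeval s q • fun i => (companionInput q i : ℂ) := by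
  funext i
  rw [Matrix.sub_mulVec, Matrix.smul_mulVec, Matrix.one_mulVec, Pi.sub_apply, companion_mulVec]
  simp only [Pi.smul_apply, smul_eq_mul, companionInput]
  have hi := i.isLt
  by_cases h : (i : ℕ) + 1 = q.natDegree
  · rw [dif_neg (by omega), if_pos h, if_pos h,
      Polynomial.aeval_eq_sum_range' (Nat.lt_succ_self q.natDegree), Finset.sum_range_succ,
      Finset.sum_range, hq.coeff_natDegree]
    have h1 : s ^ q.natDegree = s * s ^ (i : ℕ) := by
      rw [← pow_succ']
      exact congrArg (s ^ ·) h.symm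
    simp [h1]
    ring
  · rw [dif_pos (by omega), if_neg h, if_neg h]
    simp [pow_succ']

theorem isHurwitz_companion {q : ℝ[X]} (hq : q.Monic)
    (hroots : ∀ s : ℂ, aeval s q = 0 → s.re < 0) : IsHurwitz (companion q) := by
  intro μ v hv he
  have hn : 0 < q.natDegree := by
    by_contra h0
    exact hv (funext fun i => absurd i.isLt (by omega))
  have hvi : ∀ k (hk : k < q.natDegree), v ⟨k, hk⟩ = v ⟨0, hn⟩ * μ ^ k := by
    intro k
    induction k with
    | zero => intro hk; simp
    | succ k ih =>
      intro hk
      have h1 := congrFun he ⟨k, by omega⟩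
      rw [companion_mulVec, dif_pos hk, if_neg (by simp; omega), sub_zero] at h1
      rw [h1, Pi.smul_apply, smul_eq_mul, ih (by omega), pow_succ]
      ring
  have hv' : v = v ⟨0, hn⟩ • fun i : Fin q.natDegree => μ ^ (i : ℕ) :=
    funext fun i => hvi i i.isLt
  have hv0 : v ⟨0, hn⟩ ≠ 0 := fun h0 => hv (by rw [hv', h0, zero_smul])
  have h1 : (μ • (1 : Matrix _ _ ℂ) - (companion q).map Complex.ofReal) *ᵥ v = 0 := by
    rw [Matrix.sub_mulVec, Matrix.smul_mulVec, Matrix.one_mulVec, he, sub_self]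
  rw [hv', Matrix.mulVec_smul, resolvent_companion_mulVec hq] at h1
  have h2 := congrFun h1 ⟨q.natDegree - 1, by omega⟩
  have h3 : q.natDegree - 1 + 1 = q.natDegree := by omega
  simp only [Pi.smul_apply, smul_eq_mul, companionInput, if_pos h3, Complex.ofReal_one, mul_one,
    Pi.zero_apply] at h2
  exact hroots μ ((mul_eq_zero.1 h2).resolve_left hv0)

/-- The impulse response in terms of the companion realization of `G - G(∞)`. -/
noncomputable def companionResponse (G : RatFunc ℝ) (t : ℝ) : ℝ :=
  ∑ i : Fin G.denom.natDegree, (G.num.coeff i - feedthrough G * G.denom.coeff i) *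
    expResponse (companion G.denom) (companionInput G.denom) t i

theorem isImpulseResponse_companionResponse {G : RatFunc ℝ} (hG : IsStable G)
    (hGp : IsProper G) : IsImpulseResponse G (companionResponse G) := by
  have hq : G.denom.Monic := RatFunc.monic_denom G
  have hA := isHurwitz_companion hq hG
  refine ⟨?_, ?_, ?_⟩
  · refine Continuous.continuousOn ?_
    exact continuous_finsetSum _ fun i _ => continuous_const.mul (continuous_expResponse _ _ i)
  · exact integrable_finsetSum _ fun i _ => (hA.integrableOn_expResponse _ i).const_mul _
  · intro s hs
    have hq0 : aeval s G.denom ≠ 0 := fun h => absurd (hG s h) (not_lt.2 hs)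
    have hL := hA.laplace_expResponse (companionInput G.denom) hs
    set Lx : Fin G.denom.natDegree → ℂ := fun i => ∫ t in Set.Ioi (0 : ℝ),
      Complex.exp (-(s * t)) *
        (expResponse (companion G.denom) (companionInput G.denom) t i : ℂ) with hLx
    -- `s` is not an eigenvalue of the companion matrix, so the resolvent equation has only one
    -- solution.
    have hpow : ∀ i, Lx i = s ^ (i : ℕ) / aeval s G.denom := by
      have h1 : (s • (1 : Matrix _ _ ℂ) - (companion G.denom).map Complex.ofReal) *ᵥ
          (Lx - (aeval s G.denom)⁻¹ • fun i : Fin G.denom.natDegree => s ^ (i : ℕ)) = 0 := by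
        rw [Matrix.mulVec_sub, hL, Matrix.mulVec_smul, resolvent_companion_mulVec hq, smul_smul,
          inv_mul_cancel₀ hq0, one_smul, sub_self]
      have h2 : Lx - (aeval s G.denom)⁻¹ • (fun i : Fin G.denom.natDegree => s ^ (i : ℕ)) = 0 := by
        by_contra hne
        refine absurd (hA s _ hne ?_) (not_lt.2 hs)
        rw [Matrix.sub_mulVec, Matrix.smul_mulVec, Matrix.one_mulVec, sub_eq_zero] at h1
        exact h1.symm
      intro i
      have h3 := congrFun (sub_eq_zero.1 h2) i
      rw [h3, Pi.smul_apply, smul_eq_mul, div_eq_inv_mul]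
    have hint : ∫ t in Set.Ioi (0 : ℝ), Complex.exp (-(s * t)) * (companionResponse G t : ℂ) =
        ∑ i : Fin G.denom.natDegree,
          ((G.num.coeff i - feedthrough G * G.denom.coeff i : ℝ) : ℂ) * Lx i := by
      have h1 : ∀ t : ℝ, Complex.exp (-(s * t)) * (companionResponse G t : ℂ) =
          ∑ i : Fin G.denom.natDegree,
            ((G.num.coeff i - feedthrough G * G.denom.coeff i : ℝ) : ℂ) *
            (Complex.exp (-(s * t)) *
            (expResponse (companion G.denom) (companionInput G.denom) t i : ℂ)) := by
        intro t
        rw [companionResponse, Complex.ofReal_sum, Finset.mul_sum]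
        refine Finset.sum_congr rfl fun i _ => ?_
        rw [Complex.ofReal_mul]; ring
      simp only [h1]
      rw [integral_finsetSum _ fun i _ => (integrableOn_exp_mul
        (hA.integrableOn_expResponse _ i) hs).const_mul _]
      simp only [integral_const_mul, hLx]
    have hnum : G.num.natDegree < G.denom.natDegree + 1 :=
      Nat.lt_succ_of_le (Polynomial.natDegree_le_natDegree hGp)
    have heval : G.eval (algebraMap ℝ ℂ) s = aeval s G.num / aeval s G.denom := rfl
    have hsum : ∑ i : Fin G.denom.natDegree,
        ((G.num.coeff i - feedthrough G * G.denom.coeff i : ℝ) : ℂ) * s ^ (i : ℕ) =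
        aeval s G.num - (feedthrough G : ℂ) * aeval s G.denom := by
      rw [Polynomial.aeval_eq_sum_range' hnum,
        Polynomial.aeval_eq_sum_range' (Nat.lt_succ_self G.denom.natDegree),
        Finset.sum_range_succ, Finset.sum_range_succ, hq.coeff_natDegree, Finset.sum_range,
        Finset.sum_range, mul_add, Finset.mul_sum]
      have h1 : ∀ i : Fin G.denom.natDegree,
          ((G.num.coeff i - feedthrough G * G.denom.coeff i : ℝ) : ℂ) * s ^ (i : ℕ) =
          G.num.coeff i • s ^ (i : ℕ) -
            (feedthrough G : ℂ) * G.denom.coeff i • s ^ (i : ℕ) := by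
        intro i
        simp only [Complex.real_smul, Complex.ofReal_sub, Complex.ofReal_mul]
        ring
      have h2 : G.num.coeff G.denom.natDegree = feedthrough G := rfl
      rw [Finset.sum_congr rfl fun i _ => h1 i, Finset.sum_sub_distrib, h2]
      simp only [Complex.real_smul, one_smul]
      ring
    rw [hint, heval]
    simp only [hpow, mul_div_assoc']
    rw [← Finset.sum_div, hsum, sub_div, mul_div_cancel_right₀ _ hq0]

/-- Fourier inversion on the imaginary axis: the Laplace transform determines a continuous
integrable function on `[0, ∞)`. -/
theorem IsImpulseResponse.eqOn {G : RatFunc ℝ} {α β : ℝ → ℝ} (hα : IsImpulseResponse G α)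
    (hβ : IsImpulseResponse G β) : Set.EqOn α β (Set.Ici 0) := by
  let f : ℝ → ℂ := (Set.Ioi (0 : ℝ)).indicator fun t => ((α t - β t : ℝ) : ℂ)
  have hint : IntegrableOn (fun t => α t - β t) (Set.Ioi 0) := hα.integrable.sub hβ.integrable
  have hf : Integrable f := (integrable_indicator_iff measurableSet_Ioi).2 hint.ofReal
  have hF : FourierTransform.fourier f = 0 := by
    funext w
    rw [Real.fourier_real_eq_integral_exp_smul]
    set s : ℂ := ((2 * Real.pi * w : ℝ) : ℂ) * Complex.I with hs
    have hs0 : 0 ≤ s.re := by simp [hs]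
    have h1 : ∀ v : ℝ, Complex.exp (↑(-2 * Real.pi * v * w) * Complex.I) • f v =
        (Set.Ioi (0 : ℝ)).indicator
          (fun t : ℝ => Complex.exp (-(s * t)) * ((α t - β t : ℝ) : ℂ)) v := by
      intro v
      by_cases hv : v ∈ Set.Ioi (0 : ℝ)
      · rw [Set.indicator_of_mem hv]
        simp only [f, Set.indicator_of_mem hv, smul_eq_mul]
        congr 2
        rw [hs]; push_cast; ring
      · rw [Set.indicator_of_notMem hv]
        simp only [f, Set.indicator_of_notMem hv, smul_zero]
    simp only [h1]
    rw [integral_indicator measurableSet_Ioi]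
    have h2 : ∀ t : ℝ, Complex.exp (-(s * t)) * ((α t - β t : ℝ) : ℂ) =
        Complex.exp (-(s * t)) * (α t : ℂ) - Complex.exp (-(s * t)) * (β t : ℂ) := by
      intro t; push_cast; ring
    simp only [h2]
    rw [integral_sub (integrableOn_exp_mul hα.integrable hs0)
      (integrableOn_exp_mul hβ.integrable hs0), hα.laplace s hs0, hβ.laplace s hs0, sub_self]
    rfl
  have hpos : Set.EqOn α β (Set.Ioi 0) := by
    intro t ht
    have hcont : ContinuousAt f t := by
      have h1 : ContinuousAt (fun t => ((α t - β t : ℝ) : ℂ)) t := by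
        have ha := hα.cont.continuousAt (Ici_mem_nhds ht)
        have hb := hβ.cont.continuousAt (Ici_mem_nhds ht)
        exact Complex.continuous_ofReal.continuousAt.comp (ha.sub hb)
      refine h1.congr ?_
      filter_upwards [Ioi_mem_nhds ht] with v hv
      exact (Set.indicator_of_mem (f := fun t => ((α t - β t : ℝ) : ℂ)) hv).symm
    have h2 := hf.fourierInv_fourier_eq (by rw [hF]; exact integrable_zero _ _ _) hcont
    have h3 : FourierTransformInv.fourierInv (0 : ℝ → ℂ) t = 0 := by
      rw [Real.fourierInv_eq]
      simp
    rw [hF, h3] at h2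
    have h4 : f t = ((α t - β t : ℝ) : ℂ) :=
      Set.indicator_of_mem (f := fun t => ((α t - β t : ℝ) : ℂ)) ht
    rw [h4] at h2
    exact sub_eq_zero.1 (Complex.ofReal_eq_zero.1 h2.symm)
  exact hpos.of_subset_closure hα.cont hβ.cont Set.Ioi_subset_Ici_self
    (by rw [closure_Ioi])

theorem impulseResponse_eqOn {G : RatFunc ℝ} (hG : IsStable G) (hGp : IsProper G) :
    Set.EqOn (impulseResponse G) (companionResponse G) (Set.Ici 0) := by
  have h := isImpulseResponse_companionResponse hG hGp
  exact IsImpulseResponse.eqOn (Classical.epsilon_spec ⟨_, h⟩) h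

end impulseResponse

/-! ### Step-invariant discretization -/

section discretization

theorem hold_eq {δ : ℝ} (hδ : 0 < δ) (ψ : Sig Unit) {n : ℕ} {t : ℝ} (h1 : n * δ ≤ t)
    (h2 : t < (n + 1) * δ) : hold δ ψ t = ψ n () := by
  rw [hold, tsum_eq_single n]
  · rw [Set.indicator_of_mem, mul_one]
    exact ⟨by linarith, by linarith⟩
  · intro m hm
    rw [Set.indicator_of_notMem, mul_zero]
    rintro ⟨h3, h4⟩
    apply hm
    have h5 : (m : ℝ) < n + 1 := by
      by_contra! h
      nlinarith
    have h6 : (n : ℝ) < m + 1 := by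
      by_contra! h
      nlinarith
    have h5' : m < n + 1 := by exact_mod_cast h5
    have h6' : n < m + 1 := by exact_mod_cast h6
    omega

/-- Over the `j`-th sampling period, the exponential response integrates to `exp (δA)ʲ` times
its integral over the first period. -/
theorem integral_expResponse {σ : Type} [Fintype σ] [DecidableEq σ] (A : Matrix σ σ ℝ)
    (b : σ → ℝ) (δ : ℝ) (j : ℕ) (i : σ) :
    ∫ τ in (j * δ)..((j + 1) * δ), expResponse A b τ i =
      (exp (δ • A) ^ j *ᵥ fun i => ∫ τ in (0 : ℝ)..δ, expResponse A b τ i) i := by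
  have h1 : ∫ τ in (j * δ)..((j + 1) * δ), expResponse A b τ i =
      ∫ τ in (0 : ℝ)..δ, expResponse A b (τ + j * δ) i := by
    rw [intervalIntegral.integral_comp_add_right (fun τ => expResponse A b τ i)]
    congr 1 <;> ring
  have h2 : ∀ τ, expResponse A b (τ + j * δ) i =
      ∑ k, (exp (δ • A) ^ j) i k * expResponse A b τ k := by
    intro τ
    rw [expResponse, add_comm, exp_add_smul, exp_natCast_mul_smul, ← Matrix.mulVec_mulVec]
    rfl
  rw [h1]
  simp only [h2]
  rw [intervalIntegral.integral_finsetSum fun k _ =>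
    ((continuous_expResponse A b k).const_mul _).intervalIntegrable _ _]
  simp only [intervalIntegral.integral_const_mul]
  rfl

/-- Sampling behind a zero-order hold keeps finite dimension and stability: if the impulse
response is `C exp(tA) b`, the state matrix is `exp(δA)` and the input matrix is
`∫₀^δ exp(tA) b dt`. -/
theorem hasStableRealization_sampled {G : RatFunc ℝ} (hG : IsStable G) (hGp : IsProper G)
    {δ : ℝ} (hδ : 0 < δ) :
    HasStableRealization (fun ψ => sampler δ (ctSystem G (hold δ ψ)))
      (Matrix.of fun _ _ => feedthrough G) := by
  set A := companion G.denom with hAdef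
  set b := companionInput G.denom with hbdef
  set c : Fin G.denom.natDegree → ℝ := fun i =>
    G.num.coeff i - feedthrough G * G.denom.coeff i with hc
  have hA : IsHurwitz A := isHurwitz_companion (RatFunc.monic_denom G) hG
  refine ⟨Fin G.denom.natDegree, inferInstance, inferInstance, exp (δ • A),
    Matrix.of fun i _ => ∫ τ in (0 : ℝ)..δ, expResponse A b τ i, Matrix.of fun _ i => c i,
    hA.isSchur_exp hδ, ?_⟩
  funext ψ n u
  have hα := impulseResponse_eqOn hG hGp
  have hresp : ∀ τ, companionResponse G τ = ∑ i, c i * expResponse A b τ i := fun τ => rfl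
  have hcont : Continuous (companionResponse G) :=
    continuous_finsetSum _ fun i _ => continuous_const.mul (continuous_expResponse _ _ i)
  have hpiece : ∀ j < n, Set.EqOn
      (fun τ => impulseResponse G τ * hold δ ψ (n * δ - τ))
      (fun τ => companionResponse G τ * ψ (n - 1 - j) ())
      (Set.uIoc (j * δ) (((j + 1 : ℕ) : ℝ) * δ)) := by
    intro j hj τ hτ
    rw [Set.uIoc_of_le (by push_cast; nlinarith)] at hτ
    have hτ0 : 0 ≤ τ := le_trans (by positivity) hτ.1.le
    have hcast : ((n - 1 - j : ℕ) : ℝ) = n - 1 - j := by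
      rw [Nat.sub_sub, Nat.cast_sub (by omega)]; push_cast; ring
    have h2 := hτ.2
    have h1 := hτ.1
    push_cast at h2
    simp only []
    rw [hα hτ0, hold_eq hδ ψ (n := n - 1 - j)]
    · rw [hcast]; linarith
    · rw [hcast]; linarith
  have hval : ∀ j < n, ∫ τ in (j * δ)..(((j + 1 : ℕ) : ℝ) * δ),
      impulseResponse G τ * hold δ ψ (n * δ - τ) =
      (∑ i, c i * (exp (δ • A) ^ j *ᵥ fun i => ∫ τ in (0 : ℝ)..δ, expResponse A b τ i) i) *
        ψ (n - 1 - j) () := by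
    intro j hj
    rw [intervalIntegral.integral_congr_ae (Eventually.of_forall fun τ hτ => hpiece j hj hτ),
      intervalIntegral.integral_mul_const]
    congr 1
    simp only [hresp]
    rw [intervalIntegral.integral_finsetSum fun k _ =>
      ((continuous_expResponse A b k).const_mul _).intervalIntegrable _ _]
    refine Finset.sum_congr rfl fun i _ => ?_
    rw [intervalIntegral.integral_const_mul, ← integral_expResponse]
    push_cast
    rfl
  have hint : ∀ j < n, IntervalIntegrable
      (fun τ => impulseResponse G τ * hold δ ψ (n * δ - τ)) volume (j * δ)
      (((j + 1 : ℕ) : ℝ) * δ) := by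
    intro j hj
    rw [intervalIntegrable_iff]
    refine IntegrableOn.congr_fun ?_ (hpiece j hj).symm measurableSet_uIoc
    exact intervalIntegrable_iff.1 ((hcont.mul continuous_const).intervalIntegrable _ _)
  have htot : ∫ τ in (0 : ℝ)..(n * δ), impulseResponse G τ * hold δ ψ (n * δ - τ) =
      ∑ j ∈ Finset.range n,
        (∑ i, c i * (exp (δ • A) ^ j *ᵥ fun i => ∫ τ in (0 : ℝ)..δ, expResponse A b τ i) i) *
          ψ (n - 1 - j) () := by
    have h1 := intervalIntegral.sum_integral_adjacent_intervals (a := fun k : ℕ => (k : ℝ) * δ) hint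
    rw [Nat.cast_zero, zero_mul] at h1
    rw [← h1]
    exact Finset.sum_congr rfl fun j hj => hval j (Finset.mem_range.1 hj)
  have hn : hold δ ψ (n * δ) = ψ n () := hold_eq hδ ψ le_rfl (by linarith)
  simp only [sampler, ctSystem]
  rw [htot, hn]
  simp only [ss]
  rw [ssState_eq_sum, Matrix.mulVec_sum, Pi.add_apply, Finset.sum_apply, add_comm]
  congr 1
  · refine Finset.sum_congr rfl fun j _ => ?_
    rw [Matrix.mulVec_mulVec]
    have h1 := mulVec_unit ((Matrix.of fun (_ : Unit) i => c i) * (exp (δ • A) ^ j *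
      Matrix.of fun i (_ : Unit) => ∫ τ in (0 : ℝ)..δ, expResponse A b τ i))
      (ψ (n - 1 - j) ()) u
    refine Eq.trans ?_ h1.symm
    rfl
  · exact (mulVec_unit (Matrix.of fun (_ : Unit) (_ : Unit) => feedthrough G) (ψ n ()) u).symm

theorem IsStrictlyProper.isProper {G : RatFunc ℝ} (h : IsStrictlyProper G) : IsProper G :=
  le_of_lt h

theorem IsStrictlyProper.feedthrough_eq_zero {G : RatFunc ℝ} (h : IsStrictlyProper G) :
    feedthrough G = 0 := by
  refine Polynomial.coeff_eq_zero_of_degree_lt (lt_of_lt_of_le h ?_)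
  exact Polynomial.degree_le_natDegree

theorem exists_hasStableRealization_fastLift {G : RatFunc ℝ} (hG : IsStable G) (hGp : IsProper G)
    {h : ℝ} (hh : 0 < h) {N : ℕ} (hN : 0 < N) :
    ∃ D : Matrix (Fin N) (Fin N) ℝ, HasStableRealization (fastLift h N G) D ∧
      (feedthrough G = 0 → rowFirst N * D = 0) := by
  have hδ : 0 < h / N := div_pos hh (by exact_mod_cast hN)
  obtain ⟨D, hD, hD0⟩ := (hasStableRealization_sampled hG hGp hδ).lift hN
  refine ⟨D, hD, fun h0 => hD0 ?_⟩
  ext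
  exact h0

theorem exists_realization_sysT1 {Kc F : RatFunc ℝ} (hKc : IsStable Kc) (hKc_proper : IsProper Kc)
    (hF : IsStable F) (hF_proper : IsProper F) {h : ℝ} (hh : 0 < h) {N : ℕ} (hN : 0 < N) (d : ℕ) :
    ∃ (n : ℕ) (A : Matrix (Fin n) (Fin n) ℝ) (B : Matrix (Fin n) (Fin N) ℝ)
      (C : Matrix (Fin N) (Fin n) ℝ) (D : Matrix (Fin N) (Fin N) ℝ),
      IsSchur A ∧ sysT1 h N d Kc F = ss A B C D ∧ (0 < d → D = 0) := by
  obtain ⟨DK, hK, -⟩ := exists_hasStableRealization_fastLift hKc hKc_proper hh hN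
  obtain ⟨DF, hDF, -⟩ := exists_hasStableRealization_fastLift hF hF_proper hh hN
  obtain ⟨n, A, B, C, hA, hG⟩ := ((hK.comp hDF).delay d).exists_fin
  exact ⟨n, A, B, C, _, hA, hG, fun hd => if_neg hd.ne'⟩

theorem exists_realization_sysT2 {F : RatFunc ℝ} (hF : IsStable F)
    (hF_proper : IsStrictlyProper F) {h : ℝ} (hh : 0 < h) {N : ℕ} (hN : 0 < N) :
    ∃ (n : ℕ) (A : Matrix (Fin n) (Fin n) ℝ) (B : Matrix (Fin n) (Fin N) ℝ)
      (C : Matrix Unit (Fin n) ℝ), IsSchur A ∧ sysT2 h N F = ss A B C 0 := by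
  obtain ⟨D, hD, hD0⟩ := exists_hasStableRealization_fastLift hF hF_proper.isProper hh hN
  have h1 := hD.gain (rowFirst N)
  rw [hD0 hF_proper.feedthrough_eq_zero] at h1
  exact h1.exists_fin

end discretization

end SampledData


theorem mainTheorem2 (h : ℝ) (hh : 0 < h) (Kc F : RatFunc ℝ)
    (hKc : SampledData.IsStable Kc) (hKc_proper : SampledData.IsProper Kc)
    (hF : SampledData.IsStable F) (hF_proper : SampledData.IsStrictlyProper F)
    (M : ℕ) [NeZero M] (d : ℕ) :
    -- stable finite-dimensional realizations of `T₁` and `T₂` exist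
    (∀ N : ℕ, 0 < N →
      (∃ (n₁ : ℕ) (A₁ : Matrix (Fin n₁) (Fin n₁) ℝ) (B₁ : Matrix (Fin n₁) (Fin N) ℝ)
          (C₁ : Matrix (Fin N) (Fin n₁) ℝ) (D₁ : Matrix (Fin N) (Fin N) ℝ),
        SampledData.IsSchur A₁ ∧
        SampledData.sysT1 h N d Kc F = SampledData.ss A₁ B₁ C₁ D₁ ∧ (0 < d → D₁ = 0)) ∧
      (∃ (n₂ : ℕ) (A₂ : Matrix (Fin n₂) (Fin n₂) ℝ) (B₂ : Matrix (Fin n₂) (Fin N) ℝ)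
          (C₂ : Matrix Unit (Fin n₂) ℝ),
        SampledData.IsSchur A₂ ∧
        SampledData.sysT2 h N F = SampledData.ss A₂ B₂ C₂ 0)) ∧
    -- single rate
    (∀ N : ℕ, 0 < N →
      ∀ (n₁ : ℕ) (A₁ : Matrix (Fin n₁) (Fin n₁) ℝ) (B₁ : Matrix (Fin n₁) (Fin N) ℝ)
        (C₁ : Matrix (Fin N) (Fin n₁) ℝ) (D₁ : Matrix (Fin N) (Fin N) ℝ)
        (n₂ : ℕ) (A₂ : Matrix (Fin n₂) (Fin n₂) ℝ) (B₂ : Matrix (Fin n₂) (Fin N) ℝ)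
        (C₂ : Matrix Unit (Fin n₂) ℝ),
        SampledData.IsSchur A₁ → SampledData.IsSchur A₂ →
        SampledData.sysT1 h N d Kc F = SampledData.ss A₁ B₁ C₁ D₁ →
        SampledData.sysT2 h N F = SampledData.ss A₂ B₂ C₂ 0 →
        SampledData.ReducesToLMI
          (fun a : Fin M → ℝ => SampledData.errSys h N d Kc F a)
          (SampledData.blockA A₁ A₂ C₂ (SampledData.firA M) (SampledData.firB M))
          (SampledData.blockB (M - 1) B₁ B₂)
          (fun a => SampledData.blockC C₁ C₂
            (SampledData.colOnes N * SampledData.firC a)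
            (SampledData.colOnes N * SampledData.firD a))
          (fun _ => D₁)) ∧
    -- multi-rate, with `N = L p`
    (∀ L p : ℕ, 2 ≤ L → 0 < p →
      ∀ (n₁ : ℕ) (A₁ : Matrix (Fin n₁) (Fin n₁) ℝ) (B₁ : Matrix (Fin n₁) (Fin (L * p)) ℝ)
        (C₁ : Matrix (Fin (L * p)) (Fin n₁) ℝ) (D₁ : Matrix (Fin (L * p)) (Fin (L * p)) ℝ)
        (n₂ : ℕ) (A₂ : Matrix (Fin n₂) (Fin n₂) ℝ) (B₂ : Matrix (Fin n₂) (Fin (L * p)) ℝ)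
        (C₂ : Matrix Unit (Fin n₂) ℝ),
        SampledData.IsSchur A₁ → SampledData.IsSchur A₂ →
        SampledData.sysT1 h (L * p) d Kc F = SampledData.ss A₁ B₁ C₁ D₁ →
        SampledData.sysT2 h (L * p) F = SampledData.ss A₂ B₂ C₂ 0 →
        SampledData.ReducesToLMI
          (fun a : Fin M → ℝ => SampledData.errSysMR h L p d Kc F a)
          (SampledData.blockA A₁ A₂ C₂ (SampledData.firA M ^ L)
            (SampledData.firA M ^ (L - 1) * SampledData.firB M))
          (SampledData.blockB (M - 1) B₁ B₂)
          (fun a => SampledData.blockC C₁ C₂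
            (SampledData.blkOnes L p * SampledData.liftedC L a)
            (SampledData.blkOnes L p * SampledData.liftedD L a))
          (fun _ => D₁)) := by
  open SampledData in
  exact ⟨fun N hN =>
      ⟨exists_realization_sysT1 hKc hKc_proper hF hF_proper.isProper hh hN d,
        exists_realization_sysT2 hF hF_proper hh hN⟩,
    fun N hN _ _ _ _ _ _ _ _ _ h₁ h₂ hT₁ hT₂ =>
      have : NeZero N := ⟨hN.ne'⟩
      reducesToLMI_errSys h₁ h₂ hT₁ hT₂,
    fun L p hL hp _ _ _ _ _ _ _ _ _ h₁ h₂ hT₁ hT₂ =>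
      reducesToLMI_errSysMR (by omega) hp h₁ h₂ hT₁ hT₂⟩
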